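/- Let $\mathbf k$ be a field of characteristic $0$. A cyclic $\mathbb S$-module $\mathcal V$ is a sequence of chain complexes $\mathcal V((n))$ ($\mathbb Z$-graded) of $\mathbf k$-vector spaces with actions of the symmetric groups $S_n$. Let $\Lambda=\varprojlim_r \mathbb Z[[x_1,\dots,x_r]]^{S_r}$ be the ring of symmetric functions, $p_n=\sum_i x_i^n$ the power sums, so that $\Lambda$ sits in $\mathbf k[[p_1,p_2,\dots]]$, and let $h_2=\tfrac12(p_1^2+p_2)$, $e_2=\tfrac12(p_1^2-p_2)$. If every $\mathcal V((n))$ has finite total dimension, the characteristic of $\mathcal V$ is $$\mathrm{Ch}(\mathcal V)=\sum_{n\ge1}\ \sum_{i\in\mathbb Z}(-1)^i\,\frac1{n!}\sum_{\sigma\in S_n}\mathrm{Tr}_{\mathcal V((n))_i}(\sigma)\,\psi(\sigma),\qquad \psi(\sigma)=p_{a_1}\cdots p_{a_\ell},$$ where $a_1,\dots,a_\ell$ are the cycle lengths of $\sigma$. It depends only on the underlying graded $\mathbb S$-module. Let $\mathbb T\mathcal V((n))=\bigoplus_T\bigotimes_{v}\mathcal V((v))$ be the sum over isomorphism classes of trees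 $T$ with $n$ labelled legs, at least one vertex, and all vertices of valence $\ge3$, of the unordered graded tensor product (with Koszul signs) over the vertices $v$ of $T$, where $\mathcal V((v))$ denotes $\mathcal V((m))$ with its $m$ inputs labelled by the $m$ flags at $v$; $S_n$ acts by relabelling the legs. Plethysm $f\circ g$ is the substitution $p_n\mapsto g(p_n,p_{2n},p_{3n},\dots)$ into $f=f(p_1,p_2,\dots)$ (for $g$ without constant term). Let $\Lambda_*$ be the set of $f\in\mathbf k[[p_1,p_2,\dots]]$ whose image under $p_1\mapsto x$, $p_n\mapsto0$ $(n>1)$ has the form $\sum_{n\ge2}a_nx^n/n!$ with $a_2\ne0$. For $f\in\Lambda_*$, the Legendre transform $\mathcal Lf$ is the unique $g\in\Lambda_*$ with $$g\circ\frac{\partial f}{\partial p_1}+f=p_1\frac{\partial f}{\partial p_1}.$$ **Theorem.** Let $\mathcal V$ be a cyclic $\mathbb S$-module such that $\mathcal V((n))=0$ for $n\le2$ and $\mathcal V((n))$ is finite-dimensional for all $n$. Then every $\mathbb T\mathcal V((n))$ is finite-dimensional, the elements $$f=e_2-\mathrm{Ch}(\mathcal V)\qquad\text{and}\qquad g=h_2+\mathrm{Ch}(\mathbb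 T\mathcal V)$$ lie in $\Lambda\cap\Lambda_*$, and $g=\mathcal Lf$; that is, $g$ is the unique element of $\Lambda_*$ satisfying the displayed equation. -/

import Mathlib

open CategoryTheory DirectSum TensorProduct

universe u w

/-! ## Symmetric functions in power-sum coordinates -/

/-- The (completed) ring of symmetric functions with coefficients in `k`, written in the power sums:
`Λ ⊗ k = k⟦p₁, p₂, …⟧`. The variable `X n` is the power sum `p_n`. As `p_n` has degree `n`, there
are finitely many monomials of each degree, so the power series ring is the degree-completion. -/
abbrev SymFun (k : Type u) : Type u := MvPowerSeries ℕ+ k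

namespace SymFun

noncomputable section

variable {k : Type u} [Field k]

/-- The power sum `p_n`, for `n ≥ 1`. -/
def p (n : ℕ+) : SymFun k := MvPowerSeries.X n

/-- The complete symmetric function `h₂ = (p₁² + p₂) / 2`. -/
def h₂ : SymFun k := (2 : k)⁻¹ • (p 1 ^ 2 + p 2)

/-- The elementary symmetric function `e₂ = (p₁² - p₂) / 2`. -/
def e₂ : SymFun k := (2 : k)⁻¹ • (p 1 ^ 2 - p 2)

/-- The partial derivative `∂f/∂p₁`. -/
def dp₁ (f : SymFun k) : SymFun k := MvPowerSeries.pderiv k (1 : ℕ+) f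

/-- `p_n ∘ g = g(p_n, p_{2n}, p_{3n}, …)`. -/
def adams (n : ℕ+) (g : SymFun k) : SymFun k :=
  MvPowerSeries.subst (fun m : ℕ+ => (p (n * m) : SymFun k)) g

/-- Plethysm `f ∘ g`: substitute `p_n ∘ g` for `p_n` in `f = f(p₁, p₂, …)`. It is used (and
meaningful for all `f`) when `g` has zero constant term. -/
def plethysm (f g : SymFun k) : SymFun k :=
  MvPowerSeries.subst (fun n : ℕ+ => adams n g) f

/-- The rank homomorphism `rk : p₁ ↦ x`, `p_n ↦ 0` for `n > 1`. -/
def rk (f : SymFun k) : PowerSeries k :=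
  PowerSeries.mk fun n => MvPowerSeries.coeff (Finsupp.single (1 : ℕ+) n) f

/-- The set `Λ_*` of symmetric functions `f` such that `rk f = ∑_{n ≥ 2} a_n xⁿ / n!`
with `a₂ ≠ 0`. -/
def LambdaStar (k : Type u) [Field k] : Set (SymFun k) :=
  {f | PowerSeries.coeff 0 (rk f) = 0 ∧ PowerSeries.coeff 1 (rk f) = 0 ∧
    PowerSeries.coeff 2 (rk f) ≠ 0}

/-- The equation `g ∘ ∂f/∂p₁ + f = p₁ ∂f/∂p₁`. -/
def LegendreEquation (f g : SymFun k) : Prop :=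
  plethysm g (dp₁ f) + f = p 1 * dp₁ f

/-- `g` is the Legendre transform of `f`: both belong to `Λ_*`, and `g` is the unique element of
`Λ_*` with `g ∘ ∂f/∂p₁ + f = p₁ ∂f/∂p₁`. -/
def IsLegendreTransform (f g : SymFun k) : Prop :=
  f ∈ LambdaStar k ∧ g ∈ LambdaStar k ∧ LegendreEquation f g ∧
    ∀ g' ∈ LambdaStar k, LegendreEquation f g' → g' = g

open Classical in
/-- The power sum `p_n = ∑ᵢ xᵢⁿ` as a power series in the variables `x₀, x₁, x₂, …`. -/
def powerSumX (n : ℕ+) : MvPowerSeries ℕ k :=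
  fun m => if ∃ i : ℕ, m = Finsupp.single i (n : ℕ) then 1 else 0

/-- The expansion of a symmetric function as a power series in the variables `x₀, x₁, x₂, …`. -/
def toX (f : SymFun k) : MvPowerSeries ℕ k :=
  MvPowerSeries.subst (fun n : ℕ+ => (powerSumX n : MvPowerSeries ℕ k)) f

/-- `f` lies in the ring `Λ = lim ℤ⟦x₁, …, x_r⟧^{S_r}` of symmetric functions with integer
coefficients: all coefficients of its expansion in the variables `xᵢ` are integers. -/
def IsIntegral (f : SymFun k) : Prop :=
  ∀ m : ℕ →₀ ℕ, ∃ z : ℤ, MvPowerSeries.coeff m (toX f) = (z : k)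

/-- The cycle index `ψ(σ) = p_{a₁} ⋯ p_{a_l}`, where `a₁, …, a_l` are the lengths of the cycles of
`σ` (fixed points included). -/
def cycleIndex {n : ℕ} (σ : Equiv.Perm (Fin n)) : SymFun k :=
  (σ.partition.parts.map fun a => (p a.toPNat' : SymFun k)).prod

end

end SymFun

/-! ## Cyclic modules and their characteristics -/

/-- A (differential graded) cyclic `S`-module, indexed by the number of legs: for each `n`, a chain
complex `𝒱((n))` of `k`-vector spaces with an action of the symmetric group on `n` letters. -/
abbrev CyclicModule (k : Type u) [Field k] : Type _ :=
  ∀ n : ℕ, ChainComplex (Rep.{w} k (Equiv.Perm (Fin n))) ℤ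

/-- A graded cyclic `S`-module: for each `n`, a graded representation of the symmetric group on `n`
letters. -/
abbrev GradedCyclicModule (k : Type u) [Field k] : Type _ :=
  ∀ n : ℕ, ℤ → Rep.{w} k (Equiv.Perm (Fin n))

/-- The graded module underlying a differential graded one (forget the differential). -/
def CyclicModule.graded {k : Type u} [Field k] (V : CyclicModule.{u, w} k) :
    GradedCyclicModule.{u, w} k :=
  fun n i => (V n).X i

namespace GradedCyclicModule

noncomputable section

variable {k : Type u} [Field k]

/-- Each `𝒱((n))` has finite total dimension. -/
def IsFiniteDimensional (V : GradedCyclicModule.{u, w} k) : Prop :=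
  ∀ n, Module.Finite k (⨁ i : ℤ, (V n i : Type w))

open Classical in
/-- The characteristic `ch_n(V) = (1/n!) ∑_σ Tr_V(σ) ψ(σ)` of a representation `V` of `S_n`. -/
def chRep {n : ℕ} (V : Rep.{w} k (Equiv.Perm (Fin n))) : SymFun k :=
  (n.factorial : k)⁻¹ • ∑ σ : Equiv.Perm (Fin n),
    LinearMap.trace k V (V.ρ σ) • SymFun.cycleIndex σ

/-- The characteristic `ch_n(V) = ∑_i (-1)^i ch_n(V_i)` of a graded representation of `S_n`
with finite total dimension. -/
def chGr {n : ℕ} (V : ℤ → Rep.{w} k (Equiv.Perm (Fin n))) : SymFun k :=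
  ∑ᶠ i : ℤ, (i.negOnePow : ℤ) • chRep (V i)

/-- The characteristic `Ch(𝒱) = ∑_{n ≥ 1} ch_n(𝒱((n)))`. As `ch_n` is homogeneous of degree `n`,
this is a finite sum in each coefficient. -/
def Ch (V : GradedCyclicModule.{u, w} k) : SymFun k :=
  fun d => ∑ᶠ n ∈ Set.Ici 1, MvPowerSeries.coeff d (chGr (V n))

end

end GradedCyclicModule

/-! ## Stable trees -/

/-- A stable tree with `n` labelled legs, together with an ordering of its vertices and, for each
vertex, an ordering of the flags at this vertex. The flags form the set `Σ j, Fin (val j)`,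
partitioned into the vertices `j`. The fixed points of the involution `inv` are the legs, its
two-element orbits are the edges. -/
structure StableTree (n : ℕ) : Type where
  /-- the number of vertices -/
  r : ℕ
  /-- the valence of a vertex -/
  val : Fin r → ℕ
  /-- the involution on the flags -/
  inv : Equiv.Perm (Σ j : Fin r, Fin (val j))
  /-- the labelling of the legs -/
  leg : Fin n → Σ j : Fin r, Fin (val j)
  inv_inv : ∀ x, inv (inv x) = x
  leg_injective : Function.Injective leg
  isLeg_iff : ∀ x, inv x = x ↔ ∃ a, leg a = x
  /-- any two vertices are joined by a path of edges -/
  connected : ∀ i j : Fin r,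
    Relation.ReflTransGen (fun a b : Fin r => ∃ x, x.1 = a ∧ (inv x).1 = b) i j
  /-- the number of edges is one less than the number of vertices, that is, a connected graph with
  at least one vertex has genus zero; twice the number of edges is the number of flags that are
  not legs -/
  genus_zero : Nat.card {x // inv x ≠ x} + 2 = 2 * r
  /-- every vertex (of genus `0`) is stable -/
  stable : ∀ j, 3 ≤ val j

namespace StableTree

variable {n : ℕ}

/-- The same tree with its vertices and flags reordered: the vertex in position `j` is the one that
was in position `e j`, and its flag in position `a` is the one that was in position `τ j a`. -/
@[reducible] def reorder (T : StableTree n) (e : Equiv.Perm (Fin T.r))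
    (τ : ∀ j, Equiv.Perm (Fin (T.val (e j)))) : StableTree n where
  r := T.r
  val := fun j => T.val (e j)
  inv := (Equiv.sigmaCongr e τ).trans (T.inv.trans (Equiv.sigmaCongr e τ).symm)
  leg := fun a => (Equiv.sigmaCongr e τ).symm (T.leg a)
  inv_inv := fun x => by simp [T.inv_inv]
  leg_injective := fun a b h => T.leg_injective ((Equiv.sigmaCongr e τ).symm.injective h)
  isLeg_iff := fun x => by
    have h := T.isLeg_iff (Equiv.sigmaCongr e τ x)
    simp only [Equiv.trans_apply, Equiv.symm_apply_eq]
    exact h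
  connected := fun i j => by
    have key : ∀ a b, Relation.ReflTransGen
        (fun a b : Fin T.r => ∃ x, x.1 = a ∧ (T.inv x).1 = b) a b →
        Relation.ReflTransGen (fun a b : Fin T.r =>
          ∃ x, x.1 = a ∧ (((Equiv.sigmaCongr e τ).trans
            (T.inv.trans (Equiv.sigmaCongr e τ).symm)) x).1 = b) (e.symm a) (e.symm b) := by
      intro a b h
      have hfst : ∀ y : Σ j : Fin T.r, Fin (T.val j),
          ((Equiv.sigmaCongr e τ).symm y).1 = e.symm y.1 := by
        intro y
        rw [Equiv.eq_symm_apply]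
        exact congrArg Sigma.fst ((Equiv.sigmaCongr e τ).apply_symm_apply y)
      refine Relation.ReflTransGen.lift (⇑e.symm) ?_ _ _ h
      rintro _ _ ⟨x, rfl, rfl⟩
      exact ⟨(Equiv.sigmaCongr e τ).symm x, hfst x, by simp [hfst]⟩
    simpa using key (e i) (e j) (T.connected _ _)
  genus_zero := by
    rw [← T.genus_zero]
    congr 1
    refine Nat.card_congr ((Equiv.sigmaCongr e τ).subtypeEquiv fun x => ?_)
    simp [Equiv.symm_apply_eq]
  stable := fun j => T.stable (e j)

/-- The same tree with its legs relabelled: the leg labelled `a` is now labelled `σ a`. -/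
@[reducible] def relabel (T : StableTree n) (σ : Equiv.Perm (Fin n)) : StableTree n where
  r := T.r
  val := T.val
  inv := T.inv
  leg := fun a => T.leg (σ⁻¹ a)
  inv_inv := T.inv_inv
  leg_injective := fun a b h => σ⁻¹.injective (T.leg_injective h)
  isLeg_iff := fun x => (T.isLeg_iff x).trans
    ⟨fun ⟨a, h⟩ => ⟨σ a, by simpa using h⟩, fun ⟨a, h⟩ => ⟨σ⁻¹ a, h⟩⟩
  connected := T.connected
  genus_zero := T.genus_zero
  stable := T.stable

end StableTree

/-- The Koszul sign of the reordering `w₁ ⊗ ⋯ ⊗ w_r ↦ w_{e 1} ⊗ ⋯ ⊗ w_{e r}` of elements of degrees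
`d 1, …, d r`: each inversion of `e` contributes `-1` raised to the product of the two degrees. -/
def koszulSign {r : ℕ} (e : Equiv.Perm (Fin r)) (d : Fin r → ℤ) : ℤ :=
  ∏ i : Fin r, ∏ j : Fin r,
    if i < j ∧ e j < e i then ((d (e i) * d (e j)).negOnePow : ℤ) else 1

/-- An ordered stable tree with `n` legs, together with a degree for each vertex, of total
degree `i`. -/
structure TreeIndex (n : ℕ) (i : ℤ) : Type where
  tree : StableTree n
  deg : Fin tree.r → ℤ
  sum_deg : ∑ j, deg j = i

/-- Reordering the vertices, and the flags at each vertex, of a tree with a multidegree. -/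
@[reducible] def TreeIndex.reorder {n : ℕ} {i : ℤ} (x : TreeIndex n i)
    (e : Equiv.Perm (Fin x.tree.r)) (τ : ∀ j, Equiv.Perm (Fin (x.tree.val (e j)))) :
    TreeIndex n i where
  tree := x.tree.reorder e τ
  deg := fun j => x.deg (e j)
  sum_deg := (Equiv.sum_comp e x.deg).trans x.sum_deg

/-- Relabelling the legs of a tree with a multidegree. -/
@[reducible] def TreeIndex.relabel {n : ℕ} {i : ℤ} (σ : Equiv.Perm (Fin n)) (x : TreeIndex n i) :
    TreeIndex n i where
  tree := x.tree.relabel σ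
  deg := x.deg
  sum_deg := x.sum_deg

/-! ## The sum over trees -/

namespace GradedCyclicModule

noncomputable section

variable {k : Type u} [Field k] (V : GradedCyclicModule.{u, w} k)

/-- The summand of `𝒱((v₁)) ⊗ ⋯ ⊗ 𝒱((v_r))` in multidegree `d`, where `v₁, …, v_r` are the vertices
of `T`. -/
abbrev TreeTensor {n : ℕ} {i : ℤ} (x : TreeIndex n i) : Type (max u w) :=
  PiTensorProduct k (fun j : Fin x.tree.r => (V (x.tree.val j) (x.deg j) : Type w))

open Classical in
/-- The inclusion of a summand into the direct sum over all ordered trees and multidegrees. -/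
def treeIncl {n : ℕ} {i : ℤ} (x : TreeIndex n i) :
    TreeTensor V x →ₗ[k] ⨁ y : TreeIndex n i, TreeTensor V y :=
  DirectSum.lof k (TreeIndex n i) (fun y => TreeTensor V y) x

/-- The relations that identify the tensor products of a tree for its different orderings, and of
isomorphic trees: `w₁ ⊗ ⋯ ⊗ w_r` at an ordered tree is identified, up to the Koszul sign, with
the product of the `τ_j⁻¹ w_{e j}` at the reordered tree. -/
def treeRelations (n : ℕ) (i : ℤ) : Submodule k (⨁ x : TreeIndex n i, TreeTensor V x) :=
  Submodule.span k
    {t | ∃ (x : TreeIndex n i) (e : Equiv.Perm (Fin x.tree.r))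
        (τ : ∀ j, Equiv.Perm (Fin (x.tree.val (e j))))
        (a : ∀ j : Fin x.tree.r, (V (x.tree.val j) (x.deg j) : Type w)),
      t = treeIncl V x (PiTensorProduct.tprod k a) -
        koszulSign e x.deg • treeIncl V (x.reorder e τ)
          (PiTensorProduct.tprod k fun j : Fin x.tree.r =>
            ((V (x.tree.val (e j)) (x.deg (e j))).ρ (τ j)⁻¹ (a (e j)) :
              (V (x.tree.val (e j)) (x.deg (e j)) : Type w)))}

open Classical in
/-- The effect on the direct sum over all ordered trees of a relabelling of the legs. -/
def treeAct (n : ℕ) (i : ℤ) (σ : Equiv.Perm (Fin n)) :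
    (⨁ x : TreeIndex n i, TreeTensor V x) →ₗ[k] ⨁ x : TreeIndex n i, TreeTensor V x :=
  DirectSum.toModule k (TreeIndex n i) _ fun x => treeIncl V (x.relabel σ)

theorem treeAct_incl {n : ℕ} {i : ℤ} (σ : Equiv.Perm (Fin n)) (x : TreeIndex n i)
    (t : TreeTensor V x) : treeAct V n i σ (treeIncl V x t) = treeIncl V (x.relabel σ) t := by
  classical
  unfold treeAct treeIncl
  rw [DirectSum.toModule_lof]

theorem treeAct_relations {n : ℕ} {i : ℤ} (σ : Equiv.Perm (Fin n)) :
    treeRelations V n i ≤ (treeRelations V n i).comap (treeAct V n i σ) := by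
  refine Submodule.span_le.2 ?_
  rintro _ ⟨x, e, τ, a, rfl⟩
  refine Submodule.subset_span ⟨x.relabel σ, e, τ, a, ?_⟩
  rw [map_sub, map_zsmul, treeAct_incl, treeAct_incl]

/-- `𝕋𝒱((n))` in degree `i`: the colimit, over the groupoid of stable trees with `n` labelled legs
and their isomorphisms, of the unordered tensor products of `𝒱((v))` over the vertices `v` of the
tree. It is written as the direct sum over all ordered trees modulo the relations that identify
the values at isomorphic trees and at the different orderings of a tree. -/
abbrev TreeSpace (n : ℕ) (i : ℤ) : Type (max u w) :=
  (⨁ x : TreeIndex n i, TreeTensor V x) ⧸ treeRelations V n i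

/-- The action of `S_n` on `𝕋𝒱((n))` by relabelling the legs. -/
def treeRep (n : ℕ) (i : ℤ) : Representation k (Equiv.Perm (Fin n)) (TreeSpace V n i) where
  toFun σ := Submodule.mapQ _ _ (treeAct V n i σ) (treeAct_relations V σ)
  map_one' := by
    classical
    refine Submodule.linearMap_qext _ (DirectSum.linearMap_ext k fun x => LinearMap.ext fun t => ?_)
    change Submodule.Quotient.mk (treeAct V n i 1 (treeIncl V x t)) =
      Submodule.Quotient.mk (treeIncl V x t)
    rw [treeAct_incl]
    rfl
  map_mul' σ τ := by
    classical
    refine Submodule.linearMap_qext _ (DirectSum.linearMap_ext k fun x => LinearMap.ext fun t => ?_)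
    change Submodule.Quotient.mk (treeAct V n i (σ * τ) (treeIncl V x t)) =
      Submodule.Quotient.mk (treeAct V n i σ (treeAct V n i τ (treeIncl V x t)))
    rw [treeAct_incl, treeAct_incl, treeAct_incl]
    rfl

/-- The graded cyclic `S`-module underlying the free cyclic operad `𝕋𝒱`, the sum over trees.
(The differential of `𝒱` does not enter into the underlying graded module of `𝕋𝒱`.) -/
def freeOperad : GradedCyclicModule.{u, max u w} k :=
  fun n i => Rep.of (treeRep V n i)

end

end GradedCyclicModule

/-! Write v = Ch(𝒱), t = Ch(𝕋𝒱), v′ = ∂v/∂p₁ and ψ_n for `adams n`. Since ∂(e₂ − v)/∂p₁ = p₁ − v′,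
expanding h₂ ∘ (p₁ − v′) reduces the Legendre equation to t ∘ (p₁ − v′) = v + ½(ψ₂v′ − v′²), which
is `plethysm_Ch_freeOperad`.

This identity is an inclusion-exclusion over the leaves of trees. The series t is a sum over trees
equipped with an automorphism; a cycle of n legs contributes p_n, which plethysm replaces by p_n −
ψ_n v′. Now v′ counts corollas with one distinguished flag, the root, so choosing −ψ_n v′ on a cycle
of legs attaches a corolla to each of its legs, with sign −1 for the cycle (`cycProd_adams_dp₁`,
`graftSum_range_inr`). The result is a sum over pairs of a tree and an invariant set S of vertices
that are leaves attached to vertices outside S, with one sign per cycle in S. For a tree with at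
least three vertices, S is an arbitrary invariant set of leaf vertices; such vertices exist, so the
signs cancel (`sum_subsetSign_graftSum`). One vertex leaves v. With two vertices every S but the
full set is allowed, so the sum is minus the missing term, which is ½(ψ₂v′ − v′²) (`total_one`,
`total_two`).

To identify t with the sum over trees with automorphisms, 𝕋𝒱((n)) is treated as the quotient of the
sum over ordered trees by reorderings. Symmetrization is an idempotent that computes traces on this
quotient (`trace_quotient`), and the only diagonal terms that survive come from tree automorphisms
inducing the given permutation of the legs. The Koszul sign combines with the degree signs so that
the supertrace of a permuted tensor product is the product, over the cycles of vertices, of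
supertraces of return maps (`koszulSign_mul_prod`, `sum_cycProd_mul_prod`). This gives
`superTrace_freeOperad`.

Permutations are decomposed into rotations by `perm_cycle_induction`, and all sums are kept finite
by truncation: a stable tree with r vertices has at least r + 2 legs, so any given weight sees
finitely many trees. Uniqueness holds because plethysm with p₁ + (higher order) is injective
(`plethysm_injective`). Integrality holds because the coefficient of a monomial in the
characteristic of a representation W is the dimension of the invariants of W tensored with functions
on colourings. -/

section

open Equiv Function

/-! ### Weight filtration and plethysm -/

namespace SymFun

section

variable {k : Type u} [Field k]

/-- The weight of a monomial, where the power sum `p_n` has weight `n`. -/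
noncomputable abbrev wt (d : ℕ+ →₀ ℕ) : ℕ := Finsupp.weight (fun n : ℕ+ => (n : ℕ)) d

/-- The order of vanishing of a symmetric function. -/
noncomputable abbrev ord (f : SymFun k) : ℕ∞ := f.weightedOrder (fun n : ℕ+ => (n : ℕ))

theorem le_ord_iff {f : SymFun k} {N : ℕ} :
    (N : ℕ∞) ≤ ord f ↔ ∀ d, wt d < N → MvPowerSeries.coeff d f = 0 := by
  constructor
  · intro h d hd
    exact MvPowerSeries.coeff_eq_zero_of_lt_weightedOrder _ (lt_of_lt_of_le (by exact_mod_cast hd) h)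
  · intro h
    exact MvPowerSeries.nat_le_weightedOrder _ h

/-- The symmetric functions of order at least `N`. -/
def ordIdeal (k : Type u) [Field k] (N : ℕ) : Ideal (SymFun k) where
  carrier := {f | (N : ℕ∞) ≤ ord f}
  zero_mem' := by simp [ord]
  add_mem' := fun {a b} ha hb => le_trans (le_min ha hb) (MvPowerSeries.min_weightedOrder_le_add _)
  smul_mem' := fun c x hx => by
    refine le_trans ?_ (MvPowerSeries.le_weightedOrder_mul _)
    exact le_trans hx le_add_self

theorem mem_ordIdeal {N : ℕ} {f : SymFun k} :
    f ∈ ordIdeal k N ↔ ∀ d, wt d < N → MvPowerSeries.coeff d f = 0 := le_ord_iff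

theorem ordIdeal_mono {M N : ℕ} (h : M ≤ N) : ordIdeal k N ≤ ordIdeal k M := by
  intro f hf
  rw [mem_ordIdeal] at hf ⊢
  exact fun d hd => hf d (hd.trans_le h)

theorem mul_mem_ordIdeal {M N : ℕ} {f g : SymFun k} (hf : f ∈ ordIdeal k M)
    (hg : g ∈ ordIdeal k N) : f * g ∈ ordIdeal k (M + N) := by
  change ((M + N : ℕ) : ℕ∞) ≤ _
  push_cast
  exact le_trans (add_le_add hf hg) (MvPowerSeries.le_weightedOrder_mul _)

/-- The weight filtration is separated. The tree equation is first proved for truncated sums modulo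
each `ordIdeal`, and this turns the congruences into an equality. -/
theorem eq_of_forall_sub_mem_ordIdeal {f g : SymFun k} (h : ∀ N, f - g ∈ ordIdeal k N) :
    f = g := by
  ext d
  have := mem_ordIdeal.1 (h (wt d + 1)) d (Nat.lt_succ_self _)
  rwa [map_sub, sub_eq_zero] at this

theorem one_le_ord {f : SymFun k} (hf : MvPowerSeries.constantCoeff f = 0) :
    f ∈ ordIdeal k 1 := by
  rw [mem_ordIdeal]
  intro d hd
  have h0 : d = 0 := by
    by_contra hne
    obtain ⟨n, hn⟩ := Finsupp.ne_iff.1 hne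
    have := Finsupp.le_weight (fun n : ℕ+ => (n : ℕ)) n.ne_zero d
    simp at hn
    have h2 : wt d = 0 := by omega
    rw [wt] at h2
    omega
  subst h0
  exact hf

theorem p_mem_ordIdeal (n : ℕ+) : (p n : SymFun k) ∈ ordIdeal k n := by
  rw [mem_ordIdeal]
  intro d hd
  classical
  rw [p, MvPowerSeries.coeff_X, if_neg]
  rintro rfl
  simp [wt, Finsupp.weight_single] at hd

theorem hasSubst_p_mul (n : ℕ+) : MvPowerSeries.HasSubst (fun m : ℕ+ => (p (n * m) : SymFun k)) where
  const_coeff s := by simp [p]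
  coeff_zero d := by
    classical
    refine Set.Finite.subset (d.support.finite_toSet.preimage (f := fun m : ℕ+ => n * m)
      (fun a _ b _ h => mul_left_cancel h)) ?_
    intro m hm
    simp only [Set.mem_ofPred_eq, p, MvPowerSeries.coeff_X] at hm
    simp only [Set.mem_preimage, Finset.mem_coe, Finsupp.mem_support_iff]
    split_ifs at hm with h
    · subst h; simp
    · exact absurd rfl hm

/-- The Adams operation as a ring homomorphism. -/
noncomputable def adamsHom (k : Type u) [Field k] (n : ℕ+) : SymFun k →ₐ[k] SymFun k :=
  MvPowerSeries.substAlgHom (hasSubst_p_mul n)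

theorem adamsHom_apply (n : ℕ+) (g : SymFun k) : adamsHom k n g = adams n g :=
  MvPowerSeries.substAlgHom_apply _ _

theorem adams_p (n m : ℕ+) : adams n (p m : SymFun k) = p (n * m) :=
  MvPowerSeries.subst_X (hasSubst_p_mul n) m

theorem constantCoeff_adams (n : ℕ+) {g : SymFun k} (hg : MvPowerSeries.constantCoeff g = 0) :
    MvPowerSeries.constantCoeff (adams n g) = 0 :=
  MvPowerSeries.constantCoeff_subst_eq_zero (hasSubst_p_mul n) (fun i => by simp [p]) hg

/-- Replacing each `p_s` by `p_{ns}` multiplies the weight of every monomial by `n`. -/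
theorem adams_mem_ordIdeal (n : ℕ+) {N : ℕ} {g : SymFun k} (hg : g ∈ ordIdeal k N) :
    adams n g ∈ ordIdeal k (n * N) := by
  rw [mem_ordIdeal]
  intro d hd
  rw [adams, MvPowerSeries.coeff_subst (hasSubst_p_mul n)]
  refine finsum_eq_zero_of_forall_eq_zero fun e => ?_
  by_cases he : wt e < N
  · rw [mem_ordIdeal.1 hg e he, zero_smul]
  · have : (e.prod fun s m => (p (n * s) : SymFun k) ^ m) ∈ ordIdeal k (n * wt e) := by
      change ((_ : ℕ) : ℕ∞) ≤ _
      refine le_trans ?_ (MvPowerSeries.le_weightedOrder_prod _ _ _)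
      rw [wt, Finsupp.weight_apply, Finsupp.sum, Finset.mul_sum, Nat.cast_sum]
      refine Finset.sum_le_sum fun i _ => ?_
      refine le_trans ?_ (MvPowerSeries.le_weightedOrder_pow _ _)
      have := p_mem_ordIdeal (k := k) (n * i)
      refine le_trans ?_ (nsmul_le_nsmul_right (show ((n * i : ℕ+) : ℕ) ≤ ord (p (n * i) : SymFun k) from this) _)
      simp only [smul_eq_mul, nsmul_eq_mul, PNat.mul_coe]
      push_cast
      exact le_of_eq (by ring)
    rw [mem_ordIdeal.1 this d (hd.trans_le (Nat.mul_le_mul_left _ (not_lt.1 he))), smul_zero]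

/-- The order of `adams n g` is at least `n`, so only finitely many of these series reach a given
monomial. -/
theorem hasSubst_adams {g : SymFun k} (hg : MvPowerSeries.constantCoeff g = 0) :
    MvPowerSeries.HasSubst (fun n : ℕ+ => (adams n g : SymFun k)) where
  const_coeff s := by simp [constantCoeff_adams s hg]
  coeff_zero d := by
    refine Set.Finite.subset (Set.finite_Iic (⟨wt d + 1, Nat.succ_pos _⟩ : ℕ+)) ?_
    intro n hn
    by_contra hlt
    refine hn (mem_ordIdeal.1 (adams_mem_ordIdeal n (one_le_ord hg)) d ?_)
    have h1 : (⟨wt d + 1, Nat.succ_pos _⟩ : ℕ+) < n := not_le.1 hlt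
    have h2 : wt d + 1 < (n : ℕ) := h1
    rw [mul_one]
    exact (Nat.lt_succ_self _).trans h2

/-- Plethysm with a fixed inner function, as an algebra homomorphism. -/
noncomputable def plethysmHom {g : SymFun k} (hg : MvPowerSeries.constantCoeff g = 0) :
    SymFun k →ₐ[k] SymFun k :=
  MvPowerSeries.substAlgHom (hasSubst_adams hg)

theorem plethysmHom_apply {g : SymFun k} (hg : MvPowerSeries.constantCoeff g = 0) (f : SymFun k) :
    plethysmHom hg f = plethysm f g :=
  MvPowerSeries.substAlgHom_apply _ _

theorem plethysm_p {g : SymFun k} (hg : MvPowerSeries.constantCoeff g = 0) (n : ℕ+) :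
    plethysm (p n) g = adams n g :=
  MvPowerSeries.subst_X (hasSubst_adams hg) n

theorem prod_adams_mem_ordIdeal {g : SymFun k} (hg : MvPowerSeries.constantCoeff g = 0)
    (e : ℕ+ →₀ ℕ) : (e.prod fun s m => (adams s g : SymFun k) ^ m) ∈ ordIdeal k (wt e) := by
  change ((_ : ℕ) : ℕ∞) ≤ _
  refine le_trans ?_ (MvPowerSeries.le_weightedOrder_prod _ _ _)
  rw [wt, Finsupp.weight_apply, Finsupp.sum, Nat.cast_sum]
  refine Finset.sum_le_sum fun i _ => ?_
  refine le_trans ?_ (MvPowerSeries.le_weightedOrder_pow _ _)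
  have h := adams_mem_ordIdeal i (one_le_ord hg)
  rw [mul_one] at h
  refine le_trans ?_ (nsmul_le_nsmul_right (show ((i : ℕ+) : ℕ) ≤ ord (adams i g) from h) _)
  simp

theorem plethysm_mem_ordIdeal {f g : SymFun k} (hg : MvPowerSeries.constantCoeff g = 0) {N : ℕ}
    (hf : f ∈ ordIdeal k N) : plethysm f g ∈ ordIdeal k N := by
  rw [mem_ordIdeal]
  intro d hd
  rw [plethysm, MvPowerSeries.coeff_subst (hasSubst_adams hg)]
  refine finsum_eq_zero_of_forall_eq_zero fun e => ?_
  by_cases he : wt e < N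
  · rw [mem_ordIdeal.1 hf e he, zero_smul]
  · rw [mem_ordIdeal.1 (prod_adams_mem_ordIdeal hg e) d (hd.trans_le (not_lt.1 he)), smul_zero]

/-- Continuity of plethysm in the inner argument: `adams s` cannot lower the order of `g - g'`, so
all monomials in the two families agree in the quotient ring by `ordIdeal k N`. -/
theorem plethysm_sub_plethysm_mem_ordIdeal (f : SymFun k) {g g' : SymFun k}
    (hg : MvPowerSeries.constantCoeff g = 0) (hg' : MvPowerSeries.constantCoeff g' = 0) {N : ℕ}
    (h : g - g' ∈ ordIdeal k N) : plethysm f g - plethysm f g' ∈ ordIdeal k N := by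
  rw [mem_ordIdeal]
  intro d hd
  rw [map_sub, sub_eq_zero, plethysm, MvPowerSeries.coeff_subst (hasSubst_adams hg), plethysm,
    MvPowerSeries.coeff_subst (hasSubst_adams hg')]
  refine finsum_congr fun e => ?_
  have key : (e.prod fun s m => (adams s g : SymFun k) ^ m) -
      (e.prod fun s m => (adams s g' : SymFun k) ^ m) ∈ ordIdeal k N := by
    rw [← Ideal.Quotient.eq]
    simp only [Finsupp.prod, map_prod, map_pow]
    refine Finset.prod_congr rfl fun s _ => ?_
    congr 1
    rw [Ideal.Quotient.eq, ← adamsHom_apply, ← adamsHom_apply, ← map_sub, adamsHom_apply]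
    exact ordIdeal_mono (Nat.le_mul_of_pos_left _ s.pos) (adams_mem_ordIdeal s h)
  have := mem_ordIdeal.1 key d hd
  rw [map_sub, sub_eq_zero] at this
  rw [this]

/-- The leading term of a product is the product of the leading terms, by telescoping `xX - yY = (x
- y)X + y(X - Y)`. The second conjunct is what bounds the factors `X` and `y` in the induction. -/
theorem prod_sub_prod_mem_ordIdeal {ι : Type*} (s : Finset ι) (x y : ι → SymFun k) (c : ι → ℕ)
    (hy : ∀ i ∈ s, y i ∈ ordIdeal k (c i)) (h : ∀ i ∈ s, x i - y i ∈ ordIdeal k (c i + 1)) :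
    ∏ i ∈ s, x i - ∏ i ∈ s, y i ∈ ordIdeal k (∑ i ∈ s, c i + 1) ∧
      ∏ i ∈ s, y i ∈ ordIdeal k (∑ i ∈ s, c i) := by
  classical
  induction s using Finset.induction_on with
  | empty =>
    simp only [Finset.prod_empty, sub_self, Ideal.zero_mem, Finset.sum_empty, true_and]
    rw [mem_ordIdeal]
    exact fun d hd => absurd hd (Nat.not_lt_zero _)
  | insert a s ha ih =>
    obtain ⟨h1, h2⟩ := ih (fun i hi => hy i (Finset.mem_insert_of_mem hi))
      (fun i hi => h i (Finset.mem_insert_of_mem hi))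
    have hya := hy a (Finset.mem_insert_self _ _)
    have hxa := h a (Finset.mem_insert_self _ _)
    rw [Finset.prod_insert ha, Finset.prod_insert ha, Finset.sum_insert ha]
    refine ⟨?_, mul_mem_ordIdeal hya h2⟩
    have hP : ∏ i ∈ s, x i ∈ ordIdeal k (∑ i ∈ s, c i) := by
      have := Ideal.add_mem _ (ordIdeal_mono (Nat.le_succ _) h1) h2
      simpa using this
    have e : x a * ∏ i ∈ s, x i - y a * ∏ i ∈ s, y i =
        (x a - y a) * ∏ i ∈ s, x i + y a * (∏ i ∈ s, x i - ∏ i ∈ s, y i) := by ring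
    rw [e]
    refine Ideal.add_mem _ ?_ ?_
    · have := mul_mem_ordIdeal hxa hP
      rwa [add_right_comm] at this
    · have := mul_mem_ordIdeal hya h1
      rwa [← add_assoc] at this

/-- Plethysm with `p₁ + (terms of higher order)` preserves the leading term. -/
theorem plethysm_sub_self_mem_ordIdeal {h g : SymFun k} (hg : g - p 1 ∈ ordIdeal k 2) {N : ℕ}
    (hh : h ∈ ordIdeal k N) : plethysm h g - h ∈ ordIdeal k (N + 1) := by
  have hg0 : MvPowerSeries.constantCoeff g = 0 := by
    have := mem_ordIdeal.1 hg 0 (by simp)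
    rw [map_sub, MvPowerSeries.coeff_zero_eq_constantCoeff_apply,
      MvPowerSeries.coeff_zero_eq_constantCoeff_apply, p] at this
    simpa using this
  have hp0 : MvPowerSeries.constantCoeff (p 1 : SymFun k) = 0 := by simp [p]
  -- Writing `h` itself as a plethysm gives both sides the same coefficients, so only the
  -- substituted monomials have to be compared.
  have hself : plethysm h (p 1) = h := by
    have : (fun n : ℕ+ => adams n (p 1 : SymFun k)) = MvPowerSeries.X := by
      funext n; rw [adams_p, mul_one, p]
    rw [plethysm, this, MvPowerSeries.subst_self]
    rfl
  nth_rw 2 [← hself]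
  rw [mem_ordIdeal]
  intro d hd
  rw [map_sub, sub_eq_zero, plethysm, MvPowerSeries.coeff_subst (hasSubst_adams hg0), plethysm,
    MvPowerSeries.coeff_subst (hasSubst_adams hp0)]
  refine finsum_congr fun e => ?_
  by_cases he : wt e < N
  · rw [mem_ordIdeal.1 hh e he, zero_smul, zero_smul]
  -- The gain of one in the order comes from `2 * s ≥ s + 1`: the error of `adams s g` has order `2
  -- * s`, while its leading term `p s` has order `s`.
  have hpw : ∀ s : ℕ+, ∀ m : ℕ, adams s g ^ m - adams s (p 1) ^ m ∈ ordIdeal k (s * m + 1) ∧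
      adams s (p 1 : SymFun k) ^ m ∈ ordIdeal k (s * m) := by
    intro s m
    have := prod_sub_prod_mem_ordIdeal (Finset.range m) (fun _ => adams s g)
      (fun _ => adams s (p 1)) (fun _ => (s : ℕ)) (fun i _ => by
        rw [adams_p, mul_one]; exact p_mem_ordIdeal s) (fun i _ => by
        rw [← adamsHom_apply, ← adamsHom_apply, ← map_sub, adamsHom_apply]
        refine ordIdeal_mono ?_ (adams_mem_ordIdeal s hg)
        have := s.pos
        omega)
    simpa [Finset.prod_const, mul_comm] using this
  have key := (prod_sub_prod_mem_ordIdeal e.support (fun s => adams s g ^ e s)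
    (fun s => adams s (p 1) ^ e s) (fun s => (s : ℕ) * e s) (fun s _ => (hpw s _).2)
    (fun s _ => (hpw s _).1)).1
  have hw : ∑ s ∈ e.support, (s : ℕ) * e s = wt e := by
    rw [wt, Finsupp.weight_apply, Finsupp.sum]
    exact Finset.sum_congr rfl fun i _ => by simp [mul_comm]
  rw [hw] at key
  have := mem_ordIdeal.1 key d (by omega)
  rw [map_sub, sub_eq_zero] at this
  simp only [Finsupp.prod]
  rw [this]

/-- The leading term of `a - b` survives plethysm with `g`, so if the plethysm vanishes, the order
of `a - b` exceeds every `N`. -/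
theorem plethysm_injective {g : SymFun k} (hg : g - p 1 ∈ ordIdeal k 2) {a b : SymFun k}
    (hab : plethysm a g = plethysm b g) : a = b := by
  have hg0 : MvPowerSeries.constantCoeff g = 0 := by
    have := mem_ordIdeal.1 hg 0 (by simp)
    rw [map_sub, MvPowerSeries.coeff_zero_eq_constantCoeff_apply,
      MvPowerSeries.coeff_zero_eq_constantCoeff_apply, p] at this
    simpa using this
  have h0 : plethysm (a - b) g = 0 := by
    rw [← plethysmHom_apply hg0, map_sub, plethysmHom_apply, plethysmHom_apply, hab, sub_self]
  refine eq_of_forall_sub_mem_ordIdeal fun N => ?_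
  induction N with
  | zero => exact mem_ordIdeal.2 fun d hd => absurd hd (Nat.not_lt_zero _)
  | succ N ih =>
    have := plethysm_sub_self_mem_ordIdeal hg ih
    rw [h0, zero_sub] at this
    simpa using (ordIdeal k (N + 1)).neg_mem this

theorem dp₁_mem_ordIdeal {N : ℕ} {f : SymFun k} (hf : f ∈ ordIdeal k (N + 1)) :
    dp₁ f ∈ ordIdeal k N := by
  rw [mem_ordIdeal] at hf ⊢
  intro d hd
  rw [dp₁, MvPowerSeries.coeff_pderiv, hf, zero_mul]
  simp only [wt, map_add, Finsupp.weight_single]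
  simp only [wt] at hd
  simp
  omega

end

end SymFun

/-! ### Products over the cycles of a permutation -/

section Cycles

variable {X Y Z : Type} [Fintype X] [Fintype Y] [Fintype Z]

/-- The length of the cycle of `α` through `x`. -/
noncomputable abbrev per {X : Type} (α : Perm X) (x : X) : ℕ := minimalPeriod α x

theorem sameCycle_iff_exists_iterate {α : Perm X} {x y : X} :
    α.SameCycle x y ↔ ∃ i : ℕ, α^[i] x = y := by
  constructor
  · intro h
    obtain ⟨i, hi⟩ := h.exists_nat_pow_eq
    exact ⟨i, by rw [Perm.iterate_eq_pow]; exact hi⟩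
  · rintro ⟨i, hi⟩
    exact ⟨i, by rw [zpow_natCast, ← Perm.iterate_eq_pow]; exact hi⟩

theorem mem_periodicPts (α : Perm X) (x : X) : x ∈ periodicPts α :=
  α.injective.mem_periodicPts x

theorem per_pos (α : Perm X) (x : X) : 0 < per α x :=
  minimalPeriod_pos_of_mem_periodicPts (mem_periodicPts α x)

theorem eq_of_sameCycle {A : Type*} {α : Perm X} {g : X → A} (hg : ∀ x, g (α x) = g x) {x y : X}
    (h : α.SameCycle x y) : g x = g y := by
  obtain ⟨i, rfl⟩ := sameCycle_iff_exists_iterate.1 h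
  induction i with
  | zero => rfl
  | succ i ih => rw [iterate_succ_apply', hg]; exact ih ⟨i, by rw [zpow_natCast, ← Perm.iterate_eq_pow]⟩

theorem per_apply (α : Perm X) (x : X) : per α (α x) = per α x :=
  minimalPeriod_apply (mem_periodicPts α x)

theorem per_eq_of_sameCycle {α : Perm X} {x y : X} (h : α.SameCycle x y) : per α x = per α y :=
  eq_of_sameCycle (per_apply α) h

theorem iterate_comm_of_comm {X Y : Type} {α : X → X} {β : Y → Y} {φ : X → Y}
    (h : ∀ x, φ (α x) = β (φ x)) (i : ℕ) (x : X) : φ (α^[i] x) = β^[i] (φ x) := by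
  induction i with
  | zero => rfl
  | succ i ih => rw [iterate_succ_apply', iterate_succ_apply', h, ih]

theorem per_of_injective {X Y : Type} {α : Perm X} {β : Perm Y} {φ : X → Y} (hφ : Injective φ)
    (h : ∀ x, φ (α x) = β (φ x)) (x : X) : per β (φ x) = per α x := by
  refine Nat.dvd_antisymm ?_ ?_
  · refine IsPeriodicPt.minimalPeriod_dvd ?_
    change _ = _
    rw [← iterate_comm_of_comm h, iterate_minimalPeriod]
  · refine IsPeriodicPt.minimalPeriod_dvd (hφ ?_)
    rw [iterate_comm_of_comm h]
    exact iterate_minimalPeriod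

theorem sameCycle_iff_of_injective {α : Perm X} {β : Perm Y} {φ : X → Y} (hφ : Injective φ)
    (h : ∀ x, φ (α x) = β (φ x)) (x y : X) : α.SameCycle x y ↔ β.SameCycle (φ x) (φ y) := by
  rw [sameCycle_iff_exists_iterate, sameCycle_iff_exists_iterate]
  refine exists_congr fun i => ?_
  rw [← iterate_comm_of_comm h, hφ.eq_iff]

variable {M : Type*} [CommMonoid M]

open Classical in
/-- The product over the cycles of a permutation of the values of a function that is constant on
each cycle. -/
noncomputable def cycProd (α : Perm X) (g : X → M) : M :=
  ∏ q : Quotient (Perm.SameCycle.setoid α), g q.out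

theorem cycProd_congr {α : Perm X} {g g' : X → M} (h : ∀ x, g x = g' x) :
    cycProd α g = cycProd α g' := by
  rw [funext h]

theorem cycProd_mul (α : Perm X) (g g' : X → M) :
    cycProd α (fun x => g x * g' x) = cycProd α g * cycProd α g' :=
  Finset.prod_mul_distrib

theorem cycProd_eq_one {α : Perm X} {g : X → M} (h : ∀ x, g x = 1) : cycProd α g = 1 :=
  Finset.prod_eq_one fun _ _ => h _

theorem map_cycProd {N F : Type*} [CommMonoid N] [FunLike F M N] [MonoidHomClass F M N] (f : F)
    (α : Perm X) (g : X → M) : f (cycProd α g) = cycProd α (fun x => f (g x)) :=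
  map_prod f _ _

/-- The map induced by `φ` on cycles is injective, and the cycles that it misses contribute one.
Invariance of `g` makes the representatives picked by `Quotient.out` irrelevant. -/
theorem cycProd_of_map {α : Perm X} {β : Perm Y} (φ : X → Y)
    (hφ : ∀ x y, α.SameCycle x y ↔ β.SameCycle (φ x) (φ y)) {g : Y → M}
    (hg : ∀ y, g (β y) = g y) (h1 : ∀ y, (∀ x, ¬ β.SameCycle (φ x) y) → g y = 1) :
    cycProd β g = cycProd α (fun x => g (φ x)) := by
  classical
  symm
  refine Fintype.prod_of_injective
    (Quotient.map' φ (fun x y h => (hφ x y).1 h) :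
      Quotient (Perm.SameCycle.setoid α) → Quotient (Perm.SameCycle.setoid β)) ?_ _ _ ?_ ?_
  · intro a b
    induction a using Quotient.inductionOn'
    induction b using Quotient.inductionOn'
    intro h
    rw [Quotient.map'_mk'', Quotient.map'_mk'', Quotient.eq''] at h
    rw [Quotient.eq'']
    exact (hφ _ _).2 h
  · intro q hq
    refine h1 _ fun x hx => hq ⟨Quotient.mk'' x, ?_⟩
    rw [Quotient.map'_mk'']
    conv_rhs => rw [← Quotient.out_eq' q]
    rw [Quotient.eq'']
    exact hx
  · intro q
    refine eq_of_sameCycle hg ?_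
    have h2 : (Quotient.mk'' (φ q.out) : Quotient (Perm.SameCycle.setoid β)) =
        Quotient.map' φ (fun x y h => (hφ x y).1 h) q := by
      conv_rhs => rw [← Quotient.out_eq' q]
      rw [Quotient.map'_mk'']
    have h3 := h2.trans (Quotient.out_eq' _).symm
    rw [Quotient.eq''] at h3
    exact h3

theorem cycProd_of_injective {α : Perm X} {β : Perm Y} {φ : X → Y} (hφ : Injective φ)
    (h : ∀ x, φ (α x) = β (φ x)) {g : Y → M} (hg : ∀ y, g (β y) = g y)
    (h1 : ∀ y, y ∉ Set.range φ → g y = 1) : cycProd β g = cycProd α (fun x => g (φ x)) := by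
  refine cycProd_of_map φ (sameCycle_iff_of_injective hφ h) hg fun y hy => h1 y ?_
  rintro ⟨x, rfl⟩
  exact hy x (Perm.SameCycle.refl _ _)

theorem cycProd_permCongr (θ : X ≃ Y) (α : Perm X) {g : Y → M}
    (hg : ∀ y, g (θ.permCongr α y) = g y) :
    cycProd (θ.permCongr α) g = cycProd α (fun x => g (θ x)) :=
  cycProd_of_injective θ.injective (fun x => by simp) hg
    (fun y hy => absurd (θ.surjective y) hy)

theorem cycProd_inv (α : Perm X) {g : X → M} (hg : ∀ y, g (α y) = g y) :
    cycProd α⁻¹ g = cycProd α g := by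
  refine cycProd_of_map id (fun x y => by simp) (fun y => ?_) ?_
  · rw [← hg (α⁻¹ y)]; simp
  · intro y hy
    exact absurd (Perm.SameCycle.refl _ _) (hy y)

theorem cycProd_sumCongr (α : Perm X) (β : Perm Y) {g : X ⊕ Y → M}
    (hg : ∀ y, g (Perm.sumCongr α β y) = g y) :
    cycProd (Perm.sumCongr α β) g =
      cycProd α (fun x => g (Sum.inl x)) * cycProd β (fun x => g (Sum.inr x)) := by
  -- Each of the two factors is one on one summand, so each is handled by `cycProd_of_injective` for
  -- the other inclusion.
  have e : ∀ z, g z = Sum.elim (fun x => g (Sum.inl x)) (fun _ => 1) z *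
      Sum.elim (fun _ => 1) (fun x => g (Sum.inr x)) z := by
    rintro (x | x) <;> simp
  rw [cycProd_congr e, cycProd_mul]
  congr 1
  · refine (cycProd_of_injective (α := α) Sum.inl_injective (fun x => by simp) ?_ ?_).trans ?_
    · rintro (x | x)
      · simpa using hg (Sum.inl x)
      · simp
    · rintro (x | x) h
      · exact absurd ⟨x, rfl⟩ h
      · rfl
    · rfl
  · refine (cycProd_of_injective (α := β) Sum.inr_injective (fun x => by simp) ?_ ?_).trans ?_
    · rintro (x | x)
      · simp
      · simpa using hg (Sum.inr x)
    · rintro (x | x) h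
      · rfl
      · exact absurd ⟨x, rfl⟩ h
    · rfl

theorem cycProd_of_isEmpty [IsEmpty X] (α : Perm X) (g : X → M) : cycProd α g = 1 := by
  unfold cycProd
  have : IsEmpty (Quotient (Perm.SameCycle.setoid α)) := ⟨fun q => isEmptyElim q.out⟩
  simp

theorem cycProd_of_transitive {α : Perm X} (x : X) (h : ∀ y, α.SameCycle x y) {g : X → M}
    (hg : ∀ y, g (α y) = g y) : cycProd α g = g x := by
  classical
  unfold cycProd
  rw [Fintype.prod_eq_single (Quotient.mk'' x)]
  · exact (eq_of_sameCycle hg (h _)).symm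
  · intro q hq
    refine absurd ?_ hq
    rw [← Quotient.out_eq' q, Quotient.eq'']
    exact (h _).symm

theorem finRotate_iterate_zero (a i : ℕ) (hi : i < a + 1) :
    (finRotate (a + 1))^[i] 0 = ⟨i, hi⟩ := by
  induction i with
  | zero => rfl
  | succ i ih =>
    rw [iterate_succ_apply', ih (by omega), finRotate_of_lt (by omega)]

theorem sameCycle_finRotate (a : ℕ) (y : Fin (a + 1)) : (finRotate (a + 1)).SameCycle 0 y :=
  sameCycle_iff_exists_iterate.2 ⟨y, finRotate_iterate_zero a y y.2⟩

theorem finRotate_iterate_card (a : ℕ) : (finRotate (a + 1))^[a + 1] 0 = 0 := by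
  rw [iterate_succ_apply', finRotate_iterate_zero a a (by omega)]
  exact finRotate_last

theorem per_finRotate (a : ℕ) (x : Fin (a + 1)) : per (finRotate (a + 1)) x = a + 1 := by
  rw [← per_eq_of_sameCycle (sameCycle_finRotate a x)]
  refine le_antisymm (IsPeriodicPt.minimalPeriod_le (Nat.succ_pos _) (finRotate_iterate_card a)) ?_
  by_contra h
  have h0 := per_pos (finRotate (a + 1)) 0
  have h1 : (finRotate (a + 1))^[per (finRotate (a + 1)) 0] 0 = 0 := iterate_minimalPeriod
  rw [finRotate_iterate_zero a _ (by omega)] at h1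
  have := congrArg Fin.val h1
  simp at this
  omega

theorem cycProd_finRotate (a : ℕ) {g : Fin (a + 1) → M}
    (hg : ∀ y, g (finRotate (a + 1) y) = g y) : cycProd (finRotate (a + 1)) g = g 0 :=
  cycProd_of_transitive 0 (sameCycle_finRotate a) hg

/-- Every permutation of a finite set is a disjoint union of rotations. -/
theorem perm_cycle_induction {P : ∀ (X : Type) [Fintype X], Perm X → Prop}
    (iso : ∀ (X Y : Type) [Fintype X] [Fintype Y] (θ : X ≃ Y) (α : Perm X),
      P X α → P Y (θ.permCongr α))
    (empty : ∀ (X : Type) [Fintype X] [IsEmpty X] (α : Perm X), P X α)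
    (sum : ∀ (X Y : Type) [Fintype X] [Fintype Y] (α : Perm X) (β : Perm Y),
      P X α → P Y β → P (X ⊕ Y) (Perm.sumCongr α β))
    (rotate : ∀ a : ℕ, P (Fin (a + 1)) (finRotate (a + 1)))
    (X : Type) [Fintype X] (α : Perm X) : P X α := by
  classical
  obtain ⟨N, hN⟩ : ∃ N, Fintype.card X = N := ⟨_, rfl⟩
  induction N using Nat.strong_induction_on generalizing X with
  | _ N ih =>
  rcases isEmpty_or_nonempty X with hX | ⟨⟨x₀⟩⟩
  · exact empty X α
  -- The cycle through `x₀` is split off. Its iterates identify it with a rotation, and the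
  -- complement is strictly smaller, so the induction hypothesis applies to it.
  let C : X → Prop := fun y => α.SameCycle x₀ y
  have hC : ∀ y, C (α y) ↔ C y := fun y => Perm.sameCycle_apply_right
  have hC' : ∀ y, ¬ C (α y) ↔ ¬ C y := fun y => not_congr (hC y)
  obtain ⟨a, ha⟩ : ∃ a, per α x₀ = a + 1 := ⟨per α x₀ - 1, by have := per_pos α x₀; omega⟩
  let f : Fin (a + 1) → {y // C y} := fun i =>
    ⟨α^[i] x₀, sameCycle_iff_exists_iterate.2 ⟨i, rfl⟩⟩
  have hf : Bijective f := by
    constructor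
    · intro i j hij
      have h1 : α^[i] x₀ = α^[j] x₀ := congrArg Subtype.val hij
      have := iterate_injOn_Iio_minimalPeriod (f := α) (x := x₀) (show (i : ℕ) ∈ _ from ?_)
        (show (j : ℕ) ∈ _ from ?_) h1
      · exact Fin.ext this
      · simp only [Set.mem_Iio]; have := i.2; unfold per at ha; omega
      · simp only [Set.mem_Iio]; have := j.2; unfold per at ha; omega
    · rintro ⟨y, hy⟩
      obtain ⟨i, rfl⟩ := sameCycle_iff_exists_iterate.1 hy
      refine ⟨⟨i % (a + 1), Nat.mod_lt _ (Nat.succ_pos _)⟩, Subtype.ext ?_⟩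
      change α^[i % (a + 1)] x₀ = _
      rw [← ha]
      exact iterate_mod_minimalPeriod_eq
  let θ : Fin (a + 1) ≃ {y // C y} := Equiv.ofBijective f hf
  have h1 : P {y // C y} (α.subtypePerm hC) := by
    have h := iso _ _ θ _ (rotate a)
    convert h using 1
    ext y
    obtain ⟨i, rfl⟩ := θ.surjective y
    simp only [permCongr_apply, symm_apply_apply]
    change α (α^[i] x₀) = α^[(finRotate (a + 1) i : Fin (a + 1))] x₀
    rw [← iterate_succ_apply' (f := α)]
    by_cases hi : (i : ℕ) < a
    · rw [finRotate_of_lt hi]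
    · have hia : i = Fin.last a := Fin.ext (by have := i.2; simp; omega)
      rw [hia, finRotate_last]
      simp only [Fin.val_last, Fin.val_zero, iterate_zero, id_eq]
      rw [← Nat.succ_eq_add_one] at ha
      rw [← ha]
      exact iterate_minimalPeriod
  have h2 : P {y // ¬ C y} (α.subtypePerm hC') := by
    refine ih _ ?_ _ _ rfl
    rw [← hN]
    exact Fintype.card_subtype_lt (x := x₀) (fun h => h (Perm.SameCycle.refl _ _))
  have h3 := iso _ _ (Equiv.sumCompl C) _ (sum _ _ _ _ h1 h2)
  convert h3 using 1
  ext y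
  obtain ⟨z, rfl⟩ := (Equiv.sumCompl C).surjective y
  rcases z with z | z <;> simp

end Cycles

/-! ### Class functions on invariant subsets -/

section ClassFunctions

variable {k : Type u} [Field k]

/-- A family of functions on the symmetric groups that are invariant under conjugation. -/
def IsClassFun (χ : ∀ m : ℕ, Perm (Fin m) → k) : Prop :=
  ∀ m (g ρ : Perm (Fin m)), χ m (g.permCongr ρ) = χ m ρ

open Classical in
/-- The value of a family of class functions at the restriction of a permutation to a subset. -/
noncomputable def chiOn (χ : ∀ m : ℕ, Perm (Fin m) → k) {F : Type} [Finite F] (α : Perm F)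
    (s : Set F) : k :=
  if h : ∀ x, α x ∈ s ↔ x ∈ s then
    χ (Nat.card s) ((Finite.equivFin s).permCongr (α.subtypePerm h)) else 0

variable {χ : ∀ m : ℕ, Perm (Fin m) → k} (hχ : IsClassFun χ)
include hχ

omit [Field k] in
theorem chi_permCongr_eq {F : Type} {m m' : ℕ} (θ : F ≃ Fin m) (θ' : F ≃ Fin m') (α : Perm F) :
    χ m (θ.permCongr α) = χ m' (θ'.permCongr α) := by
  obtain rfl : m = m' := by simpa using Fintype.card_congr (θ.symm.trans θ')
  rw [← hχ m (θ.symm.trans θ') (θ.permCongr α)]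
  congr 1
  ext x
  simp

/-- Conjugation invariance makes the numbering chosen inside `chiOn` irrelevant; any parametrization
of the subset computes the same value. -/
theorem chiOn_eq {F : Type} [Finite F] {α : Perm F} {s : Set F} {m : ℕ} (θ : Fin m → F)
    (hθ : Injective θ) (hs : Set.range θ = s) (ρ : Perm (Fin m)) (h : ∀ x, θ (ρ x) = α (θ x)) :
    chiOn χ α s = χ m ρ := by
  subst hs
  have hα : ∀ x, α x ∈ Set.range θ ↔ x ∈ Set.range θ := by
    intro x
    constructor
    · rintro ⟨y, hy⟩
      refine ⟨ρ.symm y, α.injective ?_⟩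
      rw [← h, apply_symm_apply, hy]
    · rintro ⟨y, rfl⟩
      exact ⟨ρ y, h y⟩
  rw [chiOn, dif_pos hα, chi_permCongr_eq hχ _ (Equiv.ofInjective θ hθ).symm]
  congr 1
  ext x
  congr 1
  simp only [permCongr_apply, symm_symm, symm_apply_eq]
  exact Subtype.ext (h x).symm

theorem chiOn_image {F F' : Type} [Finite F] [Finite F'] {α : Perm F} {α' : Perm F'} {φ : F → F'}
    (hφ : Injective φ) (h : ∀ x, φ (α x) = α' (φ x)) (s : Set F) :
    chiOn χ α' (φ '' s) = chiOn χ α s := by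
  by_cases hs : ∀ x, α x ∈ s ↔ x ∈ s
  · symm
    rw [chiOn, dif_pos hs]
    symm
    refine chiOn_eq hχ (fun x => φ ((Finite.equivFin s).symm x))
      (fun x y hxy => (Finite.equivFin s).symm.injective (Subtype.ext (hφ hxy))) ?_ _ ?_
    · ext y
      constructor
      · rintro ⟨x, rfl⟩
        exact ⟨_, Subtype.coe_prop _, rfl⟩
      · rintro ⟨x, hx, rfl⟩
        exact ⟨Finite.equivFin s ⟨x, hx⟩,
          congrArg φ (congrArg Subtype.val ((Finite.equivFin s).symm_apply_apply ⟨x, hx⟩))⟩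
    · intro x
      simp only [permCongr_apply, symm_apply_apply, Perm.subtypePerm_apply, h]
  · rw [chiOn, chiOn, dif_neg hs, dif_neg]
    intro h'
    refine hs fun x => ?_
    have := h' (φ x)
    rwa [← h, hφ.mem_set_image, hφ.mem_set_image] at this

end ClassFunctions

theorem pow_perm_comm {F F' : Type} {α : Perm F} {α' : Perm F'} {φ : F → F'}
    (h : ∀ x, φ (α x) = α' (φ x)) (i : ℕ) (x : F) : φ ((α ^ i) x) = (α' ^ i) (φ x) := by
  rw [← Perm.iterate_eq_pow, ← Perm.iterate_eq_pow]
  exact iterate_comm_of_comm h i x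

/-! ### Products of class functions over cycles of vertices -/

section VertexWeight

variable {k : Type u} [Field k] (χ : ∀ m : ℕ, Perm (Fin m) → k)
variable {V V' S F F' G : Type} [Fintype V] [Fintype V'] [Fintype S] [Finite F] [Finite F']
  [Finite G]

/-- The product over the cycles of a permutation `e` of the vertices of the values of `χ` at the
return maps of a permutation `α` of the flags. -/
noncomputable def vertexWeight (vt : F → V) (e : Perm V) (α : Perm F) : k :=
  cycProd e fun j => chiOn χ (α ^ per e j) (vt ⁻¹' {j})

variable {χ} (hχ : IsClassFun χ)
include hχ

/-- Conjugation by `α` carries the return map at `j` to the one at `e j`. Hence `vertexWeight` does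
not depend on representatives of cycles. -/
theorem chiOn_fiber_apply {vt : F → V} {e : Perm V} {α : Perm F} (h : ∀ x, vt (α x) = e (vt x))
    (j : V) : chiOn χ (α ^ per e (e j)) (vt ⁻¹' {e j}) = chiOn χ (α ^ per e j) (vt ⁻¹' {j}) := by
  rw [per_apply, ← chiOn_image hχ (φ := α) α.injective (α := α ^ per e j) (α' := α ^ per e j)
    (s := vt ⁻¹' {j})]
  · congr 1
    ext x
    simp only [Set.mem_preimage, Set.mem_singleton_iff, Set.mem_image]
    constructor
    · intro hx
      refine ⟨α.symm x, e.injective ?_, by simp⟩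
      rw [← h, apply_symm_apply, hx]
    · rintro ⟨y, hy, hyx⟩
      rw [← hyx, h, hy]
  · intro x
    exact pow_perm_comm (φ := α) (fun _ => rfl) _ x

theorem vertexWeight_sumCongr {vt : F → V} {e : Perm V} {α : Perm F}
    (h : ∀ x, vt (α x) = e (vt x)) {vs : G → S} {ε : Perm S} {β : Perm G}
    (h' : ∀ x, vs (β x) = ε (vs x)) :
    vertexWeight χ (Sum.map vt vs) (Perm.sumCongr e ε) (Perm.sumCongr α β) =
      vertexWeight χ vt e α * vertexWeight χ vs ε β := by
  have hm : ∀ x, Sum.map vt vs (Perm.sumCongr α β x) = Perm.sumCongr e ε (Sum.map vt vs x) := by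
    rintro (x | x) <;> simp [h, h']
  unfold vertexWeight
  rw [cycProd_sumCongr]
  · congr 1
    · refine cycProd_congr fun j => ?_
      rw [per_of_injective (α := e) Sum.inl_injective (fun x => by simp) j]
      rw [← chiOn_image hχ (α := α ^ per e j) (φ := (Sum.inl : F → F ⊕ G)) Sum.inl_injective]
      · congr 1
        ext (x | x) <;> simp
      · exact fun x => pow_perm_comm (φ := (Sum.inl : F → F ⊕ G)) (fun _ => rfl) _ x
    · refine cycProd_congr fun j => ?_
      rw [per_of_injective (α := ε) Sum.inr_injective (fun x => by simp) j]
      rw [← chiOn_image hχ (α := β ^ per ε j) (φ := (Sum.inr : G → F ⊕ G)) Sum.inr_injective]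
      · congr 1
        ext (x | x) <;> simp
      · exact fun x => pow_perm_comm (φ := (Sum.inr : G → F ⊕ G)) (fun _ => rfl) _ x
  · intro j
    exact chiOn_fiber_apply hχ hm j

theorem vertexWeight_equiv {vt : F → V} {e : Perm V} {α : Perm F}
    (h : ∀ x, vt (α x) = e (vt x)) {vt' : F' → V'} (θ : V ≃ V') (Θ : F ≃ F')
    (hΘ : ∀ x, vt' (Θ x) = θ (vt x)) :
    vertexWeight χ vt' (θ.permCongr e) (Θ.permCongr α) = vertexWeight χ vt e α := by
  have hm : ∀ x, vt' (Θ.permCongr α x) = θ.permCongr e (vt' x) := by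
    intro x
    obtain ⟨x, rfl⟩ := Θ.surjective x
    simp [hΘ, h]
  unfold vertexWeight
  rw [cycProd_permCongr]
  · refine cycProd_congr fun j => ?_
    rw [per_of_injective (α := e) θ.injective (fun x => by simp) j]
    rw [← chiOn_image hχ (α := α ^ per e j) (φ := Θ) Θ.injective]
    · congr 1
      ext x
      obtain ⟨x, rfl⟩ := Θ.surjective x
      simp [hΘ]
    · exact fun x => pow_perm_comm (φ := Θ) (fun _ => by simp) _ x
  · intro j
    exact chiOn_fiber_apply hχ hm j

end VertexWeight

/-! ### Weighted sums over flags at given vertices -/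

section SumOver

/-- The set of flags at vertices with given valences. -/
abbrev Flags {V : Type} (val : V → ℕ) : Type := Σ j : V, Fin (val j)

/-- Permutations of the flags that cover a given permutation of the vertices. -/
structure FlagPerm {V : Type} (e : Perm V) (val : V → ℕ) : Type where
  /-- the permutation of the flags -/
  perm : Perm (Flags val)
  cover : ∀ x, (perm x).1 = e x.1

/-- `FlagPerm` as a subtype. -/
def flagPermEquiv {V : Type} (e : Perm V) (val : V → ℕ) :
    FlagPerm e val ≃ {α : Perm (Flags val) // ∀ x, (α x).1 = e x.1} where
  toFun α := ⟨α.perm, α.cover⟩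
  invFun α := ⟨α.1, α.2⟩
  left_inv _ := rfl
  right_inv _ := rfl

noncomputable instance {V : Type} [Fintype V] (e : Perm V) (val : V → ℕ) :
    Fintype (FlagPerm e val) :=
  have : Finite (FlagPerm e val) := Finite.of_equiv _ (flagPermEquiv e val).symm
  Fintype.ofFinite _

/-- The permutation injects the flags at `j` into those at `e j`, and its inverse injects them back.
-/
theorem FlagPerm.val_apply {V : Type} {e : Perm V} {val : V → ℕ} (α : FlagPerm e val) (j : V) :
    val (e j) = val j := by
  have h1 : ∀ j, val j ≤ val (e j) := by
    intro j
    have : Function.Injective (fun x : Fin (val j) =>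
        (Fin.cast (congrArg val (α.cover ⟨j, x⟩)) (α.perm ⟨j, x⟩).2 : Fin (val (e j)))) := by
      intro x y hxy
      have h2 : α.perm ⟨j, x⟩ = α.perm ⟨j, y⟩ := by
        refine Sigma.ext ((α.cover ⟨j, x⟩).trans (α.cover ⟨j, y⟩).symm) ?_
        refine (Fin.heq_ext_iff (congrArg val ((α.cover ⟨j, x⟩).trans (α.cover ⟨j, y⟩).symm))).2 ?_
        simpa [Fin.ext_iff] using hxy
      simpa using α.perm.injective h2
    simpa using Fintype.card_le_of_injective _ this
  have h2 : val (e j) ≤ val j := by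
    have : Function.Injective (fun x : Fin (val (e j)) =>
        (Fin.cast (congrArg val (show (α.perm.symm ⟨e j, x⟩).1 = j by
          apply e.injective; rw [← α.cover]; simp)) (α.perm.symm ⟨e j, x⟩).2 : Fin (val j))) := by
      intro x y hxy
      have hf : ∀ x, (α.perm.symm ⟨e j, x⟩).1 = j := fun x => by
        apply e.injective; rw [← α.cover]; simp
      have h2 : α.perm.symm ⟨e j, x⟩ = α.perm.symm ⟨e j, y⟩ := by
        refine Sigma.ext ((hf _).trans (hf _).symm) ?_
        refine (Fin.heq_ext_iff (congrArg val ((hf _).trans (hf _).symm))).2 ?_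
        simpa [Fin.ext_iff] using hxy
      simpa using α.perm.symm.injective h2
    simpa using Fintype.card_le_of_injective _ this
  exact le_antisymm h2 (h1 j)

variable (k : Type u) [Field k] (D : ℕ) {A : Type*} [AddCommMonoid A] [Module k A]

open Classical in
/-- The weighted sum, over all ways to put flags at the vertices and all permutations of the flags
that cover a given permutation of the vertices, of an invariant of such data. The valences are
between `3` and `D`. -/
noncomputable def sumOver {V : Type} [Fintype V] (e : Perm V)
    (Φ : ∀ (F : Type) [Fintype F], (F → V) → Perm F → A) : A :=
  ∑ val : V → Finset.Icc 3 D, (∏ j, ((val j : ℕ).factorial : k))⁻¹ •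
    ∑ α : FlagPerm e (fun j => (val j : ℕ)), Φ (Flags fun j => (val j : ℕ)) Sigma.fst α.perm

/-- Invariance under bijections of the sets of flags. -/
def FlagInvariant {V : Type} (e : Perm V)
    (Φ : ∀ (F : Type) [Fintype F], (F → V) → Perm F → A) : Prop :=
  ∀ (F F' : Type) [Fintype F] [Fintype F'] (Θ : F ≃ F') (vt : F → V) (vt' : F' → V) (α : Perm F),
    (∀ x, vt (α x) = e (vt x)) → (∀ x, vt' (Θ x) = vt x) → Φ F' vt' (Θ.permCongr α) = Φ F vt α

theorem sumOver_congr {V : Type} [Fintype V] {e : Perm V}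
    {Φ Ψ : ∀ (F : Type) [Fintype F], (F → V) → Perm F → A}
    (h : ∀ (F : Type) [Fintype F] (vt : F → V) (α : Perm F), (∀ x, vt (α x) = e (vt x)) →
      Φ F vt α = Ψ F vt α) : sumOver k D e Φ = sumOver k D e Ψ := by
  classical
  unfold sumOver
  refine Finset.sum_congr rfl fun val _ => ?_
  congr 1
  exact Finset.sum_congr rfl fun α _ => h _ _ _ α.cover

theorem sumOver_permCongr {V V' : Type} [Fintype V] [Fintype V'] (θ : V ≃ V') (e : Perm V)
    {Φ : ∀ (F : Type) [Fintype F], (F → V) → Perm F → A}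
    {Φ' : ∀ (F : Type) [Fintype F], (F → V') → Perm F → A}
    (hΦ' : FlagInvariant (θ.permCongr e) Φ')
    (h : ∀ (F : Type) [Fintype F] (vt : F → V) (α : Perm F), (∀ x, vt (α x) = e (vt x)) →
      Φ' F (fun x => θ (vt x)) α = Φ F vt α) :
    sumOver k D (θ.permCongr e) Φ' = sumOver k D e Φ := by
  classical
  unfold sumOver
  symm
  refine Fintype.sum_equiv (θ.arrowCongr (Equiv.refl _)) _ _ fun val => ?_
  obtain ⟨val', rfl⟩ := (θ.arrowCongr (Equiv.refl _)).symm.surjective val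
  rw [apply_symm_apply]
  congr 1
  · congr 1
    exact Fintype.prod_equiv θ _ _ fun j => by simp [arrowCongr]
  let Θ : Flags (fun j => (val' (θ j) : ℕ)) ≃ Flags (fun j => (val' j : ℕ)) :=
    Equiv.sigmaCongrLeft (β := fun j => Fin (val' j : ℕ)) θ
  have hΘ : ∀ x, (Θ x).1 = θ x.1 := fun x => rfl
  let E : FlagPerm e (fun j => (val' (θ j) : ℕ)) ≃ FlagPerm (θ.permCongr e) (fun j => (val' j : ℕ)) :=
    (flagPermEquiv _ _).trans ((Θ.permCongr.subtypeEquiv fun α => ?_).trans (flagPermEquiv _ _).symm)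
  · refine Fintype.sum_equiv E _ _ fun α => ?_
    rw [← h]
    · exact (hΦ' _ _ Θ _ _ _ (fun x => by
        rw [permCongr_apply, symm_apply_apply]; exact congrArg θ (α.cover x)) (fun x => hΘ x)).symm
    · exact α.cover
  · constructor
    · intro h x
      obtain ⟨x, rfl⟩ := Θ.surjective x
      simp only [permCongr_apply, symm_apply_apply, hΘ]
      rw [h x]
    · intro h x
      have := h (Θ x)
      simp only [permCongr_apply, symm_apply_apply, hΘ] at this
      exact θ.injective this

/-- A permutation of a disjoint union that covers a disjoint union of permutations. -/
noncomputable def sumPermEquiv {V S F G : Type} [Finite F] [Finite G] (vt : F → V) (vs : G → S)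
    (e : Perm V) (ε : Perm S) :
    {α : Perm F // ∀ x, vt (α x) = e (vt x)} × {β : Perm G // ∀ x, vs (β x) = ε (vs x)} ≃
      {γ : Perm (F ⊕ G) // ∀ x, Sum.map vt vs (γ x) = Perm.sumCongr e ε (Sum.map vt vs x)} :=
  Equiv.ofBijective (fun p => ⟨Perm.sumCongr p.1.1 p.2.1, by
      rintro (x | x) <;> simp [p.1.2, p.2.2]⟩) (by
    constructor
    · rintro ⟨⟨a, ha⟩, ⟨b, hb⟩⟩ ⟨⟨a', ha'⟩, ⟨b', hb'⟩⟩ h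
      have h1 := congrArg Subtype.val h
      have := @Perm.sumCongrHom_injective F G (a, b) (a', b') h1
      simp only [Prod.mk.injEq] at this
      obtain ⟨rfl, rfl⟩ := this
      rfl
    · rintro ⟨γ, hγ⟩
      obtain ⟨⟨a, b⟩, rfl⟩ : γ ∈ (Perm.sumCongrHom F G).range := by
        refine Perm.mem_sumCongrHom_range_of_perm_mapsTo_inl ?_
        rintro _ ⟨x, rfl⟩
        have := hγ (Sum.inl x)
        rcases hx : γ (Sum.inl x) with y | y
        · exact ⟨y, rfl⟩
        · rw [hx] at this
          simp at this
      refine ⟨⟨⟨a, fun x => ?_⟩, ⟨b, fun x => ?_⟩⟩, rfl⟩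
      · simpa using hγ (Sum.inl x)
      · simpa using hγ (Sum.inr x))

/-- A permutation of the flags covering `e ⊕ ε` preserves the two halves, so it is a pair of
permutations (`sumPermEquiv`), and the factorials split accordingly. This Fubini rule lets attached
corollas be summed separately from the tree that carries them. -/
theorem sumOver_sumCongr {V S : Type} [Fintype V] [Fintype S] (e : Perm V) (ε : Perm S)
    {Φ : ∀ (F : Type) [Fintype F], (F → V ⊕ S) → Perm F → A}
    (hΦ : FlagInvariant (Perm.sumCongr e ε) Φ) :
    sumOver k D (Perm.sumCongr e ε) Φ =
      sumOver k D e fun F _ vt α => sumOver k D ε fun G _ vs β =>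
        Φ (F ⊕ G) (Sum.map vt vs) (Perm.sumCongr α β) := by
  classical
  unfold sumOver
  refine (Finset.sum_equiv (t := Finset.univ)
    (Equiv.sumArrowEquivProdArrow V S (Finset.Icc 3 D)) (by simp)
    (g := fun p => (∏ j, ((p.1 j : ℕ).factorial : k))⁻¹ • (∏ j, ((p.2 j : ℕ).factorial : k))⁻¹ •
      ∑ α : FlagPerm e (fun j => (p.1 j : ℕ)), ∑ β : FlagPerm ε (fun j => (p.2 j : ℕ)),
        Φ (Flags (fun j => (p.1 j : ℕ)) ⊕ Flags (fun j => (p.2 j : ℕ)))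
          (Sum.map Sigma.fst Sigma.fst) (Perm.sumCongr α.perm β.perm)) ?_).trans ?_
  · intro val _
    rw [smul_smul, ← mul_inv, Fintype.prod_sum_type]
    congr 1
    let Θ : Flags (fun j => (val j : ℕ)) ≃
        Flags (fun j => (val (Sum.inl j) : ℕ)) ⊕ Flags (fun j => (val (Sum.inr j) : ℕ)) :=
      Equiv.sumSigmaDistrib (fun j => Fin (val j : ℕ))
    have hΘ : ∀ x, Sum.map Sigma.fst Sigma.fst (Θ x) = x.1 := by
      rintro ⟨x | x, y⟩ <;> rfl
    let E : FlagPerm e (fun j => (val (Sum.inl j) : ℕ)) × FlagPerm ε (fun j => (val (Sum.inr j) : ℕ)) ≃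
        FlagPerm (Perm.sumCongr e ε) (fun j => (val j : ℕ)) :=
      ((flagPermEquiv _ _).prodCongr (flagPermEquiv _ _)).trans ((sumPermEquiv (Sigma.fst : Flags (fun j => (val (Sum.inl j) : ℕ)) → V)
        (Sigma.fst : Flags (fun j => (val (Sum.inr j) : ℕ)) → S) e ε).trans
        ((Θ.symm.permCongr.subtypeEquiv fun α => ?_).trans (flagPermEquiv _ _).symm))
    · rw [← Fintype.sum_prod_type']
      symm
      refine Fintype.sum_equiv E _ _ fun p => ?_
      refine (hΦ _ _ Θ.symm _ _ _ ?_ ?_).symm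
      · exact ((sumPermEquiv _ _ e ε) (⟨p.1.perm, p.1.cover⟩, ⟨p.2.perm, p.2.cover⟩)).2
      · intro x
        exact (hΘ (Θ.symm x)).symm.trans (congrArg _ (Θ.apply_symm_apply x))
    · rw [← Θ.forall_congr_right (q := fun x => Sum.map Sigma.fst Sigma.fst (α x) = _)]
      refine forall_congr' fun x => ?_
      rw [permCongr_apply, symm_symm, ← hΘ, ← hΘ x, apply_symm_apply]
  · rw [Fintype.sum_prod_type]
    refine Finset.sum_congr rfl fun val _ => ?_
    dsimp only
    rw [← Finset.smul_sum]
    congr 1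
    rw [Finset.sum_comm]
    refine Finset.sum_congr rfl fun val' _ => ?_
    rw [← Finset.smul_sum]

theorem sumOver_of_isEmpty {V : Type} [Fintype V] [IsEmpty V] (e : Perm V)
    {Φ : ∀ (F : Type) [Fintype F], (F → V) → Perm F → A} {a : A}
    (h : ∀ (F : Type) [Fintype F] [IsEmpty F] (vt : F → V) (α : Perm F), Φ F vt α = a) :
    sumOver k D e Φ = a := by
  classical
  unfold sumOver
  have : ∀ val : V → ℕ, Unique (FlagPerm e val) := fun val =>
    ⟨⟨⟨1, fun x => isEmptyElim x.1⟩⟩, fun α => by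
      obtain ⟨α, hα⟩ := α
      obtain rfl : α = 1 := Equiv.ext fun x => isEmptyElim x.1
      rfl⟩
  rw [Finset.sum_eq_single (fun j => isEmptyElim j)
    (fun b _ hb => absurd (Subsingleton.elim b _) hb) (fun h => absurd (Subsingleton.elim _ _) (by simpa using h))]
  simp only [Finset.univ_eq_empty, Finset.prod_empty, inv_one, one_smul, h, Finset.sum_const,
    Finset.card_univ]
  rw [Fintype.card_eq_one_iff_nonempty_unique.2 ⟨this _⟩, one_smul]

end SumOver

/-! ### Reduction of a rotated family of corollas to its return map -/

section Rotation

/-- The product `τ_{n-1} ⋯ τ_0`. -/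
def partialReturn {a m : ℕ} (τ : Fin (a + 1) → Perm (Fin m)) : ℕ → Perm (Fin m)
  | 0 => 1
  | n + 1 => (if h : n < a + 1 then τ ⟨n, h⟩ else 1) * partialReturn τ n

/-- The permutation of `Fin (a + 1) × Fin m` that covers the rotation, and has return map `ρ`. -/
def cycleModel (a : ℕ) {m : ℕ} (ρ : Perm (Fin m)) : Perm (Fin (a + 1) × Fin m) :=
  Equiv.prodShear (finRotate (a + 1)) (fun i => if i = Fin.last a then ρ else 1)

theorem cycleModel_fst (a : ℕ) {m : ℕ} (ρ : Perm (Fin m)) (x : Fin (a + 1) × Fin m) :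
    (cycleModel a ρ x).1 = finRotate (a + 1) x.1 := rfl

theorem FlagPerm.ext_perm {V : Type} {e : Perm V} {val : V → ℕ} {α β : FlagPerm e val}
    (h : α.perm = β.perm) : α = β := by
  cases α; cases β; cases h; rfl

/-- Permutations of a product that cover a permutation of the first factor. -/
noncomputable def flagPermConstEquiv {V : Type} (e : Perm V) (m : ℕ) :
    (V → Perm (Fin m)) ≃ FlagPerm e (fun _ => m) :=
  Equiv.ofBijective (fun τ => ⟨(Equiv.sigmaEquivProd V (Fin m)).symm.permCongr
    (Equiv.prodShear e τ), fun _ => rfl⟩) (by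
    constructor
    · intro τ τ' h
      funext j
      ext x
      have h1 := congrArg (fun α : FlagPerm e (fun _ => m) => (α.perm ⟨j, x⟩).2) h
      exact congrArg Fin.val h1
    · intro α
      have hinj : ∀ j, Function.Injective fun x : Fin m => (α.perm ⟨j, x⟩).2 := by
        intro j x y hxy
        have : α.perm ⟨j, x⟩ = α.perm ⟨j, y⟩ :=
          Sigma.ext ((α.cover ⟨j, x⟩).trans (α.cover ⟨j, y⟩).symm) (heq_of_eq hxy)
        simpa using α.perm.injective this
      refine ⟨fun j => Equiv.ofBijective _ (Finite.injective_iff_bijective.1 (hinj j)), ?_⟩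
      exact FlagPerm.ext_perm (Equiv.ext fun x => Sigma.ext (α.cover x).symm HEq.rfl))

/-- Left multiplication in the last coordinate permutes the tuples and translates `r`. Averaging
over these translations replaces each summand by the sum of `Ψ` over the whole group, which no
longer depends on the tuple. -/
theorem smul_sum_eq_of_mul_left {k : Type u} [Field k] [CharZero k] {A : Type*} [AddCommMonoid A]
    [Module k A] {G : Type*} [Group G] [Fintype G] [DecidableEq G] {a : ℕ}
    (r : (Fin (a + 1) → G) → G)
    (hr : ∀ g τ, r (Pi.mulSingle (Fin.last a) g * τ) = g * r τ) (Ψ : G → A) :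
    ((Fintype.card G : k) ^ (a + 1))⁻¹ • ∑ τ, Ψ (r τ) = (Fintype.card G : k)⁻¹ • ∑ g, Ψ g := by
  have h1 : ∀ g : G, ∑ τ, Ψ (g * r τ) = ∑ τ, Ψ (r τ) := fun g => by
    simp_rw [← hr]
    exact Equiv.sum_comp (Equiv.mulLeft (Pi.mulSingle (Fin.last a) g : Fin (a + 1) → G))
      (fun τ => Ψ (r τ))
  have h2 : (Fintype.card G : k) • ∑ τ, Ψ (r τ) = (Fintype.card G : k) ^ (a + 1) • ∑ g, Ψ g := by
    calc (Fintype.card G : k) • ∑ τ, Ψ (r τ) = ∑ g : G, ∑ τ, Ψ (g * r τ) := by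
          simp_rw [h1]; simp [Nat.cast_smul_eq_nsmul]
      _ = ∑ τ : Fin (a + 1) → G, ∑ g, Ψ (g * r τ) := Finset.sum_comm
      _ = ∑ τ : Fin (a + 1) → G, ∑ g, Ψ g :=
          Finset.sum_congr rfl fun τ _ => Equiv.sum_comp (Equiv.mulRight (r τ)) Ψ
      _ = _ := by
          simp only [Finset.sum_const, Finset.card_univ, Fintype.card_pi, Finset.prod_const,
            Fintype.card_fin]
          rw [← Nat.cast_smul_eq_nsmul k, Nat.cast_pow]
  have h0 : (Fintype.card G : k) ≠ 0 := Nat.cast_ne_zero.2 Fintype.card_ne_zero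
  rw [inv_smul_eq_iff₀ (pow_ne_zero _ h0), smul_comm, eq_inv_smul_iff₀ h0, h2]

variable (k : Type u) [Field k] [CharZero k] (D : ℕ) {A : Type*} [AddCommMonoid A] [Module k A]

/-- Up to renumbering the flags, a permutation covering a rotation is determined by its return map.
There are `(m !) ^ (a + 1)` tuples of fibre bijections, and every return map arises equally often,
which leaves the weight `1 / m !`. -/
theorem sumOver_finRotate (a : ℕ)
    {Φ : ∀ (F : Type) [Fintype F], (F → Fin (a + 1)) → Perm F → A}
    (hΦ : FlagInvariant (finRotate (a + 1)) Φ) :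
    sumOver k D (finRotate (a + 1)) Φ = ∑ m ∈ Finset.Icc 3 D, ((m.factorial : ℕ) : k)⁻¹ •
      ∑ ρ : Perm (Fin m), Φ (Fin (a + 1) × Fin m) Prod.fst (cycleModel a ρ) := by
  classical
  unfold sumOver
  rw [← Finset.sum_attach (Finset.Icc 3 D)]
  symm
  refine Finset.sum_of_injOn (fun m _ => m) ?_ ?_ ?_ ?_
  · intro m _ m' _ h
    exact congrFun h 0
  · intro m _
    simp
  · intro val _ hval
    -- A permutation of the flags over a transitive rotation forces all valences to agree, so the
    -- non-constant `val` contribute empty sums.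
    have : IsEmpty (FlagPerm (finRotate (a + 1)) fun j => (val j : ℕ)) := by
      refine ⟨fun α => hval ⟨val 0, by simp, ?_⟩⟩
      funext j
      exact eq_of_sameCycle (fun x => Subtype.ext (α.val_apply x)) (sameCycle_finRotate a j)
    rw [Finset.univ_eq_empty (α := FlagPerm (finRotate (a + 1)) fun j => (val j : ℕ)),
      Finset.sum_empty, smul_zero]
  · rintro ⟨m, hm⟩ _
    dsimp only
    rw [← Equiv.sum_comp (flagPermConstEquiv (finRotate (a + 1)) m)]
    -- Renumbering the flags over position `i` by the inverse of `partialReturn τ i` makes every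
    -- step trivial except the last, which becomes the full return map.
    have key : ∀ τ : Fin (a + 1) → Perm (Fin m),
        Φ (Flags fun _ : Fin (a + 1) => m) Sigma.fst
          (flagPermConstEquiv (finRotate (a + 1)) m τ).perm =
        Φ (Fin (a + 1) × Fin m) Prod.fst (cycleModel a (partialReturn τ (a + 1))) := by
      intro τ
      have h1 := hΦ _ _ (Equiv.sigmaEquivProd (Fin (a + 1)) (Fin m)).symm Prod.fst Sigma.fst
        (Equiv.prodShear (finRotate (a + 1)) τ) (fun x => rfl) (fun x => rfl)
      have h2 := hΦ _ _ (Equiv.prodShear (Equiv.refl (Fin (a + 1)))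
        (fun i => (partialReturn τ i)⁻¹)) Prod.fst Prod.fst
        (Equiv.prodShear (finRotate (a + 1)) τ) (fun x => rfl) (fun x => rfl)
      refine h1.trans (h2.symm.trans ?_)
      congr 1
      refine Equiv.ext fun y => ?_
      obtain ⟨⟨i, x⟩, rfl⟩ := (Equiv.prodShear (Equiv.refl (Fin (a + 1)))
        (fun i => (partialReturn τ i)⁻¹)).surjective y
      rw [permCongr_apply, symm_apply_apply]
      refine Prod.ext rfl ?_
      simp only [cycleModel, prodShear_apply, coe_refl, id_eq]
      by_cases hi : i = Fin.last a
      · subst hi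
        have e : partialReturn τ (a + 1) = τ (Fin.last a) * partialReturn τ a := by
          rw [partialReturn, dif_pos (Nat.lt_succ_self a)]; rfl
        rw [if_pos rfl, e, finRotate_last]
        simp [partialReturn]
      · have hlt : (i : ℕ) < a := by
          have := i.2
          have h3 : (i : ℕ) ≠ a := fun h => hi (Fin.ext h)
          omega
        rw [if_neg hi, finRotate_of_lt hlt]
        simp only [partialReturn, dif_pos i.2, mul_inv_rev]
        simp
    simp_rw [key]
    have hr : ∀ (g : Perm (Fin m)) (τ : Fin (a + 1) → Perm (Fin m)),
        partialReturn (Pi.mulSingle (Fin.last a) g * τ) (a + 1) = g * partialReturn τ (a + 1) := by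
      intro g τ
      have h3 : ∀ n ≤ a, partialReturn (Pi.mulSingle (Fin.last a) g * τ) n = partialReturn τ n := by
        intro n hn
        induction n with
        | zero => rfl
        | succ n ih =>
          rw [partialReturn, partialReturn, ih (by omega), dif_pos (by omega), dif_pos (by omega)]
          congr 1
          have : (⟨n, by omega⟩ : Fin (a + 1)) ≠ Fin.last a := by
            intro h; have := congrArg Fin.val h; simp at this; omega
          simp [this]
      rw [partialReturn, partialReturn, h3 a le_rfl, dif_pos (Nat.lt_succ_self a),
        dif_pos (Nat.lt_succ_self a), ← mul_assoc]
      congr 1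
      change ((Pi.mulSingle (Fin.last a) g : Fin (a + 1) → Perm (Fin m)) * τ) (Fin.last a) = g * τ (Fin.last a)
      simp
    have := smul_sum_eq_of_mul_left (k := k)
      (fun τ : Fin (a + 1) → Perm (Fin m) => partialReturn τ (a + 1)) hr
      (fun ρ => Φ (Fin (a + 1) × Fin m) Prod.fst (cycleModel a ρ))
    rw [Fintype.card_perm, Fintype.card_fin] at this
    rw [Finset.prod_const, Finset.card_univ, Fintype.card_fin, this]

end Rotation

/-! ### Cycle structure of the model permutation -/

section CycleModel

variable {a m : ℕ} (ρ : Perm (Fin m))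

theorem cycleModel_of_lt {i : ℕ} (hi : i < a) (x : Fin m) :
    cycleModel a ρ (⟨i, by omega⟩, x) = (⟨i + 1, by omega⟩, x) := by
  have h : (⟨i, by omega⟩ : Fin (a + 1)) ≠ Fin.last a := by
    intro h; have := congrArg Fin.val h; simp at this; omega
  refine Prod.ext (finRotate_of_lt hi) ?_
  simp [cycleModel, h]

theorem cycleModel_last (x : Fin m) : cycleModel a ρ (Fin.last a, x) = (0, ρ x) := by
  refine Prod.ext finRotate_last ?_
  simp [cycleModel]

theorem cycleModel_iterate_of_le (x : Fin m) {i : ℕ} (hi : i < a + 1) :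
    (cycleModel a ρ)^[i] (0, x) = (⟨i, hi⟩, x) := by
  induction i with
  | zero => rfl
  | succ i ih => rw [iterate_succ_apply', ih (by omega), cycleModel_of_lt ρ (by omega)]

theorem cycleModel_iterate_succ (x : Fin m) : (cycleModel a ρ)^[a + 1] (0, x) = (0, ρ x) := by
  rw [iterate_succ_apply', cycleModel_iterate_of_le ρ x (Nat.lt_succ_self a)]
  exact cycleModel_last ρ x

theorem cycleModel_iterate_mul (x : Fin m) (n : ℕ) :
    (cycleModel a ρ)^[(a + 1) * n] (0, x) = (0, ρ^[n] x) := by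
  induction n with
  | zero => rfl
  | succ n ih =>
    rw [Nat.mul_succ, Nat.add_comm ((a + 1) * n) (a + 1), iterate_add_apply, ih, cycleModel_iterate_succ,
      iterate_succ_apply']

theorem cycleModel_iterate (x : Fin m) (N : ℕ) :
    (cycleModel a ρ)^[N] (0, x) =
      (⟨N % (a + 1), Nat.mod_lt _ (Nat.succ_pos _)⟩, ρ^[N / (a + 1)] x) := by
  conv_lhs => rw [← Nat.mod_add_div N (a + 1)]
  rw [iterate_add_apply, cycleModel_iterate_mul, cycleModel_iterate_of_le]

theorem cycleModel_iterate_eq_zero_iff {x y : Fin m} {N : ℕ} :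
    (cycleModel a ρ)^[N] (0, x) = (0, y) ↔ a + 1 ∣ N ∧ ρ^[N / (a + 1)] x = y := by
  rw [cycleModel_iterate, Prod.mk.injEq, Fin.ext_iff, Nat.dvd_iff_mod_eq_zero]
  rfl

theorem sameCycle_cycleModel (x y : Fin m) :
    ρ.SameCycle x y ↔ (cycleModel a ρ).SameCycle (0, x) (0, y) := by
  rw [sameCycle_iff_exists_iterate, sameCycle_iff_exists_iterate]
  constructor
  · rintro ⟨n, rfl⟩
    exact ⟨(a + 1) * n, cycleModel_iterate_mul ρ x n⟩
  · rintro ⟨N, hN⟩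
    exact ⟨_, ((cycleModel_iterate_eq_zero_iff ρ).1 hN).2⟩

/-- The first return to the fibre over `0` takes `a + 1` steps and acts by `ρ`. This factor `a + 1`
in the period is the source of the Adams operation in `rootSum_cycleModel`. -/
theorem per_cycleModel (x : Fin m) : per (cycleModel a ρ) (0, x) = (a + 1) * per ρ x := by
  refine Nat.dvd_antisymm ?_ ?_
  · refine IsPeriodicPt.minimalPeriod_dvd ?_
    change _ = _
    rw [cycleModel_iterate_mul, iterate_minimalPeriod]
  · have h : (cycleModel a ρ)^[per (cycleModel a ρ) (0, x)] (0, x) = (0, x) :=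
      iterate_minimalPeriod
    obtain ⟨⟨c, hc⟩, h2⟩ := (cycleModel_iterate_eq_zero_iff ρ).1 h
    rw [hc] at h2 ⊢
    rw [Nat.mul_div_cancel_left _ (Nat.succ_pos a)] at h2
    exact Nat.mul_dvd_mul_left _ (IsPeriodicPt.minimalPeriod_dvd h2)

theorem exists_sameCycle_cycleModel (z : Fin (a + 1) × Fin m) :
    ∃ x, (cycleModel a ρ).SameCycle (0, x) z :=
  ⟨z.2, sameCycle_iff_exists_iterate.2 ⟨z.1, cycleModel_iterate_of_le ρ z.2 z.1.2⟩⟩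

theorem cycProd_cycleModel {M : Type*} [CommMonoid M] {g : Fin (a + 1) × Fin m → M}
    (hg : ∀ z, g (cycleModel a ρ z) = g z) :
    cycProd (cycleModel a ρ) g = cycProd ρ fun x => g (0, x) :=
  cycProd_of_map (fun x => (0, x)) (sameCycle_cycleModel ρ) hg fun z hz => by
    obtain ⟨x, hx⟩ := exists_sameCycle_cycleModel ρ z
    exact absurd hx (hz x)

end CycleModel

/-! ### Rooted corollas and the derivative of the characteristic -/

section Roots

variable {k : Type u} [Field k]

/-- The power sum `p_n` (for `n ≥ 1`). -/
noncomputable def pw (k : Type u) [Field k] (n : ℕ) : SymFun k := SymFun.p n.toPNat'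

theorem adams_pw (a : ℕ) {n : ℕ} (hn : 0 < n) :
    SymFun.adams (a + 1).toPNat' (pw k n) = pw k ((a + 1) * n) := by
  rw [pw, SymFun.adams_p, pw]
  congr 1
  apply PNat.eq
  rw [PNat.mul_coe, Nat.toPNat'_coe, Nat.toPNat'_coe, Nat.toPNat'_coe, if_pos hn,
    if_pos (Nat.succ_pos a), if_pos (Nat.mul_pos (Nat.succ_pos a) hn)]

theorem dp₁_pw {n : ℕ} (hn : 0 < n) : SymFun.dp₁ (pw k n) = if n = 1 then 1 else 0 := by
  rw [SymFun.dp₁, pw, SymFun.p]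
  split_ifs with h
  · subst h
    exact MvPowerSeries.pderiv_X_self
  · refine MvPowerSeries.pderiv_X_of_ne fun h1 => h ?_
    have h2 := congrArg PNat.val h1
    exact ((Nat.toPNat'_coe n).trans (if_pos hn)).symm.trans h2

theorem dp₁_smul (c : k) (f : SymFun k) : SymFun.dp₁ (c • f) = c • SymFun.dp₁ f :=
  (MvPowerSeries.pderiv k (1 : ℕ+)).map_smul c f

theorem dp₁_sum {ι : Type*} (s : Finset ι) (f : ι → SymFun k) :
    SymFun.dp₁ (∑ i ∈ s, f i) = ∑ i ∈ s, SymFun.dp₁ (f i) :=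
  map_sum _ _ _

open Classical in
theorem dp₁_prod {ι : Type*} (s : Finset ι) (f : ι → SymFun k) :
    SymFun.dp₁ (∏ i ∈ s, f i) = ∑ i ∈ s, (∏ j ∈ s.erase i, f j) * SymFun.dp₁ (f i) := by
  induction s using Finset.induction_on with
  | empty => exact MvPowerSeries.pderiv_one
  | insert a s ha ih =>
    rw [Finset.prod_insert ha, Finset.sum_insert ha, Finset.erase_insert ha]
    have h1 : SymFun.dp₁ (f a * ∏ i ∈ s, f i) =
        f a * SymFun.dp₁ (∏ i ∈ s, f i) + (∏ i ∈ s, f i) * SymFun.dp₁ (f a) :=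
      (MvPowerSeries.pderiv k (1 : ℕ+)).leibniz _ _
    rw [h1, ih, add_comm, Finset.mul_sum]
    congr 1
    refine Finset.sum_congr rfl fun i hi => ?_
    have hne : a ≠ i := fun h => ha (h ▸ hi)
    rw [Finset.erase_insert_of_ne hne, Finset.prod_insert (fun h => ha (Finset.mem_of_mem_erase h)),
      mul_assoc]

variable (χ : ∀ m : ℕ, Perm (Fin m) → k) (D : ℕ)

/-- The characteristic of a family of class functions, in degrees between `3` and `D`. -/
noncomputable def truncCh : SymFun k :=
  ∑ m ∈ Finset.Icc 3 D, ((m.factorial : ℕ) : k)⁻¹ •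
    ∑ ρ : Perm (Fin m), χ m ρ • cycProd ρ (fun x => pw k (per ρ x))

-- In the Leibniz rule only the factors equal to `p₁` have a nonzero derivative, and these belong to
-- the fixed points. The derivative thus marks a fixed flag, the future root.
open Classical in
theorem dp₁_cycProd {X : Type} [Fintype X] (ρ : Perm X) :
    SymFun.dp₁ (cycProd ρ fun x => pw k (per ρ x)) =
      ∑ x with ρ x = x, cycProd ρ fun y => if y = x then 1 else pw k (per ρ y) := by
  rw [cycProd, dp₁_prod]
  symm
  refine Finset.sum_of_injOn (fun x => (Quotient.mk'' x : Quotient (Perm.SameCycle.setoid ρ)))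
    ?_ ?_ ?_ ?_
  · intro x hx y hy h
    simp only [Finset.coe_filter, Finset.mem_univ, true_and, Set.mem_ofPred_eq] at hx hy
    dsimp only at h
    rw [Quotient.eq''] at h
    exact Perm.SameCycle.eq_of_left h hx
  · intro x _; simp
  · intro q _ hq
    rw [dp₁_pw (per_pos _ _), if_neg, mul_zero]
    intro hper
    refine hq ⟨q.out, ?_, Quotient.out_eq' q⟩
    simp only [Finset.coe_filter, Finset.mem_univ, true_and, Set.mem_ofPred_eq]
    exact minimalPeriod_eq_one_iff_isFixedPt.1 hper
  · intro x hx
    simp only [Finset.mem_filter, Finset.mem_univ, true_and] at hx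
    have hout : (Quotient.mk'' x : Quotient (Perm.SameCycle.setoid ρ)).out = x := by
      have : (Perm.SameCycle.setoid ρ) x (Quotient.mk'' x : Quotient (Perm.SameCycle.setoid ρ)).out :=
        Quotient.eq''.1 (Quotient.out_eq' _).symm
      exact (Perm.SameCycle.eq_of_left this hx).symm
    rw [hout, dp₁_pw (per_pos _ _), if_pos (minimalPeriod_eq_one_iff_isFixedPt.2 hx), mul_one,
      cycProd, ← Finset.mul_prod_erase _ _ (Finset.mem_univ
        (Quotient.mk'' x : Quotient (Perm.SameCycle.setoid ρ))), hout, if_pos rfl, one_mul]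
    refine Finset.prod_congr (by ext; simp) fun q hq => ?_
    rw [if_neg]
    intro h
    have hq' : q ≠ Quotient.mk'' x := by simpa using hq
    exact hq' (by rw [← Quotient.out_eq' q, h])

open Classical in
/-- The sum over equivariant choices of a flag at each vertex. -/
noncomputable def rootSum {L : Type} [Fintype L] (ε : Perm L) (F : Type) [Fintype F] (vt : F → L)
    (α : Perm F) : SymFun k :=
  ∑ root : L → F with (∀ l, vt (root l) = l) ∧ (∀ l, α (root l) = root (ε l)),
    vertexWeight χ vt ε α • cycProd α fun x => if x ∈ Set.range root then 1 else pw k (per α x)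

variable {χ} (hχ : IsClassFun χ)

theorem root_range_apply_iff {L F : Type} {ε : Perm L} {α : Perm F} {root : L → F}
    (h : ∀ l, α (root l) = root (ε l)) (x : F) : α x ∈ Set.range root ↔ x ∈ Set.range root := by
  constructor
  · rintro ⟨l, hl⟩
    refine ⟨ε.symm l, α.injective ?_⟩
    rw [h, apply_symm_apply, hl]
  · rintro ⟨l, rfl⟩
    exact ⟨ε l, (h l).symm⟩

include hχ

theorem rootSum_equiv {L L' F F' : Type} [Fintype L] [Fintype L'] [Fintype F] [Fintype F']
    {ε : Perm L} {vt : F → L} {vt' : F' → L'} {α : Perm F} (θ : L ≃ L') (Θ : F ≃ F')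
    (h : ∀ x, vt (α x) = ε (vt x)) (hΘ : ∀ x, vt' (Θ x) = θ (vt x)) :
    rootSum χ (θ.permCongr ε) F' vt' (Θ.permCongr α) = rootSum χ ε F vt α := by
  classical
  unfold rootSum
  symm
  refine Finset.sum_equiv (θ.arrowCongr Θ) ?_ ?_
  · intro root
    simp only [Finset.mem_filter, Finset.mem_univ, true_and]
    refine and_congr ?_ ?_
    · rw [← θ.forall_congr_right]
      refine forall_congr' fun l => ?_
      simp [hΘ]
    · rw [← θ.forall_congr_right (q := fun l => Θ.permCongr α _ = _)]
      refine forall_congr' fun l => ?_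
      simp
  · intro root hroot
    simp only [Finset.mem_filter, Finset.mem_univ, true_and] at hroot
    have hr : ∀ x, Θ x ∈ Set.range (θ.arrowCongr Θ root) ↔ x ∈ Set.range root := by
      intro x
      constructor
      · rintro ⟨l, hl⟩
        exact ⟨θ.symm l, Θ.injective hl⟩
      · rintro ⟨l, rfl⟩
        exact ⟨θ l, by simp⟩
    rw [vertexWeight_equiv hχ h θ Θ hΘ, cycProd_permCongr]
    · congr 1
      refine cycProd_congr fun x => ?_
      rw [per_of_injective (α := α) Θ.injective (fun x => by simp)]
      simp only [hr]
    · intro y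
      obtain ⟨x, rfl⟩ := Θ.surjective y
      rw [per_apply]
      simp only [permCongr_apply, symm_apply_apply, hr, root_range_apply_iff hroot.2]

theorem rootSum_flagInvariant {L : Type} [Fintype L] (ε : Perm L) :
    FlagInvariant ε (fun F _ vt α => rootSum χ ε F vt α) := by
  intro F F' _ _ Θ vt vt' α h hΘ
  exact rootSum_equiv hχ (Equiv.refl L) Θ h hΘ

/-- Roots lie over their own vertices, so a choice of roots over a disjoint union is a pair of
choices, and both weights are multiplicative. -/
theorem rootSum_sumCongr {L M F G : Type} [Fintype L] [Fintype M] [Fintype F] [Fintype G]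
    {ε : Perm L} {η : Perm M} {vt : F → L} {vs : G → M} {α : Perm F} {β : Perm G}
    (h : ∀ x, vt (α x) = ε (vt x)) (h' : ∀ x, vs (β x) = η (vs x)) :
    rootSum χ (Perm.sumCongr ε η) (F ⊕ G) (Sum.map vt vs) (Perm.sumCongr α β) =
      rootSum χ ε F vt α * rootSum χ η G vs β := by
  classical
  unfold rootSum
  rw [Finset.sum_mul_sum, ← Finset.sum_product']
  symm
  refine Finset.sum_nbij (fun r => Sum.map r.1 r.2) ?_ ?_ ?_ ?_
  · rintro ⟨r, s⟩ hrs
    simp only [Finset.mem_product, Finset.mem_filter, Finset.mem_univ, true_and] at hrs ⊢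
    constructor
    · rintro (l | l)
      · simp [hrs.1.1]
      · simp [hrs.2.1]
    · rintro (l | l)
      · simp [hrs.1.2]
      · simp [hrs.2.2]
  · rintro ⟨r, s⟩ _ ⟨r', s'⟩ _ hh
    refine Prod.ext (funext fun l => ?_) (funext fun l => ?_)
    · exact Sum.inl_injective (congrFun hh (Sum.inl l))
    · exact Sum.inr_injective (congrFun hh (Sum.inr l))
  · intro r hr
    simp only [Finset.coe_filter, Finset.mem_univ, true_and, Set.mem_ofPred_eq] at hr
    obtain ⟨hr1, hr2⟩ := hr
    have hl : ∀ l, ∃ x, r (Sum.inl l) = Sum.inl x := by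
      intro l
      have := hr1 (Sum.inl l)
      rcases hx : r (Sum.inl l) with x | x
      · exact ⟨x, rfl⟩
      · rw [hx] at this; simp at this
    have hl' : ∀ l, ∃ x, r (Sum.inr l) = Sum.inr x := by
      intro l
      have := hr1 (Sum.inr l)
      rcases hx : r (Sum.inr l) with x | x
      · rw [hx] at this; simp at this
      · exact ⟨x, rfl⟩
    choose f hf using hl
    choose g hg using hl'
    refine ⟨(f, g), ?_, ?_⟩
    · simp only [Finset.coe_product, Finset.coe_filter, Finset.mem_univ, true_and, Set.mem_prod,
        Set.mem_ofPred_eq]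
      refine ⟨⟨fun l => ?_, fun l => ?_⟩, ⟨fun l => ?_, fun l => ?_⟩⟩
      · simpa [hf] using hr1 (Sum.inl l)
      · simpa [hf] using hr2 (Sum.inl l)
      · simpa [hg] using hr1 (Sum.inr l)
      · simpa [hg] using hr2 (Sum.inr l)
    · funext l
      rcases l with l | l
      · exact (hf l).symm
      · exact (hg l).symm
  · rintro ⟨r, s⟩ hrs
    simp only [Finset.mem_product, Finset.mem_filter, Finset.mem_univ, true_and] at hrs
    rw [vertexWeight_sumCongr hχ h h', smul_mul_smul_comm, cycProd_sumCongr]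
    · congr 2
      · refine cycProd_congr fun x => ?_
        rw [per_of_injective (α := α) Sum.inl_injective (fun x => by simp)]
        simp
      · refine cycProd_congr fun x => ?_
        rw [per_of_injective (α := β) Sum.inr_injective (fun x => by simp)]
        simp
    · intro y
      rw [per_apply]
      have : ∀ l, Perm.sumCongr α β (Sum.map r s l) = Sum.map r s (Perm.sumCongr ε η l) := by
        rintro (l | l) <;> simp [hrs.1.2, hrs.2.2]
      have := root_range_apply_iff this y
      split_ifs with h1 h2 h2
      · rfl
      · exact absurd (this.1 h1) h2
      · exact absurd (this.2 h2) h1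
      · rfl

theorem vertexWeight_cycleModel (a m : ℕ) (ρ : Perm (Fin m)) :
    vertexWeight χ Prod.fst (finRotate (a + 1)) (cycleModel a ρ) = χ m ρ := by
  rw [vertexWeight, cycProd_finRotate]
  · rw [per_finRotate]
    refine chiOn_eq hχ (fun x => ((0 : Fin (a + 1)), x)) (fun x y h => congrArg Prod.snd h) ?_ ρ ?_
    · ext ⟨i, x⟩
      simp [eq_comm]
    · intro x
      rw [← Perm.iterate_eq_pow, cycleModel_iterate_succ]
  · exact fun j => chiOn_fiber_apply hχ (cycleModel_fst a ρ) j

/-- An equivariant choice of roots is determined by its value over position `0`, which must be fixed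
by the return map; by `dp₁_cycProd` such fixed points index the terms of the derivative. The
remaining cycles are `a + 1` times as long as the corresponding cycles of `ρ`, which is the effect
of the Adams operation. -/
theorem rootSum_cycleModel (a m : ℕ) (ρ : Perm (Fin m)) :
    rootSum χ (finRotate (a + 1)) (Fin (a + 1) × Fin m) Prod.fst (cycleModel a ρ) =
      χ m ρ • SymFun.adams (a + 1).toPNat' (SymFun.dp₁ (cycProd ρ fun x => pw k (per ρ x))) := by
  classical
  unfold rootSum
  rw [vertexWeight_cycleModel hχ, ← Finset.smul_sum, dp₁_cycProd, ← SymFun.adamsHom_apply, map_sum]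
  congr 1
  symm
  refine Finset.sum_nbij (fun x i => (i, x)) ?_ ?_ ?_ ?_
  · intro x hx
    simp only [Finset.mem_filter, Finset.mem_univ, true_and, implies_true] at hx ⊢
    intro i
    refine Prod.ext rfl ?_
    simp only [cycleModel, prodShear_apply]
    split_ifs
    · exact hx
    · rfl
  · intro x _ y _ h
    exact congrArg Prod.snd (congrFun h 0)
  · intro r hr
    simp only [Finset.coe_filter, Finset.mem_univ, true_and, Set.mem_ofPred_eq] at hr
    have h0 : r 0 = (0, (r 0).2) := Prod.ext (hr.1 0) rfl
    have hi : ∀ i, ∀ hi : i < a + 1, r ⟨i, hi⟩ = (⟨i, hi⟩, (r 0).2) := by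
      intro i hi
      induction i with
      | zero => exact h0
      | succ i ih =>
        have h1 := hr.2 ⟨i, by omega⟩
        rw [ih (by omega), cycleModel_of_lt ρ (by omega), finRotate_of_lt (by omega)] at h1
        exact h1.symm
    refine ⟨(r 0).2, ?_, ?_⟩
    · simp only [Finset.coe_filter, Finset.mem_univ, true_and, Set.mem_ofPred_eq]
      have h1 := hr.2 (Fin.last a)
      rw [finRotate_last, show r (Fin.last a) = _ from hi a (Nat.lt_succ_self a)] at h1
      have h2 := cycleModel_last (a := a) ρ (r 0).2
      exact congrArg Prod.snd (h2.symm.trans h1)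
    · funext i
      exact (hi i i.2).symm
  · intro x hx
    simp only [Finset.mem_filter, Finset.mem_univ, true_and] at hx
    rw [map_cycProd]
    symm
    rw [cycProd_cycleModel]
    · refine cycProd_congr fun y => ?_
      have : ((0 : Fin (a + 1)), y) ∈ Set.range (fun i : Fin (a + 1) => (i, x)) ↔ y = x := by
        simp [eq_comm]
      simp only [this]
      split_ifs with hyx
      · simp
      · rw [per_cycleModel, SymFun.adamsHom_apply, adams_pw a (per_pos _ _)]
    · intro z
      rw [per_apply]
      have : ∀ i : Fin (a + 1), cycleModel a ρ (i, x) = (finRotate (a + 1) i, x) := by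
        intro i
        refine Prod.ext rfl ?_
        simp only [cycleModel, prodShear_apply]
        split_ifs
        · exact hx
        · rfl
      have := root_range_apply_iff (root := fun i : Fin (a + 1) => (i, x)) this z
      split_ifs with h1 h2 h2
      · rfl
      · exact absurd (this.1 h1) h2
      · exact absurd (this.2 h2) h1
      · rfl

variable [CharZero k]

omit hχ [CharZero k] in
theorem sumOver_const_mul {V : Type} [Fintype V] {e : Perm V}
    (c : SymFun k) (Φ : ∀ (F : Type) [Fintype F], (F → V) → Perm F → SymFun k) :
    sumOver k D e (fun F _ vt α => c * Φ F vt α) = c * sumOver k D e Φ := by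
  unfold sumOver
  simp only [Finset.mul_sum, mul_smul_comm]

omit hχ [CharZero k] in
theorem sumOver_mul_const {V : Type} [Fintype V] {e : Perm V}
    (c : SymFun k) (Φ : ∀ (F : Type) [Fintype F], (F → V) → Perm F → SymFun k) :
    sumOver k D e (fun F _ vt α => Φ F vt α * c) = sumOver k D e Φ * c := by
  simp only [mul_comm _ c]
  exact sumOver_const_mul D c Φ

/-- The value of the product over the cycles of `ε` of the Adams operations of `∂v/∂p₁` as a sum
over collections of rooted corollas with an automorphism. -/
theorem cycProd_adams_dp₁ (L : Type) [Fintype L] (ε : Perm L) :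
    cycProd ε (fun j => SymFun.adams (per ε j).toPNat' (SymFun.dp₁ (truncCh χ D))) =
      sumOver k D ε (fun F _ vt α => rootSum χ ε F vt α) := by
  -- Both sides are invariant under bijections and multiplicative over disjoint unions, so only a
  -- single rotation has to be computed.
  refine perm_cycle_induction (P := fun L _ ε =>
    cycProd ε (fun j => SymFun.adams (per ε j).toPNat' (SymFun.dp₁ (truncCh χ D))) =
      sumOver k D ε (fun F _ vt α => rootSum χ ε F vt α)) ?_ ?_ ?_ ?_ L ε
  · intro X Y _ _ θ ε ih
    rw [sumOver_permCongr k D θ ε (rootSum_flagInvariant hχ _)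
      (Φ := fun F _ vt α => rootSum χ ε F vt α), ← ih, cycProd_permCongr]
    · refine cycProd_congr fun x => ?_
      rw [per_of_injective (α := ε) θ.injective (fun x => by simp)]
    · intro y; rw [per_apply]
    · intro F _ vt α h
      exact rootSum_equiv hχ θ (Equiv.refl F) (vt' := fun x => θ (vt x)) h (fun _ => rfl)
  · intro L _ _ ε
    rw [cycProd_of_isEmpty]
    symm
    refine sumOver_of_isEmpty k D ε fun F _ _ vt α => ?_
    simp only [rootSum, vertexWeight, cycProd_of_isEmpty, one_smul]
    simp
  · intro X Y _ _ ε η h1 h2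
    rw [sumOver_sumCongr k D ε η (rootSum_flagInvariant hχ _), cycProd_sumCongr]
    · have e1 : ∀ x : X, per (Perm.sumCongr ε η) (Sum.inl x) = per ε x := fun x =>
        per_of_injective Sum.inl_injective (fun x => by simp) x
      have e2 : ∀ x : Y, per (Perm.sumCongr ε η) (Sum.inr x) = per η x := fun x =>
        per_of_injective Sum.inr_injective (fun x => by simp) x
      simp only [e1, e2, h1, h2]
      rw [← sumOver_mul_const]
      refine sumOver_congr k D fun F _ vt α h => ?_
      rw [← sumOver_const_mul]
      refine sumOver_congr k D fun G _ vs β h' => ?_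
      exact (rootSum_sumCongr hχ h h').symm
    · intro y; rw [per_apply]
  · intro a
    rw [sumOver_finRotate k D a (rootSum_flagInvariant hχ _), cycProd_finRotate]
    · rw [per_finRotate, truncCh, dp₁_sum, ← SymFun.adamsHom_apply, map_sum]
      refine Finset.sum_congr rfl fun m _ => ?_
      rw [dp₁_smul, map_smul, dp₁_sum, map_sum]
      congr 1
      refine Finset.sum_congr rfl fun ρ _ => ?_
      rw [dp₁_smul, map_smul, rootSum_cycleModel hχ, SymFun.adamsHom_apply]
    · intro y; rw [per_apply]

end Roots

/-! ### Invariant subsets and binomial expansions over cycles -/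

section Subsets

variable {X : Type} [Fintype X]

-- A product of sums expands over sets of factors, here over sets of cycles, and a set of cycles is
-- the same as an invariant subset.
open Classical in
theorem cycProd_add {A : Type*} [CommRing A] (α : Perm X) {f g : X → A} :
    cycProd α (fun x => f x + g x) =
      ∑ L : Finset X with ∀ x, α x ∈ L ↔ x ∈ L, cycProd α fun x => if x ∈ L then f x else g x := by
  have e := Finset.prod_add (fun q : Quotient (Perm.SameCycle.setoid α) => f q.out)
    (fun q => g q.out) Finset.univ
  rw [cycProd, e]
  refine Finset.sum_nbij
    (fun t => Finset.univ.filter fun x =>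
      (Quotient.mk'' x : Quotient (Perm.SameCycle.setoid α)) ∈ t)
    ?_ ?_ ?_ ?_
  · intro t _
    simp only [Finset.mem_filter, Finset.mem_univ, true_and]
    intro x
    have : (Quotient.mk'' (α x) : Quotient (Perm.SameCycle.setoid α)) = Quotient.mk'' x := by
      rw [Quotient.eq'']
      exact Perm.sameCycle_apply_left.2 (Perm.SameCycle.refl _ _)
    rw [this]
  · intro t _ t' _ h
    ext q
    have := Finset.ext_iff.1 h q.out
    simpa [Quotient.out_eq'] using this
  · intro L hL
    simp only [Finset.coe_filter, Finset.mem_univ, true_and, Set.mem_ofPred_eq] at hL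
    refine ⟨Finset.univ.filter fun q : _root_.Quotient (Perm.SameCycle.setoid α) => q.out ∈ L, by simp, ?_⟩
    ext x
    simp only [Finset.mem_filter, Finset.mem_univ, true_and]
    refine iff_of_eq (eq_of_sameCycle (g := fun x => x ∈ L) (fun x => propext (hL x)) ?_)
    have h : (Perm.SameCycle.setoid α)
        (Quotient.mk'' x : Quotient (Perm.SameCycle.setoid α)).out x :=
      Quotient.eq''.1 (Quotient.out_eq' _)
    exact h
  · intro t _
    rw [cycProd]
    simp only [Finset.mem_filter, Finset.mem_univ, true_and, Quotient.out_eq']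
    rw [Finset.prod_ite]
    congr 1
    · exact Finset.prod_congr (by ext; simp) fun _ _ => rfl
    · exact Finset.prod_congr (by ext; simp) fun _ _ => rfl

theorem cycProd_eq_zero {A : Type*} [CommMonoidWithZero A] (α : Perm X) {g : X → A}
    (hg : ∀ x, g (α x) = g x) {x : X} (hx : g x = 0) : cycProd α g = 0 := by
  classical
  refine Finset.prod_eq_zero (Finset.mem_univ (Quotient.mk'' x)) ?_
  rw [← hx]
  have h : (Perm.SameCycle.setoid α)
      (Quotient.mk'' x : Quotient (Perm.SameCycle.setoid α)).out x :=
    Quotient.eq''.1 (Quotient.out_eq' _)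
  exact eq_of_sameCycle hg h

open Classical in
/-- The injections of `Fin s` with a given invariant image, together with the permutation that
makes them equivariant. -/
theorem card_equivariant_injections (α : Perm X) (s : ℕ) (L : Finset X)
    (hL : ∀ x, α x ∈ L ↔ x ∈ L) (hs : L.card = s) :
    (Finset.univ.filter fun p : Perm (Fin s) × (Fin s → X) => Function.Injective p.2 ∧
      (∀ i, α (p.2 i) = p.2 (p.1 i)) ∧ Finset.univ.image p.2 = L).card = s.factorial := by
  have hcard : Fintype.card (Fin s) = Fintype.card L := by simp [hs]
  have h1 : Fintype.card (Fin s ≃ L) = s.factorial := by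
    rw [Fintype.card_equiv (Fintype.equivOfCardEq hcard), Fintype.card_fin]
  rw [← h1, ← Finset.card_univ]
  symm
  -- The permutation of `Fin s` is forced, being `α` on `L` transported by the numbering. Only the
  -- numbering of `L` is free.
  refine Finset.card_nbij (fun θ : Fin s ≃ L =>
    (θ.symm.permCongr (α.subtypePerm hL), fun i => (θ i : X))) ?_ ?_ ?_
  · intro θ _
    refine Finset.mem_filter.2 ⟨Finset.mem_univ _, ?_⟩
    refine ⟨Subtype.val_injective.comp θ.injective, fun i => by simp, ?_⟩
    ext x
    simp only [Finset.mem_image, Finset.mem_univ, true_and]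
    constructor
    · rintro ⟨i, rfl⟩; exact (θ i).2
    · intro hx; exact ⟨θ.symm ⟨x, hx⟩, by simp⟩
  · intro θ _ θ' _ h
    ext i
    exact congrFun (congrArg Prod.snd h) i
  · rintro ⟨ε, j⟩ hp
    simp only [Finset.coe_filter, Finset.mem_univ, true_and, Set.mem_ofPred_eq] at hp
    obtain ⟨hj, hε, hi⟩ := hp
    have hmem : ∀ i, j i ∈ L := fun i => hi ▸ Finset.mem_image_of_mem _ (Finset.mem_univ _)
    have hbij : Function.Bijective (fun i => (⟨j i, hmem i⟩ : L)) := by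
      constructor
      · intro a b h; exact hj (congrArg Subtype.val h)
      · rintro ⟨x, hx⟩
        rw [← hi] at hx
        obtain ⟨i, _, rfl⟩ := Finset.mem_image.1 hx
        exact ⟨i, rfl⟩
    refine ⟨Equiv.ofBijective _ hbij, by simp, ?_⟩
    refine Prod.ext (Equiv.ext fun i => ?_) rfl
    simp only [permCongr_apply, symm_symm]
    rw [Equiv.symm_apply_eq]
    exact Subtype.ext (hε i)

open Classical in
/-- The expansion of a product over cycles of differences, over the invariant subsets of the
cycles, enumerated by equivariant injections. -/
theorem cycProd_sub_eq_sum {k : Type u} [Field k] [CharZero k] {A : Type*} [CommRing A]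
    [Algebra k A] (α : Perm X) (leg : X → Prop) (hleg : ∀ x, leg (α x) ↔ leg x) (a b : ℕ → A)
    {N : ℕ} (hN : Fintype.card X ≤ N) :
    cycProd α (fun x => if leg x then a (per α x) - b (per α x) else 1) =
      ∑ s ∈ Finset.range (N + 1), (s.factorial : k)⁻¹ • ∑ ε : Perm (Fin s),
        cycProd ε (fun i => - b (per ε i)) *
        ∑ j : Fin s → X with Function.Injective j ∧ (∀ i, leg (j i)) ∧ ∀ i, α (j i) = j (ε i),
          cycProd α (fun x => if leg x ∧ x ∉ Set.range j then a (per α x) else 1) := by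
  -- `T L` is the term of the expanded product in which `-b` is chosen exactly on the cycles inside
  -- `L`.
  let T : Finset X → A := fun L => cycProd α fun x =>
    if x ∈ L then - b (per α x) else if leg x then a (per α x) else 1
  -- An invariant set of `s` legs is the image of an equivariant injection in `s !` ways, by
  -- `card_equivariant_injections`; this cancels the factor `1 / s !`.
  have hR : ∀ s, ∑ ε : Perm (Fin s), cycProd ε (fun i => - b (per ε i)) *
        ∑ j : Fin s → X with Function.Injective j ∧ (∀ i, leg (j i)) ∧ ∀ i, α (j i) = j (ε i),
          cycProd α (fun x => if leg x ∧ x ∉ Set.range j then a (per α x) else 1) =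
      s.factorial • ∑ L : Finset X with ((∀ x, α x ∈ L ↔ x ∈ L) ∧ ∀ x ∈ L, leg x) ∧ L.card = s,
        T L := by
    intro s
    have h1 : ∑ ε : Perm (Fin s), cycProd ε (fun i => - b (per ε i)) *
        ∑ j : Fin s → X with Function.Injective j ∧ (∀ i, leg (j i)) ∧ ∀ i, α (j i) = j (ε i),
          cycProd α (fun x => if leg x ∧ x ∉ Set.range j then a (per α x) else 1) =
        ∑ p : Perm (Fin s) × (Fin s → X) with Function.Injective p.2 ∧ (∀ i, leg (p.2 i)) ∧
          ∀ i, α (p.2 i) = p.2 (p.1 i), T (Finset.univ.image p.2) := by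
      rw [Finset.sum_filter, Fintype.sum_prod_type]
      refine Finset.sum_congr rfl fun ε _ => ?_
      rw [Finset.mul_sum, Finset.sum_filter]
      refine Finset.sum_congr rfl fun j _ => ?_
      refine if_ctx_congr Iff.rfl (fun h => ?_) (fun _ => rfl)
      obtain ⟨hj, hjl, hje⟩ := h
      have h2 : cycProd ε (fun i => - b (per ε i)) =
          cycProd α (fun x => if x ∈ Set.range j then - b (per α x) else 1) := by
        rw [cycProd_of_injective (α := ε) hj (fun i => (hje i).symm)]
        · refine cycProd_congr fun i => ?_
          rw [if_pos ⟨i, rfl⟩, per_of_injective hj (fun i => (hje i).symm)]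
        · intro y
          rw [per_apply]
          simp only [root_range_apply_iff hje]
        · intro y hy
          rw [if_neg hy]
      rw [h2, ← cycProd_mul]
      refine cycProd_congr fun x => ?_
      by_cases hx : x ∈ Set.range j
      · have hx' : x ∈ Finset.univ.image j := by
          obtain ⟨i, rfl⟩ := hx; exact Finset.mem_image_of_mem _ (Finset.mem_univ _)
        rw [if_pos hx, if_neg (fun h => h.2 hx), if_pos hx', mul_one]
      · have hx' : x ∉ Finset.univ.image j := by
          intro h; obtain ⟨i, _, rfl⟩ := Finset.mem_image.1 h; exact hx ⟨i, rfl⟩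
        simp only [hx, hx', not_false_eq_true, and_true, if_false, one_mul]
    rw [h1]
    rw [← Finset.sum_fiberwise_of_maps_to (t := Finset.univ.filter fun L : Finset X =>
      ((∀ x, α x ∈ L ↔ x ∈ L) ∧ ∀ x ∈ L, leg x) ∧ L.card = s)
      (g := fun p : Perm (Fin s) × (Fin s → X) => Finset.univ.image p.2), Finset.smul_sum]
    · refine Finset.sum_congr rfl fun L hL => ?_
      simp only [Finset.mem_filter, Finset.mem_univ, true_and] at hL
      rw [Finset.sum_congr rfl (g := fun _ => T L)
        (fun p hp => by rw [(Finset.mem_filter.1 hp).2]), Finset.sum_const]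
      congr 1
      rw [← card_equivariant_injections α s L hL.1.1 hL.2, Finset.filter_filter]
      congr 1
      ext p
      simp only [Finset.mem_filter, Finset.mem_univ, true_and]
      constructor
      · rintro ⟨⟨h1, _, h2⟩, h3⟩
        exact ⟨h1, h2, h3⟩
      · rintro ⟨h1, h2, h3⟩
        refine ⟨⟨h1, fun i => hL.1.2 _ ?_, h2⟩, h3⟩
        rw [← h3]
        exact Finset.mem_image_of_mem _ (Finset.mem_univ _)
    · rintro ⟨ε, j⟩ hp
      simp only [Finset.mem_filter, Finset.mem_univ, true_and] at hp ⊢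
      refine ⟨⟨fun x => ?_, fun x hx => ?_⟩, ?_⟩
      · have := root_range_apply_iff hp.2.2 x
        simpa using this
      · obtain ⟨i, _, rfl⟩ := Finset.mem_image.1 hx
        exact hp.2.1 i
      · rw [Finset.card_image_of_injective _ hp.1]; simp
  have hL : cycProd α (fun x => if leg x then a (per α x) - b (per α x) else 1) =
      ∑ L : Finset X with (∀ x, α x ∈ L ↔ x ∈ L) ∧ ∀ x ∈ L, leg x, T L := by
    -- The value `0` of the first summand away from the legs kills every subset that is not made of
    -- legs.
    have e : ∀ x, (if leg x then a (per α x) - b (per α x) else 1) =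
        (if leg x then - b (per α x) else 0) + (if leg x then a (per α x) else 1) := by
      intro x; split_ifs <;> ring
    rw [cycProd_congr e, cycProd_add, ← Finset.filter_filter,
      Finset.sum_filter (fun L => ∀ x ∈ L, leg x)]
    refine Finset.sum_congr rfl fun L hL => ?_
    simp only [Finset.mem_filter, Finset.mem_univ, true_and] at hL
    split_ifs with h
    · refine cycProd_congr fun x => ?_
      by_cases hx : x ∈ L
      · rw [if_pos hx, if_pos hx, if_pos (h x hx)]
      · rw [if_neg hx, if_neg hx]
    · push Not at h
      obtain ⟨x, hx, hlx⟩ := h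
      refine cycProd_eq_zero α (fun x => ?_) (x := x) (by rw [if_pos hx, if_neg hlx])
      rw [per_apply]
      simp only [hL, hleg]
  rw [hL, ← Finset.sum_fiberwise_of_maps_to (t := Finset.range (N + 1)) (g := Finset.card)]
  · refine Finset.sum_congr rfl fun s _ => ?_
    rw [hR, Finset.filter_filter, ← Nat.cast_smul_eq_nsmul k, smul_smul, inv_mul_cancel₀, one_smul]
    exact Nat.cast_ne_zero.2 (Nat.factorial_ne_zero _)
  · intro L _
    rw [Finset.mem_range]
    have := Finset.card_le_univ L
    omega

open Classical in
/-- The sum over permutations of `Fin q` with an invariant subset, in terms of pairs of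
permutations. -/
theorem sum_perm_invariant_subset {A : Type*} [AddCommMonoid A]
    (Φ : ∀ (V : Type) [Fintype V], Perm V → Set V → A)
    (hΦ : ∀ (V V' : Type) [Fintype V] [Fintype V'] (θ : V ≃ V') (e : Perm V) (S : Set V),
      (∀ v, e v ∈ S ↔ v ∈ S) → Φ V' (θ.permCongr e) (θ '' S) = Φ V e S) (q : ℕ) :
    ∑ e : Perm (Fin q), ∑ S : Finset (Fin q) with ∀ x, e x ∈ S ↔ x ∈ S, Φ (Fin q) e S =
      ∑ p ∈ Finset.HasAntidiagonal.antidiagonal q, q.choose p.2 • ∑ e : Perm (Fin p.1), ∑ ε : Perm (Fin p.2),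
        Φ (Fin p.1 ⊕ Fin p.2) (Perm.sumCongr e ε) (Set.range Sum.inr) := by
  let Ψ : ℕ → A := fun s => ∑ e : Perm (Fin (q - s)), ∑ ε : Perm (Fin s),
    Φ (Fin (q - s) ⊕ Fin s) (Perm.sumCongr e ε) (Set.range Sum.inr)
  -- The permutations preserving a fixed `S` form the product of the symmetric groups of the
  -- complement and of `S`; a numbering of both parts identifies them with pairs. The result depends
  -- only on the size of `S`, which produces the binomial coefficients.
  have key : ∀ S : Finset (Fin q), ∑ e : Perm (Fin q) with ∀ x, e x ∈ S ↔ x ∈ S, Φ (Fin q) e S =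
      Ψ S.card := by
    intro S
    have h1 : Fintype.card {x // x ∉ S} = q - S.card := by
      rw [Fintype.card_subtype_compl, Fintype.card_fin, Fintype.card_coe]
    have h2 : Fintype.card {x // ¬ x ∉ S} = S.card := by simp
    let θ : Fin (q - S.card) ⊕ Fin S.card ≃ Fin q :=
      ((Fintype.equivFinOfCardEq h1).symm.sumCongr (Fintype.equivFinOfCardEq h2).symm).trans
        (Equiv.sumCompl (fun x => x ∉ S))
    have hθl : ∀ i, θ (Sum.inl i) ∉ S := fun i => ((Fintype.equivFinOfCardEq h1).symm i).2
    have hθr : ∀ i, θ (Sum.inr i) ∈ S := fun i =>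
      not_not.1 ((Fintype.equivFinOfCardEq h2).symm i).2
    have hθS : ∀ z, θ z ∈ S ↔ z ∈ Set.range (Sum.inr : Fin S.card → Fin (q - S.card) ⊕ Fin S.card) := by
      rintro (z | z)
      · simp [hθl]
      · simp [hθr]
    have himg : θ '' (Set.range Sum.inr) = (S : Set (Fin q)) := by
      ext x
      obtain ⟨z, rfl⟩ := θ.surjective x
      rw [θ.injective.mem_set_image, Finset.mem_coe, hθS]
    simp only [Ψ]
    rw [← Finset.sum_product']
    symm
    refine Finset.sum_nbij (fun p => θ.permCongr (Perm.sumCongr p.1 p.2)) ?_ ?_ ?_ ?_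
    · rintro ⟨e, ε⟩ _
      simp only [Finset.mem_filter, Finset.mem_univ, true_and]
      intro x
      obtain ⟨z, rfl⟩ := θ.surjective x
      rw [permCongr_apply, symm_apply_apply, hθS, hθS]
      rcases z with z | z <;> simp
    · rintro ⟨e, ε⟩ _ ⟨e', ε'⟩ _ h
      exact @Perm.sumCongrHom_injective _ _ (e, ε) (e', ε') (θ.permCongr.injective h)
    · intro e he
      simp only [Finset.coe_filter, Finset.mem_univ, true_and, Set.mem_ofPred_eq] at he
      have hmem : θ.symm.permCongr e ∈ (Perm.sumCongrHom (Fin (q - S.card)) (Fin S.card)).range := by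
        refine Perm.mem_sumCongrHom_range_of_perm_mapsTo_inl ?_
        rintro _ ⟨i, rfl⟩
        have : e (θ (Sum.inl i)) ∉ S := by rw [he]; exact hθl i
        rw [← θ.apply_symm_apply (e (θ (Sum.inl i))), hθS] at this
        simp only [permCongr_apply, symm_symm]
        rcases hz : θ.symm (e (θ (Sum.inl i))) with z | z
        · exact ⟨z, rfl⟩
        · exact absurd ⟨z, hz.symm⟩ this
      obtain ⟨p, hp⟩ := hmem
      refine ⟨p, by simp, ?_⟩
      change θ.permCongr (Perm.sumCongrHom _ _ p) = e
      rw [hp]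
      ext x
      simp
    · rintro ⟨e, ε⟩ _
      rw [← himg, hΦ]
      rintro (v | v) <;> simp
  calc _ = ∑ S : Finset (Fin q), ∑ e : Perm (Fin q) with ∀ x, e x ∈ S ↔ x ∈ S, Φ (Fin q) e S := by
        simp only [Finset.sum_filter]
        exact Finset.sum_comm
    _ = ∑ S ∈ (Finset.univ : Finset (Fin q)).powerset, Ψ S.card := by
        rw [Finset.powerset_univ]
        exact Finset.sum_congr rfl fun S _ => key S
    _ = ∑ s ∈ Finset.range (q + 1), q.choose s • Ψ s := by
        rw [Finset.sum_powerset_apply_card, Finset.card_univ, Fintype.card_fin]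
    _ = ∑ p ∈ Finset.HasAntidiagonal.antidiagonal q, q.choose p.2 • Ψ p.2 := by
        rw [← Finset.Nat.sum_antidiagonal_swap, Finset.Nat.sum_antidiagonal_eq_sum_range_succ_mk]
        rfl
    _ = _ := by
        refine Finset.sum_congr rfl fun p hp => ?_
        obtain ⟨r, s⟩ := p
        rw [Finset.HasAntidiagonal.mem_antidiagonal] at hp
        dsimp only at hp
        subst hp
        simp only [Ψ]
        rw [Nat.add_sub_cancel]

end Subsets

/-! ### Trees and sums over them -/

section Trees

variable {V V' F F' : Type}

/-- The involution `inv` makes the flags `F`, with their map `vt` to the vertices, into a tree. -/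
structure IsTree (vt : F → V) (inv : Perm F) : Prop where
  inv_inv : ∀ x, inv (inv x) = x
  connected : ∀ i j : V, Relation.ReflTransGen (fun a b => ∃ x, vt x = a ∧ vt (inv x) = b) i j
  genus_zero : Nat.card {x // inv x ≠ x} + 2 = 2 * Nat.card V

/-- The vertices in `S` are joined to the rest of the graph by one edge each, and have no other
edges. -/
def Good (vt : F → V) (inv : Perm F) (S : Set V) : Prop :=
  ∀ s ∈ S, ∃ x, vt x = s ∧ vt (inv x) ∉ S ∧ ∀ y, vt y = s → y ≠ x → inv y = y

theorem IsTree.equiv {vt : F → V} {vt' : F' → V'} {inv : Perm F} (h : IsTree vt inv) (θ : V ≃ V')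
    (Θ : F ≃ F') (hΘ : ∀ x, vt' (Θ x) = θ (vt x)) : IsTree vt' (Θ.permCongr inv) where
  inv_inv x := by simp [h.inv_inv]
  connected i j := by
    have := Relation.ReflTransGen.lift (p := fun a b => ∃ x, vt' x = a ∧
      vt' (Θ.permCongr inv x) = b) θ ?_ _ _ (h.connected (θ.symm i) (θ.symm j))
    · rw [← θ.apply_symm_apply i, ← θ.apply_symm_apply j]
      exact this
    · rintro _ _ ⟨x, rfl, rfl⟩
      exact ⟨Θ x, hΘ x, by simp [hΘ]⟩
  genus_zero := by
    rw [← Nat.card_congr θ, ← h.genus_zero]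
    congr 1
    refine (Nat.card_congr (Θ.subtypeEquiv fun x => ?_)).symm
    simp

theorem Good.equiv {vt : F → V} {vt' : F' → V'} {inv : Perm F} {S : Set V} (h : Good vt inv S)
    (θ : V ≃ V') (Θ : F ≃ F') (hΘ : ∀ x, vt' (Θ x) = θ (vt x)) :
    Good vt' (Θ.permCongr inv) (θ '' S) := by
  rintro _ ⟨s, hs, rfl⟩
  obtain ⟨x, hx, hx', hy⟩ := h s hs
  refine ⟨Θ x, by rw [hΘ, hx], ?_, fun y hys hyx => ?_⟩
  · rw [permCongr_apply, symm_apply_apply, hΘ, θ.injective.mem_set_image]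
    exact hx'
  · obtain ⟨y, rfl⟩ := Θ.surjective y
    rw [hΘ, θ.injective.eq_iff] at hys
    rw [permCongr_apply, symm_apply_apply, hy y hys fun h => hyx (congrArg Θ h)]

theorem permCongr_symm_permCongr (Θ : F ≃ F') (inv : Perm F) :
    Θ.symm.permCongr (Θ.permCongr inv) = inv := by
  ext x; simp

theorem isTree_equiv_iff {vt : F → V} {vt' : F' → V'} {inv : Perm F} (θ : V ≃ V')
    (Θ : F ≃ F') (hΘ : ∀ x, vt' (Θ x) = θ (vt x)) :
    IsTree vt' (Θ.permCongr inv) ↔ IsTree vt inv := by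
  refine ⟨fun h => ?_, fun h => h.equiv θ Θ hΘ⟩
  have := h.equiv (vt' := vt) θ.symm Θ.symm (fun x => by
    obtain ⟨x, rfl⟩ := Θ.surjective x; simp [hΘ])
  rwa [permCongr_symm_permCongr] at this

theorem good_equiv_iff {vt : F → V} {vt' : F' → V'} {inv : Perm F} {S : Set V} (θ : V ≃ V')
    (Θ : F ≃ F') (hΘ : ∀ x, vt' (Θ x) = θ (vt x)) :
    Good vt' (Θ.permCongr inv) (θ '' S) ↔ Good vt inv S := by
  refine ⟨fun h => ?_, fun h => h.equiv θ Θ hΘ⟩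
  have := h.equiv (vt' := vt) θ.symm Θ.symm (fun x => by
    obtain ⟨x, rfl⟩ := Θ.surjective x; simp [hΘ])
  rwa [permCongr_symm_permCongr, ← Set.image_comp, Equiv.symm_comp_self, Set.image_id] at this

variable {k : Type u} [Field k] (χ : ∀ m : ℕ, Perm (Fin m) → k)

/-- The product of the power sums attached to the cycles of legs. -/
noncomputable def legProd [Fintype F] (k : Type u) [Field k] (inv α : Perm F) : SymFun k :=
  open Classical in cycProd α fun x => if inv x = x then pw k (per α x) else 1

open Classical in
/-- The sum, over the trees with automorphism `α` in which the vertices in `S` are leaves attached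
to the other vertices, of their contributions. -/
noncomputable def graftSum [Fintype V] (S : Set V) (e : Perm V) (F : Type) [Fintype F]
    (vt : F → V) (α : Perm F) : SymFun k :=
  ∑ inv : Perm F with IsTree vt inv ∧ (∀ x, inv (α x) = α (inv x)) ∧ Good vt inv S,
    vertexWeight χ vt e α • legProd k inv α

theorem leg_apply_iff {inv α : Perm F} (h : ∀ x, inv (α x) = α (inv x)) (x : F) :
    inv (α x) = α x ↔ inv x = x := by
  rw [h, α.injective.eq_iff]

theorem legProd_equiv [Fintype F] [Fintype F'] {inv α : Perm F} (h : ∀ x, inv (α x) = α (inv x))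
    (Θ : F ≃ F') : legProd k (Θ.permCongr inv) (Θ.permCongr α) = legProd k inv α := by
  classical
  unfold legProd
  rw [cycProd_permCongr]
  · refine cycProd_congr fun x => ?_
    rw [per_of_injective (α := α) Θ.injective (fun x => by simp)]
    simp
  · intro y
    rw [per_apply, leg_apply_iff]
    intro y
    obtain ⟨x, rfl⟩ := Θ.surjective y
    simp [h]

variable {χ} (hχ : IsClassFun χ)
include hχ

theorem graftSum_equiv [Fintype V] [Fintype V'] [Fintype F] [Fintype F'] {S : Set V} {e : Perm V}
    {vt : F → V} {vt' : F' → V'} {α : Perm F} (θ : V ≃ V') (Θ : F ≃ F')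
    (h : ∀ x, vt (α x) = e (vt x)) (hΘ : ∀ x, vt' (Θ x) = θ (vt x)) :
    graftSum χ (θ '' S) (θ.permCongr e) F' vt' (Θ.permCongr α) = graftSum χ S e F vt α := by
  classical
  unfold graftSum
  symm
  refine Finset.sum_equiv Θ.permCongr ?_ ?_
  · intro inv
    simp only [Finset.mem_filter, Finset.mem_univ, true_and]
    rw [isTree_equiv_iff θ Θ hΘ, good_equiv_iff θ Θ hΘ, ← Θ.forall_congr_right]
    simp
  · intro inv hinv
    simp only [Finset.mem_filter, Finset.mem_univ, true_and] at hinv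
    rw [vertexWeight_equiv hχ h θ Θ hΘ, legProd_equiv hinv.2.1]

theorem graftSum_flagInvariant [Fintype V] (S : Set V) (e : Perm V) :
    FlagInvariant e (fun F _ vt α => graftSum χ S e F vt α) := by
  intro F F' _ _ Θ vt vt' α h hΘ
  have := graftSum_equiv hχ (S := S) (Equiv.refl V) Θ h hΘ
  rwa [Equiv.coe_refl, Set.image_id] at this

end Trees

/-! ### Grafting corollas onto legs -/

section Gluing

variable {V S F G : Type}

/-- The involution `inv'` arises from `inv` by joining the legs `j s` to the roots of corollas. -/
structure Glued (inv : Perm F) (j : S → F) (root : S → G) (inv' : Perm (F ⊕ G)) : Prop where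
  root_apply : ∀ s, inv' (Sum.inr (root s)) = Sum.inl (j s)
  leg_apply : ∀ s, inv' (Sum.inl (j s)) = Sum.inr (root s)
  inl_apply : ∀ x, x ∉ Set.range j → inv' (Sum.inl x) = Sum.inl (inv x)
  inr_apply : ∀ y, y ∉ Set.range root → inv' (Sum.inr y) = Sum.inr y

variable {vt : F → V} {vs : G → S} {inv : Perm F} {j : S → F} {root : S → G}
  {inv' : Perm (F ⊕ G)}

open Classical in
theorem exists_glued (hinv : ∀ x, inv (inv x) = x) (hj : Function.Injective j)
    (hleg : ∀ s, inv (j s) = j s) (hroot : ∀ s, vs (root s) = s) :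
    ∃ inv' : Perm (F ⊕ G), Glued inv j root inv' := by
  have hri : Function.Injective root := fun s t h => by rw [← hroot s, h, hroot]
  let f : F ⊕ G → F ⊕ G := Sum.elim
    (fun x => if h : ∃ s, j s = x then Sum.inr (root h.choose) else Sum.inl (inv x))
    (fun y => if h : ∃ s, root s = y then Sum.inl (j h.choose) else Sum.inr y)
  have f1 : ∀ s, f (Sum.inl (j s)) = Sum.inr (root s) := by
    intro s
    have h : ∃ t, j t = j s := ⟨s, rfl⟩
    change (if h : ∃ t, j t = j s then Sum.inr (root h.choose) else Sum.inl (inv (j s))) = _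
    rw [dif_pos h, hj h.choose_spec]
  have f2 : ∀ s, f (Sum.inr (root s)) = Sum.inl (j s) := by
    intro s
    have h : ∃ t, root t = root s := ⟨s, rfl⟩
    change (if h : ∃ t, root t = root s then Sum.inl (j h.choose) else Sum.inr (root s)) = _
    rw [dif_pos h, hri h.choose_spec]
  have f3 : ∀ x, x ∉ Set.range j → f (Sum.inl x) = Sum.inl (inv x) := fun x hx => dif_neg hx
  have f4 : ∀ y, y ∉ Set.range root → f (Sum.inr y) = Sum.inr y := fun y hy => dif_neg hy
  have hf : Function.Involutive f := by
    rintro (x | y)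
    · by_cases hx : x ∈ Set.range j
      · obtain ⟨s, rfl⟩ := hx
        rw [f1, f2]
      · have hx' : inv x ∉ Set.range j := by
          rintro ⟨s, hs⟩
          refine hx ⟨s, ?_⟩
          rw [← hinv x, ← hs, hleg]
        rw [f3 x hx, f3 _ hx', hinv]
    · by_cases hy : y ∈ Set.range root
      · obtain ⟨s, rfl⟩ := hy
        rw [f2, f1]
      · rw [f4 y hy, f4 y hy]
  exact ⟨hf.toPerm, f2, f1, f3, f4⟩

theorem Glued.inv_inv (hg : Glued inv j root inv') (hinv : ∀ x, inv (inv x) = x)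
    (hleg : ∀ s, inv (j s) = j s) (z : F ⊕ G) : inv' (inv' z) = z := by
  rcases z with x | y
  · by_cases hx : x ∈ Set.range j
    · obtain ⟨s, rfl⟩ := hx
      rw [hg.leg_apply, hg.root_apply]
    · have hx' : inv x ∉ Set.range j := by
        rintro ⟨s, hs⟩
        refine hx ⟨s, ?_⟩
        rw [← hinv x, ← hs, hleg]
      rw [hg.inl_apply x hx, hg.inl_apply _ hx', hinv]
  · by_cases hy : y ∈ Set.range root
    · obtain ⟨s, rfl⟩ := hy
      rw [hg.root_apply, hg.leg_apply]
    · rw [hg.inr_apply y hy, hg.inr_apply y hy]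

theorem Glued.inl_eq_iff (hg : Glued inv j root inv') (x : F) :
    inv' (Sum.inl x) = Sum.inl x ↔ inv x = x ∧ x ∉ Set.range j := by
  by_cases hx : x ∈ Set.range j
  · obtain ⟨s, rfl⟩ := hx
    rw [hg.leg_apply]
    simp
  · rw [hg.inl_apply x hx]
    simp [hx]

theorem Glued.inr_eq_iff (hg : Glued inv j root inv') (y : G) :
    inv' (Sum.inr y) = Sum.inr y ↔ y ∉ Set.range root := by
  by_cases hy : y ∈ Set.range root
  · obtain ⟨s, rfl⟩ := hy
    rw [hg.root_apply]
    simp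
  · rw [hg.inr_apply y hy]
    simp [hy]

theorem Glued.good (hg : Glued inv j root inv') (hroot : ∀ s, vs (root s) = s) :
    Good (Sum.map vt vs) inv' (Set.range Sum.inr) := by
  rintro _ ⟨s, rfl⟩
  refine ⟨Sum.inr (root s), by simp [hroot], by rw [hg.root_apply]; simp, ?_⟩
  rintro (x | y) hy hne
  · simp at hy
  · rw [hg.inr_eq_iff]
    rintro ⟨t, rfl⟩
    simp only [Sum.map_inr, Sum.inr.injEq, hroot] at hy
    exact hne (by rw [hy])

/-- None of the flags `j s` and `root s` was on an edge before; each `s` contributes the two ends of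
its new edge. -/
theorem Glued.card_nonfixed [Finite S] [Finite F] (hg : Glued inv j root inv')
    (hj : Function.Injective j)
    (hleg : ∀ s, inv (j s) = j s) (hroot : ∀ s, vs (root s) = s) :
    Nat.card {z // inv' z ≠ z} = Nat.card {x // inv x ≠ x} + 2 * Nat.card S := by
  have hri : Function.Injective root := fun s t h => by rw [← hroot s, h, hroot]
  have hmem : ∀ z : {x // inv x ≠ x} ⊕ S ⊕ S,
      inv' (Sum.elim (fun x => Sum.inl x.1) (Sum.elim (fun s => Sum.inl (j s))
        fun s => Sum.inr (root s)) z) ≠ Sum.elim (fun x => Sum.inl x.1)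
        (Sum.elim (fun s => Sum.inl (j s)) fun s => Sum.inr (root s)) z := by
    rintro (x | s | s)
    · exact fun h => x.2 ((hg.inl_eq_iff _).1 h).1
    · exact fun h => ((hg.inl_eq_iff _).1 h).2 ⟨s, rfl⟩
    · exact fun h => (hg.inr_eq_iff _).1 h ⟨s, rfl⟩
  have hb : Function.Bijective fun z : {x // inv x ≠ x} ⊕ S ⊕ S =>
      (⟨_, hmem z⟩ : {z // inv' z ≠ z}) := by
    constructor
    · rintro (x | s | s) (x' | s' | s') h <;>
        simp only [Subtype.mk.injEq, Sum.elim_inl, Sum.elim_inr, Sum.inl.injEq, Sum.inr.injEq,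
          reduceCtorEq] at h
      · rw [Subtype.ext h]
      · exact absurd (by rw [h, hleg]) x.2
      · exact absurd (by rw [← h, hleg]) x'.2
      · rw [hj h]
      · rw [hri h]
    · rintro ⟨x | y, hz⟩
      · rw [ne_eq, hg.inl_eq_iff, not_and_or, not_not] at hz
        by_cases hx : x ∈ Set.range j
        · obtain ⟨s, rfl⟩ := hx
          exact ⟨Sum.inr (Sum.inl s), rfl⟩
        · exact ⟨Sum.inl ⟨x, hz.resolve_right hx⟩, rfl⟩
      · have hy := hz
        rw [ne_eq, hg.inr_eq_iff, not_not] at hy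
        obtain ⟨s, rfl⟩ := hy
        exact ⟨Sum.inr (Sum.inr s), rfl⟩
  rw [← Nat.card_congr (Equiv.ofBijective _ hb), Nat.card_sum, Nat.card_sum, two_mul]

/-- Grafting adds as many edges as vertices, so the genus does not change. Paths in the grafted
graph contract to the original one by sending each new vertex to the vertex that carries it, and
conversely each new vertex is joined to that vertex. -/
theorem Glued.isTree_iff [Finite V] [Finite S] [Finite F] (hg : Glued inv j root inv')
    (hj : Function.Injective j) (hinv : ∀ x, inv (inv x) = x)
    (hleg : ∀ s, inv (j s) = j s) (hroot : ∀ s, vs (root s) = s) :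
    IsTree (Sum.map vt vs) inv' ↔ IsTree vt inv := by
  have hc : Nat.card {z // inv' z ≠ z} + 2 = 2 * Nat.card (V ⊕ S) ↔
      Nat.card {x // inv x ≠ x} + 2 = 2 * Nat.card V := by
    rw [hg.card_nonfixed hj hleg hroot, Nat.card_sum]
    omega
  constructor
  · intro h
    refine ⟨hinv, fun a b => ?_, hc.1 h.genus_zero⟩
    have := Relation.ReflTransGen.lift' (p := fun a b => ∃ x, vt x = a ∧ vt (inv x) = b)
      (Sum.elim id fun s => vt (j s)) ?_ _ _ (h.connected (Sum.inl a) (Sum.inl b))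
    · exact this
    · rintro _ _ ⟨x | y, rfl, rfl⟩
      · by_cases hx : x ∈ Set.range j
        · obtain ⟨s, rfl⟩ := hx
          rw [hg.leg_apply]
          simp only [Sum.map_inl, Sum.map_inr, hroot]
          exact Relation.ReflTransGen.refl
        · rw [hg.inl_apply x hx]
          exact Relation.ReflTransGen.single ⟨x, rfl, rfl⟩
      · by_cases hy : y ∈ Set.range root
        · obtain ⟨s, rfl⟩ := hy
          rw [hg.root_apply]
          simp only [Sum.map_inl, Sum.map_inr, hroot]
          exact Relation.ReflTransGen.refl
        · rw [hg.inr_apply y hy]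
  · intro h
    let R := fun a b : V ⊕ S => ∃ x, Sum.map vt vs x = a ∧ Sum.map vt vs (inv' x) = b
    have hV : ∀ a b, Relation.ReflTransGen R (Sum.inl a) (Sum.inl b) := by
      intro a b
      refine Relation.ReflTransGen.lift' (p := R) Sum.inl ?_ _ _ (h.connected a b)
      rintro _ _ ⟨x, rfl, rfl⟩
      by_cases hx : x ∈ Set.range j
      · obtain ⟨s, rfl⟩ := hx
        rw [hleg]
      · exact Relation.ReflTransGen.single ⟨Sum.inl x, rfl, by rw [hg.inl_apply x hx]; rfl⟩
    have h1 : ∀ s, R (Sum.inl (vt (j s))) (Sum.inr s) := fun s =>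
      ⟨Sum.inl (j s), rfl, by rw [hg.leg_apply]; simp [hroot]⟩
    have h2 : ∀ s, R (Sum.inr s) (Sum.inl (vt (j s))) := fun s =>
      ⟨Sum.inr (root s), by simp [hroot], by rw [hg.root_apply]; simp⟩
    refine ⟨hg.inv_inv hinv hleg, ?_, hc.2 h.genus_zero⟩
    rintro (a | s) (b | t)
    · exact hV a b
    · exact (hV a _).tail (h1 t)
    · exact Relation.ReflTransGen.head (h2 s) (hV _ b)
    · exact Relation.ReflTransGen.head (h2 s) ((hV _ _).tail (h1 t))

/-- A graph whose vertices in `S` are leaves is obtained by gluing. -/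
theorem exists_glued_of_good (hinv' : ∀ z, inv' (inv' z) = z)
    (h : Good (Sum.map vt vs) inv' (Set.range Sum.inr)) :
    ∃ (inv : Perm F) (j : S → F) (root : S → G), Glued inv j root inv' ∧ Function.Injective j ∧
      (∀ x, inv (inv x) = x) ∧ (∀ s, inv (j s) = j s) ∧ ∀ s, vs (root s) = s := by
  classical
  have h1 : ∀ s, ∃ (y : G) (x : F), vs y = s ∧ inv' (Sum.inr y) = Sum.inl x ∧
      ∀ y', vs y' = s → y' ≠ y → inv' (Sum.inr y') = Sum.inr y' := by
    intro s
    obtain ⟨y | y, hy, hy', hu⟩ := h _ ⟨s, rfl⟩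
    · simp at hy
    · rcases hx : inv' (Sum.inr y) with x | x
      · refine ⟨y, x, by simpa using hy, hx, fun y' hs hne => hu _ (by simp [hs]) ?_⟩
        exact fun h => hne (Sum.inr_injective h)
      · rw [hx] at hy'
        simp at hy'
  choose root j hroot hrj hu using h1
  have hjr : ∀ s, inv' (Sum.inl (j s)) = Sum.inr (root s) := fun s => by rw [← hrj, hinv']
  have hri : Function.Injective root := fun s t h => by rw [← hroot s, h, hroot]
  have hj : Function.Injective j := fun s t hst => hri (Sum.inr_injective
    ((hjr s).symm.trans ((congrArg (fun x => inv' (Sum.inl x)) hst).trans (hjr t))))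
  have hfix : ∀ y, y ∉ Set.range root → inv' (Sum.inr y) = Sum.inr y := fun y hy =>
    hu (vs y) y rfl fun h => hy ⟨_, h.symm⟩
  -- Cutting off the leaves turns `j s` into a leg, hence the value `x` there. No other flag of `F`
  -- can be joined to `G`: the roots are joined to the flags `j s`, and the other flags of `G` are
  -- fixed.
  have hl : ∀ x, ∃ x', (x ∈ Set.range j → x' = x) ∧
      (x ∉ Set.range j → inv' (Sum.inl x) = Sum.inl x') := by
    intro x
    by_cases hx : x ∈ Set.range j
    · exact ⟨x, fun _ => rfl, fun h => absurd hx h⟩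
    · rcases hz : inv' (Sum.inl x) with x' | y
      · exact ⟨x', fun h => absurd h hx, fun _ => rfl⟩
      · exfalso
        by_cases hy : y ∈ Set.range root
        · obtain ⟨s, rfl⟩ := hy
          rw [← hjr] at hz
          exact hx ⟨s, Sum.inl_injective (inv'.injective hz).symm⟩
        · have h2 := hfix y hy
          rw [← hz, hinv', hz] at h2
          simp at h2
  choose f hf1 hf2 using hl
  have hf : Function.Involutive f := by
    intro x
    by_cases hx : x ∈ Set.range j
    · rw [hf1 x hx, hf1 x hx]
    · have h2 := hf2 x hx
      have hx' : f x ∉ Set.range j := by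
        rintro ⟨s, hs⟩
        have h3 := hinv' (Sum.inl x)
        rw [h2, ← hs, hjr] at h3
        simp at h3
      have h3 := hf2 _ hx'
      rw [← h2, hinv'] at h3
      exact (Sum.inl_injective h3).symm
  exact ⟨hf.toPerm, j, root, ⟨hrj, hjr, hf2, hfix⟩, hj, hf, fun s => hf1 _ ⟨s, rfl⟩, hroot⟩

/-- The roots are the flags of `G` whose partner lies in `F`, so a commuting `α ⊕ β` preserves them.
Since each vertex has one root, `root` is equivariant, and passing to partners gives the same for
`j`. -/
theorem Glued.commute_iff (hg : Glued inv j root inv')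
    (hleg : ∀ s, inv (j s) = j s) (hroot : ∀ s, vs (root s) = s)
    {ε : Perm S} {α : Perm F} {β : Perm G} (hβ : ∀ y, vs (β y) = ε (vs y)) :
    (∀ z, inv' (Perm.sumCongr α β z) = Perm.sumCongr α β (inv' z)) ↔
      (∀ x, inv (α x) = α (inv x)) ∧ (∀ s, α (j s) = j (ε s)) ∧ ∀ s, β (root s) = root (ε s) := by
  constructor
  · intro h
    have hr : ∀ s, β (root s) = root (ε s) := by
      intro s
      have hmem : β (root s) ∈ Set.range root := by
        by_contra hn
        have h1 := h (Sum.inr (root s))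
        rw [Perm.sumCongr_apply, Sum.map_inr, hg.inr_apply _ hn, hg.root_apply] at h1
        simp at h1
      obtain ⟨t, ht⟩ := hmem
      have := hβ (root s)
      rw [← ht, hroot, hroot] at this
      rw [← ht, this]
    have hjj : ∀ s, α (j s) = j (ε s) := by
      intro s
      have h1 := h (Sum.inr (root s))
      rw [hg.root_apply, Perm.sumCongr_apply, Sum.map_inr, hr, hg.root_apply] at h1
      simpa using h1.symm
    refine ⟨fun x => ?_, hjj, hr⟩
    by_cases hx : x ∈ Set.range j
    · obtain ⟨s, rfl⟩ := hx
      rw [hleg, hjj, hleg]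
    · have hx' : α x ∉ Set.range j := fun h => hx ((root_range_apply_iff hjj x).1 h)
      have h1 := h (Sum.inl x)
      rw [hg.inl_apply x hx, Perm.sumCongr_apply, Sum.map_inl, hg.inl_apply _ hx'] at h1
      simpa using h1
  · rintro ⟨h1, hjj, hr⟩ (x | y)
    · by_cases hx : x ∈ Set.range j
      · obtain ⟨s, rfl⟩ := hx
        simp [hg.leg_apply, hjj, hr]
      · have hx' : α x ∉ Set.range j := fun h => hx ((root_range_apply_iff hjj x).1 h)
        simp [hg.inl_apply _ hx', hg.inl_apply _ hx, h1]
    · by_cases hy : y ∈ Set.range root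
      · obtain ⟨s, rfl⟩ := hy
        simp [hg.root_apply, hjj, hr]
      · have hy' : β y ∉ Set.range root := fun h => hy ((root_range_apply_iff hr y).1 h)
        simp [hg.inr_apply _ hy', hg.inr_apply _ hy]

theorem Glued.legProd_eq {k : Type u} [Field k] [Fintype F] [Fintype G]
    (hg : Glued inv j root inv') {ε : Perm S} {α : Perm F} {β : Perm G}
    (h : ∀ x, inv (α x) = α (inv x)) (hjj : ∀ s, α (j s) = j (ε s))
    (hr : ∀ s, β (root s) = root (ε s)) :
    open Classical in
    legProd k inv' (Perm.sumCongr α β) =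
      cycProd α (fun x => if inv x = x ∧ x ∉ Set.range j then pw k (per α x) else 1) *
        cycProd β (fun y => if y ∈ Set.range root then 1 else pw k (per β y)) := by
  classical
  unfold legProd
  rw [cycProd_sumCongr]
  · congr 1
    · refine cycProd_congr fun x => ?_
      rw [per_of_injective (α := α) Sum.inl_injective (fun x => by simp)]
      simp only [hg.inl_eq_iff]
    · refine cycProd_congr fun y => ?_
      rw [per_of_injective (α := β) Sum.inr_injective (fun x => by simp)]
      simp only [hg.inr_eq_iff]
      split_ifs <;> rfl
  · rintro (x | y)
    · rw [per_apply, Perm.sumCongr_apply, Sum.map_inl]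
      simp only [hg.inl_eq_iff, leg_apply_iff h, root_range_apply_iff hjj]
    · rw [per_apply, Perm.sumCongr_apply, Sum.map_inr]
      simp only [hg.inr_eq_iff, root_range_apply_iff hr]

open Classical in
/-- Trees with leaves in a given set are trees with corollas attached to some of their legs. -/
theorem graftSum_range_inr {k : Type u} [Field k] {χ : ∀ m : ℕ, Perm (Fin m) → k}
    (hχ : IsClassFun χ) [Fintype V] [Fintype S] [Fintype F] [Fintype G] {e : Perm V} {ε : Perm S}
    {α : Perm F} {β : Perm G} (hα : ∀ x, vt (α x) = e (vt x)) (hβ : ∀ y, vs (β y) = ε (vs y)) :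
    graftSum χ (Set.range Sum.inr) (Perm.sumCongr e ε) (F ⊕ G) (Sum.map vt vs)
        (Perm.sumCongr α β) =
      (∑ inv : Perm F with IsTree vt inv ∧ ∀ x, inv (α x) = α (inv x), vertexWeight χ vt e α •
        ∑ j : S → F with Function.Injective j ∧ (∀ s, inv (j s) = j s) ∧ ∀ s, α (j s) = j (ε s),
          cycProd α fun x => if inv x = x ∧ x ∉ Set.range j then pw k (per α x) else 1) *
        rootSum χ ε G vs β := by
  unfold rootSum
  rw [Finset.sum_mul]
  simp only [smul_mul_assoc, Finset.sum_mul_sum, Finset.smul_sum]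
  -- The default value `1` is never used: gluing is possible for every index that occurs in the sum.
  let glue : (Perm F × (S → F) × (S → G)) → Perm (F ⊕ G) := fun p =>
    if h : ∃ inv', Glued p.1 p.2.1 p.2.2 inv' then h.choose else 1
  have hglue : ∀ (inv : Perm F) (j : S → F) (root : S → G), (∀ x, inv (inv x) = x) →
      Function.Injective j → (∀ s, inv (j s) = j s) → (∀ s, vs (root s) = s) →
      Glued inv j root (glue (inv, j, root)) := by
    intro inv j root h1 h2 h3 h4
    have h := exists_glued h1 h2 h3 h4
    change Glued inv j root (if h : ∃ inv', Glued inv j root inv' then h.choose else 1)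
    rw [dif_pos h]
    exact h.choose_spec
  rw [Finset.sum_sigma', Finset.sum_sigma']
  symm
  refine Finset.sum_nbij (fun p => glue (p.1.1, p.1.2, p.2)) ?_ ?_ ?_ ?_
  · rintro ⟨⟨inv, j⟩, root⟩ hp
    simp only [Finset.mem_sigma, Finset.mem_filter, Finset.mem_univ, true_and] at hp ⊢
    obtain ⟨⟨⟨ht, hc⟩, hj, hleg, hjj⟩, hroot, hr⟩ := hp
    have hg := hglue inv j root ht.inv_inv hj hleg hroot
    exact ⟨(hg.isTree_iff hj ht.inv_inv hleg hroot).2 ht,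
      (hg.commute_iff hleg hroot hβ).2 ⟨hc, hjj, hr⟩, hg.good hroot⟩
  · rintro ⟨⟨inv, j⟩, root⟩ hp ⟨⟨inv₂, j₂⟩, root₂⟩ hp₂ heq
    simp only [Finset.coe_sigma, Finset.coe_filter, Finset.mem_univ, true_and, Set.mem_sigma_iff,
      Set.mem_ofPred_eq] at hp hp₂
    obtain ⟨⟨⟨ht, hc⟩, hj, hleg, hjj⟩, hroot, hr⟩ := hp
    obtain ⟨⟨⟨ht₂, hc₂⟩, hj₂, hleg₂, hjj₂⟩, hroot₂, hr₂⟩ := hp₂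
    have hg := hglue inv j root ht.inv_inv hj hleg hroot
    have hg₂ := hglue inv₂ j₂ root₂ ht₂.inv_inv hj₂ hleg₂ hroot₂
    dsimp only at heq
    rw [← heq] at hg₂
    have e1 : root = root₂ := by
      funext s
      by_contra hne
      have h1 : root s ∉ Set.range root₂ := by
        rintro ⟨t, h⟩
        have := hroot s
        rw [← h, hroot₂] at this
        rw [← h, this] at hne
        exact hne rfl
      have h2 := hg₂.inr_apply _ h1
      rw [hg.root_apply] at h2
      simp at h2
    subst e1
    have e2 : j = j₂ := by
      funext s
      have := hg.root_apply s
      rw [hg₂.root_apply] at this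
      exact (Sum.inl_injective this).symm
    subst e2
    have e3 : inv = inv₂ := by
      ext x
      by_cases hx : x ∈ Set.range j
      · obtain ⟨s, rfl⟩ := hx
        rw [hleg, hleg₂]
      · have := hg.inl_apply x hx
        rw [hg₂.inl_apply x hx] at this
        exact (Sum.inl_injective this).symm
    subst e3
    rfl
  · intro inv' hinv'
    simp only [Finset.coe_filter, Finset.mem_univ, true_and, Set.mem_ofPred_eq] at hinv'
    obtain ⟨ht, hc, hgood⟩ := hinv'
    obtain ⟨inv, j, root, hg, hj, hi, hleg, hroot⟩ := exists_glued_of_good ht.inv_inv hgood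
    obtain ⟨h1, h2, h3⟩ := (hg.commute_iff hleg hroot hβ).1 hc
    refine ⟨⟨⟨inv, j⟩, root⟩, ?_, ?_⟩
    · simp only [Finset.coe_sigma, Finset.coe_filter, Finset.mem_univ, true_and,
        Set.mem_sigma_iff, Set.mem_ofPred_eq]
      exact ⟨⟨⟨(hg.isTree_iff hj hi hleg hroot).1 ht, h1⟩, hj, hleg, h2⟩, hroot, h3⟩
    · have hg₂ := hglue inv j root hi hj hleg hroot
      dsimp only
      ext z
      rcases z with x | y
      · by_cases hx : x ∈ Set.range j
        · obtain ⟨s, rfl⟩ := hx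
          rw [hg.leg_apply, hg₂.leg_apply]
        · rw [hg.inl_apply x hx, hg₂.inl_apply x hx]
      · by_cases hy : y ∈ Set.range root
        · obtain ⟨s, rfl⟩ := hy
          rw [hg.root_apply, hg₂.root_apply]
        · rw [hg.inr_apply y hy, hg₂.inr_apply y hy]
  · rintro ⟨⟨inv, j⟩, root⟩ hp
    simp only [Finset.mem_sigma, Finset.mem_filter, Finset.mem_univ, true_and] at hp
    obtain ⟨⟨⟨ht, hc⟩, hj, hleg, hjj⟩, hroot, hr⟩ := hp
    have hg := hglue inv j root ht.inv_inv hj hleg hroot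
    dsimp only
    rw [hg.legProd_eq hc hjj hr, vertexWeight_sumCongr hχ hα hβ, mul_smul_comm, smul_smul]
    refine congrArg _ (congrArg₂ _ (cycProd_congr fun x => ?_) (cycProd_congr fun x => ?_)) <;>
      split_ifs <;> rfl

end Gluing

/-! ### Leaves of a tree -/

section Leaves

variable {V F : Type} {vt : F → V} {inv : Perm F}

/-- A vertex with exactly one flag that is not a leg. -/
def Leaf (vt : F → V) (inv : Perm F) (v : V) : Prop :=
  ∃ x, vt x = v ∧ inv x ≠ x ∧ ∀ y, vt y = v → y ≠ x → inv y = y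

theorem mem_of_reflTransGen {A : Type} {R : A → A → Prop} {s : Set A}
    (hs : ∀ a b, R a b → a ∈ s → b ∈ s) {a b : A} (h : Relation.ReflTransGen R a b) (ha : a ∈ s) :
    b ∈ s := by
  induction h with
  | refl => exact ha
  | tail _ h ih => exact hs _ _ h ih

theorem IsTree.eq_univ (h : IsTree vt inv) {s : Set V} (hs : s.Nonempty)
    (hc : ∀ x, vt x ∈ s → inv x ≠ x → vt (inv x) ∈ s) : s = Set.univ := by
  obtain ⟨a, ha⟩ := hs
  refine Set.eq_univ_of_forall fun b => mem_of_reflTransGen ?_ (h.connected a b) ha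
  rintro _ _ ⟨x, rfl, rfl⟩ hx
  by_cases hxx : inv x = x
  · rwa [hxx]
  · exact hc x hx hxx

theorem IsTree.nonempty [Finite V] (h : IsTree vt inv) : Nonempty V := by
  have := h.genus_zero
  by_contra hV
  rw [not_nonempty_iff] at hV
  rw [Nat.card_of_isEmpty (α := V)] at this
  omega

/-- Two adjacent leaves would form a connected component by themselves, hence the whole tree. With
at least three vertices this is impossible, so a leaf is always attached to a vertex that is not a
leaf. -/
theorem IsTree.good_iff [Finite V] (h : IsTree vt inv) (hV : 3 ≤ Nat.card V) (S : Set V) :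
    Good vt inv S ↔ ∀ s ∈ S, Leaf vt inv s := by
  constructor
  · intro hg s hs
    obtain ⟨x, hx, hx', hu⟩ := hg s hs
    exact ⟨x, hx, fun h => hx' (by rw [h, hx]; exact hs), hu⟩
  · intro hl s hs
    obtain ⟨x, hx, hx', hu⟩ := hl s hs
    refine ⟨x, hx, fun hmem => ?_, hu⟩
    obtain ⟨y, hy, hy', hu'⟩ := hl _ hmem
    have hyx : y = inv x := by
      by_contra hne
      have := hu' (inv x) rfl (Ne.symm hne)
      rw [h.inv_inv] at this
      exact hx' this.symm
    have hs2 : ({s, vt (inv x)} : Set V) = Set.univ := by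
      refine h.eq_univ ⟨s, by simp⟩ fun z hz hzz => ?_
      rcases hz with hz | hz
      · have : z = x := by
          by_contra hne; exact hzz (hu z hz hne)
        subst this
        simp
      · have : z = y := by
          by_contra hne; exact hzz (hu' z hz hne)
        subst this
        rw [hyx, h.inv_inv, hx]
        simp
    have h2 : Nat.card V ≤ 2 := by
      rw [← Set.ncard_univ, ← hs2]
      exact (Set.ncard_insert_le _ _).trans (by simp)
    omega

/-- Connectedness puts at least one edge flag on each of the `r` vertices. Without leaves there
would be two on each, hence `2 * r` in total, while genus zero allows only `2 * r - 2`. -/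
theorem IsTree.exists_leaf [Finite V] [Finite F] (h : IsTree vt inv) (hV : 2 ≤ Nat.card V) :
    ∃ v, Leaf vt inv v := by
  by_contra! hn
  have h1 : ∀ v, ∃ x, vt x = v ∧ inv x ≠ x := by
    intro v
    by_contra! hv
    have := h.eq_univ (s := {v}) ⟨v, rfl⟩ (fun x hx hxx => absurd (hv x hx) hxx)
    have h2 : Nat.card V ≤ 1 := by
      rw [← Set.ncard_univ, ← this]; simp
    omega
  choose f hf hf' using h1
  have h2 : ∀ v, ∃ y, vt y = v ∧ y ≠ f v ∧ inv y ≠ y := by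
    intro v
    by_contra! hv
    exact hn v ⟨f v, hf v, hf' v, hv⟩
  choose g hg hgf hg' using h2
  have hinj : Function.Injective (Sum.elim (fun v => (⟨f v, hf' v⟩ : {x // inv x ≠ x}))
      fun v => ⟨g v, hg' v⟩) := by
    rintro (v | v) (v' | v') hvv <;>
      simp only [Sum.elim_inl, Sum.elim_inr, Subtype.mk.injEq] at hvv
    · rw [← hf v, hvv, hf]
    · have : v = v' := by rw [← hf v, hvv, hg]
      subst this
      exact absurd hvv.symm (hgf v)
    · have : v = v' := by rw [← hg v, hvv, hf]
      subst this
      exact absurd hvv (hgf v)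
    · rw [← hg v, hvv, hg]
  have := Nat.card_le_card_of_injective _ hinj
  rw [Nat.card_sum] at this
  have := h.genus_zero
  omega

theorem IsTree.inv_eq_one [Finite F] (h : IsTree vt inv) (hV : Nat.card V = 1) : inv = 1 := by
  have := h.genus_zero
  have h0 : Nat.card {x // inv x ≠ x} = 0 := by omega
  rw [Finite.card_eq_zero_iff] at h0
  ext x
  by_contra hx
  exact h0.elim ⟨x, hx⟩

theorem isTree_one [Subsingleton V] [Nonempty V] : IsTree vt (1 : Perm F) where
  inv_inv _ := rfl
  connected i j := by rw [Subsingleton.elim i j]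
  genus_zero := by
    have : IsEmpty {x : F // (1 : Perm F) x ≠ x} := ⟨fun x => x.2 rfl⟩
    rw [Nat.card_of_isEmpty, Nat.card_unique]

end Leaves

/-! ### Trees with two vertices -/

section TwoVertices

variable {F : Type} {vt : F → Fin 2}

theorem swap_root_apply {root : Fin 2 → F} (l : Fin 2) [DecidableEq F] :
    swap (root 0) (root 1) (root l) = root (swap 0 1 l) := by
  fin_cases l <;> simp

theorem swap_root_apply_eq_iff [DecidableEq F] {root : Fin 2 → F} (hroot : ∀ l, vt (root l) = l)
    (x : F) : swap (root 0) (root 1) x = x ↔ x ∉ Set.range root := by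
  have h01 : root 0 ≠ root 1 := fun h => by
    have := congrArg vt h
    simp [hroot] at this
  constructor
  · rintro h ⟨l, rfl⟩
    rw [swap_root_apply] at h
    have := congrArg vt h
    rw [hroot, hroot] at this
    fin_cases l <;> simp at this
  · intro h
    exact swap_apply_of_ne_of_ne (fun h' => h ⟨0, h'.symm⟩) (fun h' => h ⟨1, h'.symm⟩)

theorem isTree_swap [Finite F] [DecidableEq F] {root : Fin 2 → F} (hroot : ∀ l, vt (root l) = l) :
    IsTree vt (swap (root 0) (root 1)) where
  inv_inv x := swap_apply_self _ _ _
  connected i j := by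
    by_cases hij : i = j
    · rw [hij]
    · refine Relation.ReflTransGen.single ⟨root i, hroot i, ?_⟩
      rw [swap_root_apply, hroot]
      revert hij
      revert i j
      decide
  genus_zero := by
    have hb : Function.Bijective fun l : Fin 2 =>
        (⟨root l, fun h => (swap_root_apply_eq_iff hroot _).1 h ⟨l, rfl⟩⟩ :
          {x // swap (root 0) (root 1) x ≠ x}) := by
      constructor
      · intro l l' h
        have := congrArg vt (congrArg Subtype.val h)
        simpa [hroot] using this
      · rintro ⟨x, hx⟩
        rw [ne_eq, swap_root_apply_eq_iff hroot, not_not] at hx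
        obtain ⟨l, rfl⟩ := hx
        exact ⟨l, rfl⟩
    rw [← Nat.card_congr (Equiv.ofBijective _ hb)]
    simp

/-- Connectedness provides an edge between the two vertices, and genus zero leaves no room for
another. -/
theorem IsTree.exists_swap [Finite F] [DecidableEq F] {inv : Perm F} (h : IsTree vt inv) :
    ∃ root : Fin 2 → F, (∀ l, vt (root l) = l) ∧ inv = swap (root 0) (root 1) := by
  have h1 : ∃ x, vt x = 0 ∧ vt (inv x) = 1 := by
    by_contra! hn
    have := h.eq_univ (s := {0}) ⟨0, rfl⟩ (fun x hx _ => by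
      have := hn x hx
      simp only [Set.mem_singleton_iff]
      omega)
    have h2 : (1 : Fin 2) ∈ ({0} : Set (Fin 2)) := by rw [this]; trivial
    simp at h2
  obtain ⟨x, hx, hx'⟩ := h1
  have hroot : ∀ l, vt (![x, inv x] l) = l := by
    intro l; fin_cases l <;> simp [hx, hx']
  refine ⟨![x, inv x], hroot, ?_⟩
  have hxx : inv x ≠ x := fun h => by rw [h, hx] at hx'; simp at hx'
  have hcard := h.genus_zero
  have hfix : ∀ y, y ≠ x → y ≠ inv x → inv y = y := by
    intro y hy hy'
    by_contra hyy
    -- A third moved flag would give three flags on edges, while genus zero with two vertices allows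
    -- exactly two.
    have hinj : Function.Injective (![⟨x, hxx⟩, ⟨inv x, by rw [h.inv_inv]; exact hxx.symm⟩,
        ⟨y, hyy⟩] : Fin 3 → {x // inv x ≠ x}) := by
      intro a b hab
      fin_cases a <;> fin_cases b <;>
        simp [Subtype.ext_iff, hxx, hxx.symm, hy, hy', Ne.symm hy, Ne.symm hy'] at hab ⊢
    have := Nat.card_le_card_of_injective _ hinj
    simp at this hcard
    omega
  ext y
  by_cases hy : y = x
  · subst hy; simp
  · by_cases hy' : y = inv x
    · subst hy'; simp [h.inv_inv]
    · simp [hfix y hy hy', swap_apply_of_ne_of_ne hy hy']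

/-- Both vertices are leaves attached to each other, so the requirement that a leaf in `S` be
attached outside `S` excludes only the full set. This exception produces the quadratic term of the
tree equation. -/
theorem good_swap_iff [DecidableEq F] {root : Fin 2 → F} (hroot : ∀ l, vt (root l) = l)
    (S : Set (Fin 2)) : Good vt (swap (root 0) (root 1)) S ↔ S ≠ Set.univ := by
  constructor
  · rintro h rfl
    obtain ⟨x, _, hx, _⟩ := h 0 trivial
    exact hx trivial
  · intro hS s hs
    refine ⟨root s, hroot s, ?_, fun y hy hne => ?_⟩
    · rw [swap_root_apply, hroot]
      intro h
      refine hS (Set.eq_univ_of_forall fun t => ?_)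
      by_cases hts : t = s
      · rwa [hts]
      · have : ∀ s t : Fin 2, ¬ t = s → t = swap 0 1 s := by decide
        rwa [this s t hts]
    · rw [swap_root_apply_eq_iff hroot]
      rintro ⟨l, rfl⟩
      rw [hroot] at hy
      exact hne (by rw [hy])

theorem commute_swap_iff [DecidableEq F] {root : Fin 2 → F} (hroot : ∀ l, vt (root l) = l)
    {e : Perm (Fin 2)} {α : Perm F} (hα : ∀ x, vt (α x) = e (vt x)) :
    (∀ x, swap (root 0) (root 1) (α x) = α (swap (root 0) (root 1) x)) ↔
      ∀ l, α (root l) = root (e l) := by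
  constructor
  · intro h l
    have hmem : α (root l) ∈ Set.range root := by
      by_contra hn
      rw [← swap_root_apply_eq_iff hroot, leg_apply_iff h, swap_root_apply_eq_iff hroot] at hn
      exact hn ⟨l, rfl⟩
    obtain ⟨t, ht⟩ := hmem
    have := hα (root l)
    rw [← ht, hroot, hroot] at this
    rw [← ht, this]
  · intro h x
    by_cases hx : x ∈ Set.range root
    · obtain ⟨l, rfl⟩ := hx
      have : ∀ (e : Perm (Fin 2)) l, swap 0 1 (e l) = e (swap 0 1 l) := by decide
      rw [h, swap_root_apply, swap_root_apply, h, this]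
    · have hx' : α x ∉ Set.range root := fun h' => hx ((root_range_apply_iff h x).1 h')
      rw [(swap_root_apply_eq_iff hroot _).2 hx, (swap_root_apply_eq_iff hroot _).2 hx']

variable {k : Type u} [Field k] (χ : ∀ m : ℕ, Perm (Fin m) → k)

/-- A tree with two vertices is a pair of rooted corollas joined at their roots. Its automorphisms
preserve this edge, so they are exactly the permutations compatible with the roots. -/
theorem graftSum_empty_eq_rootSum [Fintype F] {e : Perm (Fin 2)} {α : Perm F}
    (hα : ∀ x, vt (α x) = e (vt x)) : graftSum χ ∅ e F vt α = rootSum χ e F vt α := by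
  classical
  unfold graftSum rootSum
  symm
  refine Finset.sum_nbij (fun root => swap (root 0) (root 1)) ?_ ?_ ?_ ?_
  · intro root hr
    simp only [Finset.mem_filter, Finset.mem_univ, true_and] at hr ⊢
    exact ⟨isTree_swap hr.1, (commute_swap_iff hr.1 hα).2 hr.2, fun s hs => hs.elim⟩
  · intro r hr r' hr' h
    simp only [Finset.coe_filter, Finset.mem_univ, true_and, Set.mem_ofPred_eq] at hr hr'
    dsimp only at h
    funext l
    have h1 : r l ∈ Set.range r' := by
      by_contra hn
      rw [← swap_root_apply_eq_iff hr'.1, ← h, swap_root_apply_eq_iff hr.1] at hn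
      exact hn ⟨l, rfl⟩
    obtain ⟨t, ht⟩ := h1
    have := hr.1 l
    rw [← ht, hr'.1] at this
    rw [← ht, this]
  · intro inv hinv
    simp only [Finset.coe_filter, Finset.mem_univ, true_and, Set.mem_ofPred_eq] at hinv
    obtain ⟨root, hroot, rfl⟩ := hinv.1.exists_swap
    refine ⟨root, ?_, rfl⟩
    simp only [Finset.coe_filter, Finset.mem_univ, true_and, Set.mem_ofPred_eq]
    exact ⟨hroot, (commute_swap_iff hroot hα).1 hinv.2.1⟩
  · intro root hr
    simp only [Finset.mem_filter, Finset.mem_univ, true_and] at hr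
    unfold legProd
    congr 1
    refine cycProd_congr fun x => ?_
    simp only [swap_root_apply_eq_iff hr.1]
    split_ifs <;> rfl

end TwoVertices

/-! ### Sign cancellation over sets of leaves -/

section Cancellation

variable {k : Type u} [Field k] (χ : ∀ m : ℕ, Perm (Fin m) → k)

open Classical in
/-- The sign attached to an invariant set of vertices. -/
noncomputable def subsetSign {V : Type} [Fintype V] (k : Type u) [Field k] (e : Perm V)
    (S : Set V) : k :=
  cycProd e fun v => if v ∈ S then -1 else 1

-- The sum is the expansion of a product over cycles with factor `-1 + 1` at the cycles satisfying
-- `P`, and at least one such cycle exists.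
open Classical in
theorem sum_subsetSign {V : Type} [Fintype V] (e : Perm V) (P : V → Prop)
    (hP : ∃ v, P v) (hPe : ∀ v, P (e v) ↔ P v) :
    ∑ S : Finset V with (∀ v, e v ∈ S ↔ v ∈ S) ∧ ∀ v ∈ S, P v, subsetSign k e S = 0 := by
  obtain ⟨v, hv⟩ := hP
  have h : cycProd e (fun v => (if P v then (-1 : k) else 0) + 1) = 0 := by
    refine cycProd_eq_zero e (fun v => ?_) (x := v) (by rw [if_pos hv]; ring)
    simp only [hPe]
  rw [← h, cycProd_add, ← Finset.filter_filter, Finset.sum_filter (fun S : Finset V => ∀ v ∈ S, P v)]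
  refine Finset.sum_congr rfl fun S hS => ?_
  simp only [Finset.mem_filter, Finset.mem_univ, true_and] at hS
  split_ifs with h
  · refine cycProd_congr fun v => ?_
    simp only [Finset.mem_coe]
    by_cases hv : v ∈ S
    · rw [if_pos hv, if_pos hv, if_pos (h v hv)]
    · rw [if_neg hv, if_neg hv]
  · push Not at h
    obtain ⟨v, hv, hPv⟩ := h
    symm
    refine cycProd_eq_zero e (fun v => ?_) (x := v) (by rw [if_pos hv, if_neg hPv])
    simp only [hS, hPe]

theorem graftSum_eq_sum [Fintype V] [Fintype F] (S : Set V) (e : Perm V) (vt : F → V)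
    (α : Perm F) : open Classical in
    graftSum χ S e F vt α = ∑ inv : Perm F with IsTree vt inv ∧ ∀ x, inv (α x) = α (inv x),
      if Good vt inv S then vertexWeight χ vt e α • legProd k inv α else 0 := by
  classical
  unfold graftSum
  rw [← Finset.sum_filter, Finset.filter_filter]
  refine Finset.sum_congr ?_ fun _ _ => rfl
  ext inv
  simp [and_assoc]

theorem leaf_apply_iff {V F : Type} {vt : F → V} {inv : Perm F} {e : Perm V} {α : Perm F}
    (hα : ∀ x, vt (α x) = e (vt x)) (hc : ∀ x, inv (α x) = α (inv x)) (v : V) :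
    Leaf vt inv (e v) ↔ Leaf vt inv v := by
  constructor
  · rintro ⟨x, hx, hxx, hu⟩
    obtain ⟨x, rfl⟩ := α.surjective x
    rw [hα, e.injective.eq_iff] at hx
    refine ⟨x, hx, fun h => hxx ((leg_apply_iff hc x).2 h), fun y hy hne => ?_⟩
    exact (leg_apply_iff hc y).1 (hu (α y) (by rw [hα, hy]) fun h => hne (α.injective h))
  · rintro ⟨x, hx, hxx, hu⟩
    refine ⟨α x, by rw [hα, hx], fun h => hxx ((leg_apply_iff hc x).1 h), fun y hy hne => ?_⟩
    obtain ⟨y, rfl⟩ := α.surjective y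
    rw [hα, e.injective.eq_iff] at hy
    exact (leg_apply_iff hc y).2 (hu y hy fun h => hne (congrArg α h))

-- For each fixed tree the admissible sets are the invariant sets of leaves, and leaves exist, so
-- the signs cancel tree by tree.
open Classical in
theorem sum_subsetSign_graftSum {V F : Type} [Fintype V] [Fintype F] (hV : 3 ≤ Nat.card V)
    {vt : F → V} {e : Perm V} {α : Perm F} (hα : ∀ x, vt (α x) = e (vt x)) :
    ∑ S : Finset V with ∀ v, e v ∈ S ↔ v ∈ S, subsetSign k e S • graftSum χ S e F vt α = 0 := by
  simp only [graftSum_eq_sum, Finset.smul_sum]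
  rw [Finset.sum_comm]
  refine Finset.sum_eq_zero fun inv hinv => ?_
  simp only [Finset.mem_filter, Finset.mem_univ, true_and] at hinv
  have h := sum_subsetSign (k := k) e (Leaf vt inv) (hinv.1.exists_leaf (by omega))
    (leaf_apply_iff hα hinv.2)
  refine Eq.trans ?_ (zero_smul k (vertexWeight χ vt e α • legProd k inv α))
  rw [← h, Finset.sum_smul,
    ← Finset.filter_filter, Finset.sum_filter (fun S : Finset V => ∀ v ∈ S, Leaf vt inv v)]
  refine Finset.sum_congr rfl fun S _ => ?_
  simp only [hinv.1.good_iff hV, Finset.mem_coe]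
  split_ifs <;> simp

-- The signs of all invariant subsets add up to zero. Only the full set is not admissible, so the
-- admissible ones add up to minus its sign.
open Classical in
theorem sum_subsetSign_graftSum_two {F : Type} [Fintype F]
    {vt : F → Fin 2} {e : Perm (Fin 2)} {α : Perm F} (hα : ∀ x, vt (α x) = e (vt x)) :
    ∑ S : Finset (Fin 2) with ∀ v, e v ∈ S ↔ v ∈ S, subsetSign k e S • graftSum χ S e F vt α =
      - subsetSign k e Set.univ • rootSum χ e F vt α := by
  rw [← graftSum_empty_eq_rootSum χ hα]
  simp only [graftSum_eq_sum, Finset.smul_sum]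
  rw [Finset.sum_comm]
  refine Finset.sum_congr rfl fun inv hinv => ?_
  simp only [Finset.mem_filter, Finset.mem_univ, true_and] at hinv
  obtain ⟨root, hroot, rfl⟩ := hinv.1.exists_swap
  have h := sum_subsetSign (k := k) e (fun _ => True) ⟨0, trivial⟩ (fun _ => Iff.rfl)
  simp only [implies_true, and_true] at h
  have hu : (Finset.univ : Finset (Fin 2)) ∈
      Finset.univ.filter fun S : Finset (Fin 2) => ∀ v, e v ∈ S ↔ v ∈ S := by simp
  rw [← Finset.add_sum_erase _ _ hu, Finset.coe_univ] at h ⊢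
  have hg : Good vt (swap (root 0) (root 1)) ∅ := fun s hs => hs.elim
  rw [eq_neg_of_add_eq_zero_left h, neg_neg, if_pos hg, Finset.sum_smul,
    if_neg (fun hg => (good_swap_iff hroot _).1 hg rfl), smul_zero, zero_add]
  refine Finset.sum_congr rfl fun S hS => ?_
  rw [if_pos]
  refine (good_swap_iff hroot _).2 fun h => ?_
  exact Finset.ne_of_mem_erase hS (Finset.coe_injective (by rw [h, Finset.coe_univ]))

end Cancellation

/-! ### Orders of tree sums and linearity of the flag sums -/

section Orders

variable {k : Type u} [Field k]

theorem pw_mem_ordIdeal {n : ℕ} (hn : 0 < n) : pw k n ∈ SymFun.ordIdeal k n := by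
  have := SymFun.p_mem_ordIdeal (k := k) n.toPNat'
  rwa [Nat.toPNat'_coe, if_pos hn] at this

theorem prod_mem_ordIdeal {ι : Type*} (s : Finset ι) {f : ι → SymFun k} {c : ι → ℕ}
    (h : ∀ i ∈ s, f i ∈ SymFun.ordIdeal k (c i)) :
    ∏ i ∈ s, f i ∈ SymFun.ordIdeal k (∑ i ∈ s, c i) := by
  classical
  induction s using Finset.induction_on with
  | empty =>
    rw [SymFun.mem_ordIdeal]
    intro d hd
    simp at hd
  | insert a s ha ih =>
    rw [Finset.prod_insert ha, Finset.sum_insert ha]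
    exact SymFun.mul_mem_ordIdeal (h a (Finset.mem_insert_self _ _))
      (ih fun i hi => h i (Finset.mem_insert_of_mem hi))

open Classical in
theorem cycProd_pw_mem_ordIdeal {X : Type} [Fintype X] (α : Perm X) {P : X → Prop}
    (hP : ∀ x, P (α x) ↔ P x) :
    cycProd α (fun x => if P x then pw k (per α x) else 1) ∈
      SymFun.ordIdeal k (Nat.card {x // P x}) := by
  -- Counting cycle by cycle: `P` is constant on a cycle, and a cycle has at most `per` points
  -- because the first `per` iterates exhaust it.
  have h1 : Nat.card {x // P x} ≤ ∑ q : Quotient (Perm.SameCycle.setoid α),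
      if P q.out then per α q.out else 0 := by
    rw [Nat.card_eq_fintype_card, Fintype.card_subtype,
      Finset.card_eq_sum_card_fiberwise (t := Finset.univ)
        (f := fun x => (Quotient.mk'' x : _root_.Quotient (Perm.SameCycle.setoid α)))
        (fun _ _ => Finset.mem_coe.2 (Finset.mem_univ _))]
    refine Finset.sum_le_sum fun q _ => ?_
    have hq : ∀ x, (Quotient.mk'' x : _root_.Quotient (Perm.SameCycle.setoid α)) = q →
        α.SameCycle q.out x := by
      rintro x rfl
      have h : (Perm.SameCycle.setoid α)
          (Quotient.mk'' x : _root_.Quotient (Perm.SameCycle.setoid α)).out x :=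
        Quotient.eq''.1 (Quotient.out_eq' _)
      exact h
    split_ifs with hPq
    · refine (Finset.card_le_card (t := (Finset.range (per α q.out)).image
        fun i => α^[i] q.out) ?_).trans (Finset.card_image_le.trans (by simp))
      intro x hx
      simp only [Finset.mem_filter, Finset.mem_univ, true_and] at hx
      obtain ⟨i, hi⟩ := sameCycle_iff_exists_iterate.1 (hq x hx.2)
      rw [Finset.mem_image]
      refine ⟨i % per α q.out, Finset.mem_range.2 (Nat.mod_lt _ (per_pos _ _)), ?_⟩
      rw [← hi]
      exact iterate_mod_minimalPeriod_eq
    · rw [Nat.le_zero, Finset.card_eq_zero, Finset.filter_eq_empty_iff]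
      intro x hx hxq
      refine hPq ?_
      rw [eq_of_sameCycle (g := P) (fun x => propext (hP x)) (hq x hxq)]
      simpa using hx
  refine SymFun.ordIdeal_mono h1 ?_
  unfold cycProd
  refine prod_mem_ordIdeal _ fun q _ => ?_
  dsimp only
  split_ifs
  · exact pw_mem_ordIdeal (k := k) (per_pos α q.out)
  · rw [SymFun.mem_ordIdeal]
    intro d hd
    simp at hd

theorem legProd_mem_ordIdeal {F : Type} [Fintype F] {inv α : Perm F}
    (h : ∀ x, inv (α x) = α (inv x)) :
    legProd k inv α ∈ SymFun.ordIdeal k (Nat.card {x // inv x = x}) := by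
  classical
  exact cycProd_pw_mem_ordIdeal α (leg_apply_iff h)

theorem smul_mem_ordIdeal {N : ℕ} (c : k) {f : SymFun k} (hf : f ∈ SymFun.ordIdeal k N) :
    c • f ∈ SymFun.ordIdeal k N :=
  Submodule.smul_of_tower_mem _ c hf

/-- With `r` vertices, `2 * r - 2` of the at least `3 * r` flags lie on edges. -/
theorem IsTree.card_legs {V F : Type} [Fintype V] [Fintype F] {vt : F → V} {inv : Perm F}
    (h : IsTree vt inv) (hF : 3 * Fintype.card V ≤ Fintype.card F) :
    Fintype.card V + 2 ≤ Nat.card {x // inv x = x} := by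
  classical
  have h1 := h.genus_zero
  have h2 : Nat.card {x // inv x = x} + Nat.card {x // inv x ≠ x} = Fintype.card F := by
    rw [← Nat.card_sum, Nat.card_congr (Equiv.sumCompl _), Nat.card_eq_fintype_card]
  rw [Nat.card_eq_fintype_card (α := V)] at h1
  omega

/-- Every leg adds at least one to the weight through `legProd`, so trees with many vertices only
affect high weights. This justifies all truncations in the number of vertices. -/
theorem graftSum_mem_ordIdeal (χ : ∀ m : ℕ, Perm (Fin m) → k) {V F : Type} [Fintype V]
    [Fintype F] (S : Set V) (e : Perm V) (vt : F → V) (α : Perm F)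
    (hF : 3 * Fintype.card V ≤ Fintype.card F) :
    graftSum χ S e F vt α ∈ SymFun.ordIdeal k (Fintype.card V + 2) := by
  classical
  refine Ideal.sum_mem _ fun inv hinv => smul_mem_ordIdeal _ ?_
  simp only [Finset.mem_filter, Finset.mem_univ, true_and] at hinv
  exact SymFun.ordIdeal_mono (hinv.1.card_legs hF) (legProd_mem_ordIdeal hinv.2.1)

variable (D : ℕ)

theorem card_flags_bounds {V : Type} [Fintype V] (val : V → Finset.Icc 3 D) :
    3 * Fintype.card V ≤ Fintype.card (Flags fun j => (val j : ℕ)) ∧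
      Fintype.card (Flags fun j => (val j : ℕ)) ≤ D * Fintype.card V := by
  rw [Fintype.card_sigma]
  simp only [Fintype.card_fin]
  have h : ∀ j, 3 ≤ (val j : ℕ) ∧ (val j : ℕ) ≤ D := fun j => Finset.mem_Icc.1 (val j).2
  have h1 := Finset.card_nsmul_le_sum Finset.univ (fun j => (val j : ℕ)) 3 fun j _ => (h j).1
  have h2 := Finset.sum_le_card_nsmul Finset.univ (fun j => (val j : ℕ)) D fun j _ => (h j).2
  rw [Finset.card_univ, smul_eq_mul] at h1 h2
  exact ⟨by linarith, by linarith⟩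

theorem sumOver_congr_of_card {A : Type*} [AddCommMonoid A] [Module k A] {V : Type} [Fintype V]
    {e : Perm V} {Φ Ψ : ∀ (F : Type) [Fintype F], (F → V) → Perm F → A}
    (h : ∀ (F : Type) [Fintype F] (vt : F → V) (α : Perm F), (∀ x, vt (α x) = e (vt x)) →
      Fintype.card F ≤ D * Fintype.card V → Φ F vt α = Ψ F vt α) :
    sumOver k D e Φ = sumOver k D e Ψ := by
  classical
  unfold sumOver
  refine Finset.sum_congr rfl fun val _ => ?_
  congr 1
  exact Finset.sum_congr rfl fun α _ => h _ _ _ α.cover (card_flags_bounds D val).2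

theorem sumOver_mem_ordIdeal {N : ℕ} {V : Type} [Fintype V] {e : Perm V}
    {Φ : ∀ (F : Type) [Fintype F], (F → V) → Perm F → SymFun k}
    (h : ∀ (F : Type) [Fintype F] (vt : F → V) (α : Perm F),
      3 * Fintype.card V ≤ Fintype.card F → Φ F vt α ∈ SymFun.ordIdeal k N) :
    sumOver k D e Φ ∈ SymFun.ordIdeal k N := by
  classical
  unfold sumOver
  exact Ideal.sum_mem _ fun val _ => smul_mem_ordIdeal _
    (Ideal.sum_mem _ fun α _ => h _ _ _ (card_flags_bounds D val).1)

theorem sumOver_smul {A : Type*} [AddCommMonoid A] [Module k A] {V : Type} [Fintype V]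
    {e : Perm V} (c : k) {Φ : ∀ (F : Type) [Fintype F], (F → V) → Perm F → A} :
    sumOver k D e (fun F _ vt α => c • Φ F vt α) = c • sumOver k D e Φ := by
  classical
  unfold sumOver
  simp only [Finset.smul_sum]
  exact Finset.sum_congr rfl fun val _ => Finset.sum_congr rfl fun α _ => smul_comm _ _ _

theorem sumOver_sum {A : Type*} [AddCommMonoid A] [Module k A] {V : Type} [Fintype V]
    {e : Perm V} {ι : Type*} (s : Finset ι)
    {Φ : ι → ∀ (F : Type) [Fintype F], (F → V) → Perm F → A} :
    sumOver k D e (fun F _ vt α => ∑ i ∈ s, Φ i F vt α) = ∑ i ∈ s, sumOver k D e (Φ i) := by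
  classical
  unfold sumOver
  rw [Finset.sum_comm]
  refine Finset.sum_congr rfl fun val _ => ?_
  rw [← Finset.smul_sum, Finset.sum_comm]

theorem map_sumOver {A B : Type*} [AddCommMonoid A] [Module k A] [AddCommMonoid B] [Module k B]
    {V : Type} [Fintype V] {e : Perm V} (f : A →ₗ[k] B)
    {Φ : ∀ (F : Type) [Fintype F], (F → V) → Perm F → A} :
    f (sumOver k D e Φ) = sumOver k D e fun F _ vt α => f (Φ F vt α) := by
  classical
  unfold sumOver
  simp only [map_sum, map_smul]

open Classical in
theorem cycProd_one {X : Type} {M : Type*} [Fintype X] [CommMonoid M] (g : X → M) :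
    cycProd (1 : Perm X) g = ∏ x, g x := by
  unfold cycProd
  refine Fintype.prod_bijective (fun q : _root_.Quotient (Perm.SameCycle.setoid (1 : Perm X)) => q.out)
    ⟨Quotient.out_injective, fun x => ⟨Quotient.mk'' x, ?_⟩⟩ _ _ fun _ => rfl
  have h : (Perm.SameCycle.setoid (1 : Perm X))
      (Quotient.mk'' x : _root_.Quotient (Perm.SameCycle.setoid (1 : Perm X))).out x :=
    Quotient.eq''.1 (Quotient.out_eq' _)
  exact Perm.sameCycle_one.1 h

theorem SymFun.adams_one (f : SymFun k) : SymFun.adams 1 f = f := by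
  have : (fun m : ℕ+ => (SymFun.p (1 * m) : SymFun k)) = MvPowerSeries.X := by
    funext m; rw [one_mul]; rfl
  rw [SymFun.adams, this, MvPowerSeries.subst_self]
  rfl

end Orders

/-! ### Plethysm of the tree sum -/

section Main

variable {k : Type u} [Field k] (χ : ∀ m : ℕ, Perm (Fin m) → k) (D : ℕ)

/-- The generating function of trees with at most `R` vertices, of valences at most `D`, with an
automorphism. -/
noncomputable def treeCh (R : ℕ) : SymFun k :=
  ∑ r ∈ Finset.range (R + 1), (r.factorial : k)⁻¹ • ∑ e : Perm (Fin r),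
    sumOver k D e fun F _ vt α => graftSum χ ∅ e F vt α

/-- The contribution of all trees with a given permutation of the vertices and a given set of
vertices that are leaves. -/
noncomputable def signedGraft (V : Type) [Fintype V] (e : Perm V) (S : Set V) : SymFun k :=
  subsetSign k e S • sumOver k D e fun F _ vt α => graftSum χ S e F vt α

variable {χ} (hχ : IsClassFun χ)
include hχ

theorem signedGraft_equiv (V V' : Type) [Fintype V] [Fintype V'] (θ : V ≃ V') (e : Perm V)
    (S : Set V) (hS : ∀ v, e v ∈ S ↔ v ∈ S) :
    signedGraft χ D V' (θ.permCongr e) (θ '' S) = signedGraft χ D V e S := by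
  classical
  unfold signedGraft subsetSign
  rw [cycProd_permCongr]
  · congr 1
    · refine cycProd_congr fun v => ?_
      simp only [θ.injective.mem_set_image]
    · refine sumOver_permCongr k D θ e (graftSum_flagInvariant hχ _ _) fun F _ vt α h => ?_
      exact graftSum_equiv hχ θ (Equiv.refl F) h fun _ => rfl
  · intro v
    obtain ⟨v, rfl⟩ := θ.surjective v
    simp only [permCongr_apply, symm_apply_apply, θ.injective.mem_set_image, hS]

omit hχ in
theorem subsetSign_univ {V : Type} [Fintype V] (e : Perm V) :
    subsetSign k e Set.univ = cycProd e fun _ => -1 :=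
  cycProd_congr fun v => by rw [if_pos (Set.mem_univ v)]

-- A cycle of `n` legs contributes `p_n`, which plethysm replaces by `p_n` minus `adams n` of the
-- derivative. `cycProd_sub_eq_sum` expands over the sets of legs where the second term is chosen,
-- `cycProd_adams_dp₁` reads that term as a sum over rooted corollas, and `graftSum_range_inr`
-- attaches these to the legs.
open Classical in
theorem plethysm_graftSum [CharZero k] {g : SymFun k} (hg : MvPowerSeries.constantCoeff g = 0)
    (hgv : g = SymFun.p 1 - SymFun.dp₁ (truncCh χ D)) {V F : Type} [Fintype V] [Fintype F]
    {e : Perm V} {vt : F → V} {α : Perm F} (hα : ∀ x, vt (α x) = e (vt x)) {N : ℕ}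
    (hN : Fintype.card F ≤ N) :
    SymFun.plethysmHom hg (graftSum χ ∅ e F vt α) =
      ∑ s ∈ Finset.range (N + 1), (s.factorial : k)⁻¹ • ∑ ε : Perm (Fin s),
        subsetSign k ε Set.univ • sumOver k D ε fun G _ vs β =>
          graftSum χ (Set.range Sum.inr) (Perm.sumCongr e ε) (F ⊕ G) (Sum.map vt vs)
            (Perm.sumCongr α β) := by
  let b : ℕ → SymFun k := fun n => SymFun.adams n.toPNat' (SymFun.dp₁ (truncCh χ D))
  have aux : ∀ (a c : k) (J B : SymFun k), a • (c • J * B) = c • (a • B * J) := by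
    intro a c J B
    simp only [Algebra.smul_def]
    ring
  have hR : ∀ (s : ℕ) (ε : Perm (Fin s)), subsetSign k ε Set.univ • (sumOver k D ε fun G _ vs β =>
          graftSum χ (Set.range Sum.inr) (Perm.sumCongr e ε) (F ⊕ G) (Sum.map vt vs)
            (Perm.sumCongr α β)) =
      ∑ inv : Perm F with IsTree vt inv ∧ ∀ x, inv (α x) = α (inv x), vertexWeight χ vt e α •
        (cycProd ε (fun i => - b (per ε i)) * ∑ j : Fin s → F with Function.Injective j ∧
          (∀ s, inv (j s) = j s) ∧ ∀ s, α (j s) = j (ε s),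
          cycProd α fun x => if inv x = x ∧ x ∉ Set.range j then pw k (per α x) else 1) := by
    intro s ε
    rw [sumOver_congr k D fun G _ vs β hβ => graftSum_range_inr hχ hα hβ, sumOver_const_mul,
      ← cycProd_adams_dp₁ D hχ]
    -- One minus sign per cycle of attached corollas is the sign of the set of all new vertices.
    have hs : cycProd ε (fun i => - b (per ε i)) =
        subsetSign k ε Set.univ • cycProd ε (fun i => b (per ε i)) := by
      have h1 : cycProd ε (fun i => - b (per ε i)) =
          cycProd ε (fun i => algebraMap k (SymFun k) (-1) * b (per ε i)) :=
        cycProd_congr fun i => by rw [map_neg, map_one, neg_one_mul]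
      rw [h1, cycProd_mul, ← map_cycProd, Algebra.smul_def, subsetSign_univ]
    rw [hs, Finset.sum_mul, Finset.smul_sum]
    refine Finset.sum_congr rfl fun inv _ => ?_
    rw [aux]
    refine congrArg _ (congrArg _ ?_)
    refine Finset.sum_congr (by ext; simp) fun j _ => cycProd_congr fun x => ?_
    split_ifs <;> rfl
  have hL : SymFun.plethysmHom hg (graftSum χ ∅ e F vt α) =
      ∑ inv : Perm F with IsTree vt inv ∧ ∀ x, inv (α x) = α (inv x), vertexWeight χ vt e α •
        cycProd α (fun x => if inv x = x then pw k (per α x) - b (per α x) else 1) := by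
    rw [graftSum_eq_sum, map_sum]
    refine Finset.sum_congr rfl fun inv _ => ?_
    have hgood : Good vt inv ∅ := fun s hs => hs.elim
    rw [if_pos hgood, map_smul, legProd, map_cycProd]
    congr 1
    refine cycProd_congr fun x => ?_
    split_ifs with hx
    · rw [SymFun.plethysmHom_apply, pw, SymFun.plethysm_p hg, hgv, ← SymFun.adamsHom_apply, map_sub, SymFun.adamsHom_apply,
        SymFun.adamsHom_apply, SymFun.adams_p, mul_one]
    · exact map_one _
  rw [hL]
  simp only [hR]
  have hE : ∀ inv ∈ Finset.univ.filter (fun inv : Perm F =>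
      IsTree vt inv ∧ ∀ x, inv (α x) = α (inv x)), _ := fun inv hinv =>
    cycProd_sub_eq_sum (k := k) α (fun x => inv x = x)
      (leg_apply_iff (Finset.mem_filter.1 hinv).2.2) (pw k) b hN
  rw [Finset.sum_congr rfl fun inv hinv => by rw [hE inv hinv]]
  simp only [Finset.smul_sum]
  rw [Finset.sum_comm]
  refine Finset.sum_congr rfl fun s _ => ?_
  rw [Finset.sum_comm]
  refine Finset.sum_congr rfl fun ε _ => ?_
  refine Finset.sum_congr rfl fun inv _ => ?_
  rw [smul_comm]

/-- After summing `plethysm_graftSum` over the flags at `V`, the double sum over old and new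
vertices is one flag sum over `V ⊕ Fin s` by `sumOver_sumCongr`. The bound `N` only has to dominate
the number of flags, which limits the number of corollas that can be attached. -/
theorem plethysm_sumOver_graftSum [CharZero k] {g : SymFun k}
    (hg : MvPowerSeries.constantCoeff g = 0) (hgv : g = SymFun.p 1 - SymFun.dp₁ (truncCh χ D))
    {V : Type} [Fintype V] (e : Perm V) {N : ℕ} (hN : D * Fintype.card V ≤ N) :
    SymFun.plethysmHom hg (sumOver k D e fun F _ vt α => graftSum χ ∅ e F vt α) =
      ∑ s ∈ Finset.range (N + 1), (s.factorial : k)⁻¹ • ∑ ε : Perm (Fin s),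
        signedGraft χ D (V ⊕ Fin s) (Perm.sumCongr e ε) (Set.range Sum.inr) := by
  classical
  have h := map_sumOver D (e := e) (SymFun.plethysmHom hg).toLinearMap
    (Φ := fun F _ vt α => graftSum χ ∅ e F vt α)
  simp only [AlgHom.toLinearMap_apply] at h
  rw [h, sumOver_congr_of_card D fun F _ vt α hα hF =>
    plethysm_graftSum D hχ hg hgv hα (hF.trans hN), sumOver_sum]
  refine Finset.sum_congr rfl fun s _ => ?_
  rw [sumOver_smul, sumOver_sum]
  congr 1
  refine Finset.sum_congr rfl fun ε _ => ?_
  rw [sumOver_smul, signedGraft, sumOver_sumCongr k D e ε (graftSum_flagInvariant hχ _ _)]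
  congr 1
  unfold subsetSign
  rw [cycProd_sumCongr]
  · simp [cycProd_eq_one (α := e) (g := fun _ => (1 : k)) fun _ => rfl]
  · rintro (v | v) <;> simp

open Classical in
omit hχ in
theorem sum_signedGraft {V : Type} [Fintype V] (e : Perm V) (T : Finset (Finset V)) :
    ∑ S ∈ T, signedGraft χ D V e S =
      sumOver k D e fun F _ vt α => ∑ S ∈ T, subsetSign k e S • graftSum χ S e F vt α := by
  rw [sumOver_sum]
  exact Finset.sum_congr rfl fun S _ => (sumOver_smul D _).symm

omit hχ in
theorem sumOver_zero {V : Type} [Fintype V] (e : Perm V) :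
    sumOver k D e (fun _ _ _ _ => (0 : SymFun k)) = 0 := by
  classical
  unfold sumOver
  simp

omit hχ in
theorem graftSum_of_isEmpty {V F : Type} [Fintype V] [IsEmpty V] [Fintype F] (S : Set V)
    (e : Perm V) (vt : F → V) (α : Perm F) : graftSum χ S e F vt α = 0 := by
  classical
  unfold graftSum
  refine Finset.sum_eq_zero fun inv hinv => ?_
  simp only [Finset.mem_filter, Finset.mem_univ, true_and] at hinv
  obtain ⟨v⟩ := hinv.1.nonempty
  exact isEmptyElim v

omit hχ in
theorem graftSum_of_subsingleton {V F : Type} [Fintype V] [Subsingleton V] [Nonempty V]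
    [Fintype F] (e : Perm V) (vt : F → V) (α : Perm F) :
    graftSum χ ∅ e F vt α = vertexWeight χ vt e α • cycProd α fun x => pw k (per α x) := by
  classical
  unfold graftSum
  rw [Finset.sum_eq_single 1]
  · congr 1
    exact cycProd_congr fun x => if_pos rfl
  · intro inv hinv hne
    simp only [Finset.mem_filter, Finset.mem_univ, true_and] at hinv
    exact absurd (hinv.1.inv_eq_one Nat.card_unique) hne
  · intro h
    refine absurd (Finset.mem_filter.2 ⟨Finset.mem_univ _, isTree_one, ?_, ?_⟩) h
    · intro x; rfl
    · intro s hs; exact hs.elim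

/-- The only tree with one vertex is a corolla, all of whose flags are legs. -/
theorem sumOver_graftSum_one [CharZero k] :
    sumOver k D (finRotate 1) (fun F _ vt α => graftSum χ ∅ (finRotate 1) F vt α) =
      truncCh χ D := by
  rw [sumOver_finRotate k D 0 (graftSum_flagInvariant hχ _ _), truncCh]
  refine Finset.sum_congr rfl fun m _ => ?_
  congr 1
  refine Finset.sum_congr rfl fun ρ _ => ?_
  have h := graftSum_of_subsingleton (χ := χ) (finRotate 1)
    (Prod.fst : Fin 1 × Fin m → Fin 1) (cycleModel 0 ρ)
  refine h.trans ?_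
  rw [vertexWeight_cycleModel hχ]
  congr 1
  refine (cycProd_cycleModel (a := 0) ρ fun z => by rw [per_apply]).trans ?_
  exact cycProd_congr fun x => by rw [per_cycleModel, zero_add, one_mul]

open Classical in
omit hχ in
theorem total_of_three_le {q : ℕ} (hq : 3 ≤ q) (e : Perm (Fin q)) :
    ∑ S : Finset (Fin q) with ∀ x, e x ∈ S ↔ x ∈ S, signedGraft χ D (Fin q) e S = 0 := by
  rw [sum_signedGraft, ← sumOver_zero D e]
  exact sumOver_congr k D fun F _ vt α hα => (Finset.sum_congr (by ext; simp) fun _ _ => rfl).trans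
    (sum_subsetSign_graftSum χ (by simpa using hq) hα)

-- A single vertex cannot be attached to a vertex outside a set containing it, so only the empty set
-- contributes.
open Classical in
theorem total_one [CharZero k] :
    ∑ e : Perm (Fin 1), ∑ S : Finset (Fin 1) with ∀ x, e x ∈ S ↔ x ∈ S,
      signedGraft χ D (Fin 1) e S = truncCh χ D := by
  rw [Fintype.sum_eq_single (finRotate 1) (fun e he => absurd (Subsingleton.elim _ _) he),
    Finset.sum_eq_single ∅]
  · rw [← sumOver_graftSum_one D hχ, signedGraft, Finset.coe_empty]
    rw [show subsetSign k (finRotate 1) ∅ = 1 from cycProd_eq_one fun v => by simp, one_smul]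
  · intro S _ hS
    rw [signedGraft]
    rw [sumOver_congr k D (Ψ := fun _ _ _ _ => 0), sumOver_zero, smul_zero]
    intro F _ vt α _
    refine Finset.sum_eq_zero fun inv hinv => ?_
    simp only [Finset.mem_filter, Finset.mem_univ, true_and] at hinv
    exfalso
    obtain ⟨s, hs⟩ := Finset.nonempty_iff_ne_empty.2 hS
    obtain ⟨x, hx, hx', _⟩ := hinv.2.2 s hs
    exact hx' (by rwa [Subsingleton.elim (vt (inv x)) s])
  · intro h
    exact absurd (by simp) h

-- The identity has two cycles of vertices, hence sign `1`, and gives minus the square of the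
-- derivative. The transposition has one cycle, hence sign `-1`, and gives the Adams operation with
-- sign plus.
open Classical in
theorem total_two [CharZero k] :
    ∑ e : Perm (Fin 2), ∑ S : Finset (Fin 2) with ∀ x, e x ∈ S ↔ x ∈ S,
      signedGraft χ D (Fin 2) e S =
    SymFun.adams 2 (SymFun.dp₁ (truncCh χ D)) - SymFun.dp₁ (truncCh χ D) ^ 2 := by
  have h : ∀ e : Perm (Fin 2), ∑ S : Finset (Fin 2) with ∀ x, e x ∈ S ↔ x ∈ S,
      signedGraft χ D (Fin 2) e S = - subsetSign k e Set.univ •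
        cycProd e (fun j => SymFun.adams (per e j).toPNat' (SymFun.dp₁ (truncCh χ D))) := by
    intro e
    rw [sum_signedGraft, cycProd_adams_dp₁ D hχ, ← sumOver_smul]
    exact sumOver_congr k D fun F _ vt α hα => sum_subsetSign_graftSum_two χ hα
  have hu : (Finset.univ : Finset (Perm (Fin 2))) = {1, finRotate 2} := by decide
  rw [hu, Finset.sum_pair (by decide), h, h, subsetSign_univ, subsetSign_univ, cycProd_finRotate _ (fun _ => rfl),
    cycProd_finRotate _ (fun _ => by rw [per_apply]), per_finRotate]
  rw [cycProd_one, cycProd_one, Fin.prod_univ_two, Fin.prod_univ_two]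
  have h1 : ∀ x : Fin 2, per (1 : Perm (Fin 2)) x = 1 := fun x =>
    minimalPeriod_eq_one_iff_isFixedPt.2 rfl
  have h2 : SymFun.adams (k := k) (1 : ℕ).toPNat' (SymFun.dp₁ (truncCh χ D)) =
      SymFun.dp₁ (truncCh χ D) := SymFun.adams_one _
  rw [h1, h1, h2, neg_neg, mul_neg, mul_one, neg_neg, neg_smul, one_smul, one_smul, ← sq]
  exact neg_add_eq_sub _ _

end Main

/-! ### The truncated tree equation -/

section TreeEquation

variable {k : Type u} [Field k] {χ : ∀ m : ℕ, Perm (Fin m) → k} (D : ℕ)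

theorem signedGraft_mem_ordIdeal {V : Type} [Fintype V] (e : Perm V) (S : Set V) :
    signedGraft χ D V e S ∈ SymFun.ordIdeal k (Fintype.card V + 2) :=
  smul_mem_ordIdeal _ (sumOver_mem_ordIdeal D fun _ _ _ _ hF => graftSum_mem_ordIdeal χ S e _ _ hF)

/-- The terms of the rectangle outside the triangle have `r + s ≥ R + 1`, hence order at least `R +
3`. -/
theorem sum_rectangle_sub_sum_antidiagonal {Z : ℕ → ℕ → SymFun k} {R N : ℕ} (hN : R ≤ N)
    (hZ : ∀ r s, Z r s ∈ SymFun.ordIdeal k (r + s + 2)) :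
    ∑ r ∈ Finset.range (R + 1), ∑ s ∈ Finset.range (N + 1), Z r s -
      ∑ q ∈ Finset.range (R + 1), ∑ p ∈ Finset.HasAntidiagonal.antidiagonal q, Z p.1 p.2 ∈
        SymFun.ordIdeal k (R + 3) := by
  have h : ∑ q ∈ Finset.range (R + 1), ∑ p ∈ Finset.HasAntidiagonal.antidiagonal q, Z p.1 p.2 =
      ∑ r ∈ Finset.range (R + 1), ∑ s ∈ Finset.range (R + 1 - r), Z r s := by
    rw [← Finset.sum_range_diag_flip]
    refine Finset.sum_congr rfl fun q _ => ?_
    rw [Finset.Nat.sum_antidiagonal_eq_sum_range_succ_mk]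
  rw [h, ← Finset.sum_sub_distrib]
  refine Ideal.sum_mem _ fun r hr => ?_
  have hsub : Finset.range (R + 1 - r) ⊆ Finset.range (N + 1) :=
    Finset.range_subset_range.2 (by omega)
  rw [← Finset.sum_sdiff hsub, add_sub_cancel_right]
  refine Ideal.sum_mem _ fun s hs => SymFun.ordIdeal_mono ?_ (hZ r s)
  simp only [Finset.mem_sdiff, Finset.mem_range] at hs hr
  omega

theorem one_sub_dp₁_truncCh : (SymFun.p 1 - SymFun.dp₁ (truncCh χ D)) - SymFun.p 1 ∈
    SymFun.ordIdeal k 2 := by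
  rw [sub_sub_cancel_left]
  refine (Ideal.neg_mem_iff _).2 (SymFun.dp₁_mem_ordIdeal ?_)
  refine Ideal.sum_mem _ fun m hm => smul_mem_ordIdeal _ (Ideal.sum_mem _ fun ρ _ =>
    smul_mem_ordIdeal _ (SymFun.ordIdeal_mono (Finset.mem_Icc.1 hm).1 ?_))
  have := cycProd_pw_mem_ordIdeal (k := k) ρ (P := fun _ => True) (fun _ => Iff.rfl)
  simpa using this

theorem constantCoeff_eq_zero_of_sub_p_mem {g : SymFun k} (hg : g - SymFun.p 1 ∈ SymFun.ordIdeal k 2) :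
    MvPowerSeries.constantCoeff g = 0 := by
  have := SymFun.mem_ordIdeal.1 hg 0 (by simp)
  rw [map_sub, MvPowerSeries.coeff_zero_eq_constantCoeff_apply,
    MvPowerSeries.coeff_zero_eq_constantCoeff_apply, SymFun.p] at this
  simpa using this

variable (hχ : IsClassFun χ)
include hχ

-- A set of `q` vertices with a marked subset of size `s` splits in `q.choose s` ways, and `q.choose
-- s / q ! = 1 / (r ! * s !)`. This groups the pairs (tree, attached corollas) by the total tree.
open Classical in
theorem sum_antidiagonal_signedGraft [CharZero k] (q : ℕ) :
    ∑ p ∈ Finset.HasAntidiagonal.antidiagonal q, (p.1.factorial : k)⁻¹ • (p.2.factorial : k)⁻¹ •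
      ∑ e : Perm (Fin p.1), ∑ ε : Perm (Fin p.2),
        signedGraft χ D (Fin p.1 ⊕ Fin p.2) (Perm.sumCongr e ε) (Set.range Sum.inr) =
    (q.factorial : k)⁻¹ • ∑ e : Perm (Fin q), ∑ S : Finset (Fin q) with ∀ x, e x ∈ S ↔ x ∈ S,
      signedGraft χ D (Fin q) e S := by
  have h := sum_perm_invariant_subset (fun V _ e S => signedGraft χ D V e S)
    (fun V V' _ _ θ e S hS => signedGraft_equiv D hχ V V' θ e S hS) q
  have h' : ∑ e : Perm (Fin q), ∑ S : Finset (Fin q) with ∀ x, e x ∈ S ↔ x ∈ S,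
      signedGraft χ D (Fin q) e S = _ :=
    (Finset.sum_congr rfl fun e _ => Finset.sum_congr (by ext; simp) fun _ _ => rfl).trans h
  rw [h', Finset.smul_sum]
  refine Finset.sum_congr rfl fun p hp => ?_
  obtain ⟨r, s⟩ := p
  rw [Finset.HasAntidiagonal.mem_antidiagonal] at hp
  dsimp only at hp ⊢
  subst hp
  rw [← Nat.cast_smul_eq_nsmul k, smul_smul, smul_smul]
  congr 1
  have h1 := Nat.add_choose_mul_factorial_mul_factorial r s
  have h2 : ((r + s).choose s : k) * r.factorial * s.factorial = (r + s).factorial := by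
    exact_mod_cast h1
  have hr : (r.factorial : k) ≠ 0 := Nat.cast_ne_zero.2 (Nat.factorial_ne_zero _)
  have hs : (s.factorial : k) ≠ 0 := Nat.cast_ne_zero.2 (Nat.factorial_ne_zero _)
  have hrs : ((r + s).factorial : k) ≠ 0 := Nat.cast_ne_zero.2 (Nat.factorial_ne_zero _)
  field_simp
  rw [← h2]
  ring

/-- The equation satisfied by the generating function of trees, up to high order. -/
theorem plethysm_treeCh [CharZero k] {R : ℕ} (hR : 2 ≤ R) :
    SymFun.plethysm (treeCh χ D R) (SymFun.p 1 - SymFun.dp₁ (truncCh χ D)) -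
      (truncCh χ D + (2 : k)⁻¹ • (SymFun.adams 2 (SymFun.dp₁ (truncCh χ D)) -
        SymFun.dp₁ (truncCh χ D) ^ 2)) ∈ SymFun.ordIdeal k (R + 3) := by
  classical
  have hg := constantCoeff_eq_zero_of_sub_p_mem (one_sub_dp₁_truncCh (χ := χ) D)
  let Z : ℕ → ℕ → SymFun k := fun r s => (r.factorial : k)⁻¹ • (s.factorial : k)⁻¹ •
      ∑ e : Perm (Fin r), ∑ ε : Perm (Fin s),
        signedGraft χ D (Fin r ⊕ Fin s) (Perm.sumCongr e ε) (Set.range Sum.inr)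
  have hZ : ∀ r s, Z r s ∈ SymFun.ordIdeal k (r + s + 2) := by
    intro r s
    refine smul_mem_ordIdeal _ (smul_mem_ordIdeal _ (Ideal.sum_mem _ fun e _ =>
      Ideal.sum_mem _ fun ε _ => ?_))
    have := signedGraft_mem_ordIdeal (χ := χ) D (Perm.sumCongr e ε) (Set.range Sum.inr)
    simpa using this
  -- Trees with at most `R` vertices have at most `D * R` flags, which bounds the number of attached
  -- corollas. The extra `R` in the range makes the rectangle contain the triangle `r + s ≤ R` even
  -- for small `D`.
  have h1 : SymFun.plethysm (treeCh χ D R) (SymFun.p 1 - SymFun.dp₁ (truncCh χ D)) =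
      ∑ r ∈ Finset.range (R + 1), ∑ s ∈ Finset.range (D * R + R + 1), Z r s := by
    rw [← SymFun.plethysmHom_apply hg, treeCh, map_sum]
    refine Finset.sum_congr rfl fun r hr => ?_
    rw [map_smul, map_sum]
    have hN : D * Fintype.card (Fin r) ≤ D * R + R := by
      rw [Fintype.card_fin]
      have := Nat.mul_le_mul_left D (Nat.lt_succ_iff.1 (Finset.mem_range.1 hr))
      omega
    rw [Finset.sum_congr rfl fun e _ => plethysm_sumOver_graftSum D hχ hg rfl e hN,
      Finset.sum_comm, Finset.smul_sum]
    refine Finset.sum_congr rfl fun s _ => ?_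
    rw [← Finset.smul_sum]
  have h2 := sum_rectangle_sub_sum_antidiagonal (N := D * R + R) (R := R) (by omega) hZ
  rw [← h1] at h2
  simp only [Z, sum_antidiagonal_signedGraft D hχ] at h2
  -- By `total_of_three_le` only totals of zero, one or two vertices survive, and `2 ≤ R` ensures
  -- that all three occur.
  have hsub : Finset.range 3 ⊆ Finset.range (R + 1) := Finset.range_subset_range.2 (by omega)
  rw [← Finset.sum_subset hsub] at h2
  · rw [Finset.sum_range_succ, Finset.sum_range_succ, Finset.sum_range_one, total_one D hχ,
      total_two D hχ] at h2
    rw [Finset.sum_eq_zero (s := (Finset.univ : Finset (Perm (Fin 0))))] at h2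
    · simpa using h2
    · intro e _
      refine Finset.sum_eq_zero fun S _ => ?_
      rw [signedGraft, sumOver_congr k D (Ψ := fun _ _ _ _ => 0), sumOver_zero, smul_zero]
      intro F _ vt α _
      exact graftSum_of_isEmpty _ _ _ _
  · intro q _ hq
    rw [Finset.sum_eq_zero fun e _ => ?_, smul_zero]
    exact total_of_three_le D (by simpa using hq) e

end TreeEquation

/-! ### Koszul signs -/

section Koszul

/-- The transformation rule for antisymmetric functions, applied to `h * a` and to `a` with `a` the
order sign of a pair, gives the same sign of `σ` twice; dividing leaves the invariance for symmetric
`h`. -/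
theorem prod_Iio_comp_of_symm {n : ℕ} (σ : Perm (Fin n)) {h : Fin n → Fin n → ℤ}
    (hh : ∀ i j, h i j = h j i) :
    ∏ j, ∏ i ∈ Finset.Iio j, h (σ i) (σ j) = ∏ j, ∏ i ∈ Finset.Iio j, h i j := by
  let a : Fin n → Fin n → ℤ := fun i j => if i < j then 1 else if j < i then -1 else 0
  have ha : ∀ i j, a i j = -a j i := by
    intro i j
    simp only [a]
    rcases lt_trichotomy i j with h | h | h
    · simp [h, h.not_gt]
    · simp [h]
    · simp [h, h.not_gt]
  have h1 := σ.prod_Iio_comp_eq_sign_mul_prod (f := fun i j => h i j * a i j)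
    (fun i j => by rw [hh, ha, mul_neg])
  have h2 := σ.prod_Iio_comp_eq_sign_mul_prod (f := a) ha
  have h3 : ∏ j, ∏ i ∈ Finset.Iio j, a i j = 1 :=
    Finset.prod_eq_one fun j _ => Finset.prod_eq_one fun i hi => if_pos (Finset.mem_Iio.1 hi)
  simp only [Finset.prod_mul_distrib] at h1
  rw [h2, h3, mul_one, mul_one, mul_comm] at h1
  exact mul_left_cancel₀ (by simp) h1

/-- The contribution to a Koszul sign of two elements in positions `a` and `b`. -/
def koszulFactor {r : ℕ} (d : Fin r → ℤ) (a b : Fin r) : ℤ :=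
  if b < a then ((d a * d b).negOnePow : ℤ) else 1

theorem koszulSign_eq {r : ℕ} (e : Perm (Fin r)) (d : Fin r → ℤ) :
    koszulSign e d = ∏ j, ∏ i ∈ Finset.Iio j, koszulFactor d (e i) (e j) := by
  rw [koszulSign, Finset.prod_comm]
  refine Finset.prod_congr rfl fun j _ => ?_
  rw [← Finset.prod_subset (Finset.subset_univ (Finset.Iio j))
    (fun i _ hi => if_neg fun h => hi (Finset.mem_Iio.2 h.1))]
  refine Finset.prod_congr rfl fun i hi => ?_
  simp [koszulFactor, Finset.mem_Iio.1 hi]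

theorem negOnePow_mul_self (n : ℤ) : ((n.negOnePow : ℤ)) * n.negOnePow = 1 := by
  rw [← Units.val_mul, Int.units_mul_self, Units.val_one]

theorem koszulSign_mul_self {r : ℕ} (e : Perm (Fin r)) (d : Fin r → ℤ) :
    koszulSign e d * koszulSign e d = 1 := by
  rw [koszulSign, ← Finset.prod_mul_distrib]
  refine Finset.prod_eq_one fun i _ => ?_
  rw [← Finset.prod_mul_distrib]
  refine Finset.prod_eq_one fun j _ => ?_
  split_ifs
  · exact negOnePow_mul_self _
  · rfl

/-- The function `h` is the contribution to the sign of `e` of the unordered pair of positions `i`,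
`j`: for a pair taken in the wrong order its two factors compensate. Being symmetric, its product
over pairs does not change under `e'`, and this is the cocycle identity. -/
theorem koszulSign_mul {r : ℕ} (e e' : Perm (Fin r)) (d : Fin r → ℤ) :
    koszulSign (e * e') d = koszulSign e d * koszulSign e' (fun j => d (e j)) := by
  let h : Fin r → Fin r → ℤ := fun i j =>
    koszulFactor d (e i) (e j) * koszulFactor (fun j => d (e j)) i j
  have hh : ∀ i j, h i j = h j i := by
    intro i j
    by_cases hij : i = j
    · rw [hij]
    have hs := negOnePow_mul_self (d (e i) * d (e j))
    have hc : d (e j) * d (e i) = d (e i) * d (e j) := mul_comm _ _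
    have hne : e i ≠ e j := fun h => hij (e.injective h)
    simp only [h, koszulFactor, hc]
    rcases lt_or_gt_of_ne hij with h1 | h1 <;> rcases lt_or_gt_of_ne hne with h2 | h2 <;>
      simp [h1, h2, h1.not_gt, h2.not_gt, hs]
  have h1 := prod_Iio_comp_of_symm e' hh
  simp only [h, Finset.prod_mul_distrib] at h1
  have h2 : ∏ j, ∏ i ∈ Finset.Iio j, koszulFactor (fun j => d (e j)) i j = 1 :=
    Finset.prod_eq_one fun j _ => Finset.prod_eq_one fun i hi =>
      if_neg (Finset.mem_Iio.1 hi).not_gt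
  have h3 := koszulSign_eq (e * e') d
  have h4 := koszulSign_eq e d
  have h5 := koszulSign_eq e' (fun j => d (e j))
  simp only [Perm.mul_apply] at h3
  rw [h2, mul_one, ← h3, ← h4, ← h5] at h1
  rw [← h1, mul_assoc, koszulSign_mul_self, mul_one]

/-- Both sides are multiplicative, and for a rotation of `a + 1` points the left side is `(-1) ^ a *
(-1) ^ (a + 1) = -1`. -/
theorem sign_mul_neg_one_pow (X : Type) [Fintype X] [DecidableEq X] (α : Perm X) :
    (Perm.sign α : ℤ) * (-1) ^ Fintype.card X = cycProd α fun _ => (-1 : ℤ) := by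
  refine perm_cycle_induction (P := fun X _ α => ∀ [DecidableEq X],
    (Perm.sign α : ℤ) * (-1) ^ Fintype.card X = cycProd α fun _ => (-1 : ℤ)) ?_ ?_ ?_ ?_ X α
  · intro X Y _ _ θ α ih _
    classical
    rw [cycProd_permCongr θ α (fun _ => rfl), ← ih, Perm.sign_permCongr, Fintype.card_congr θ]
  · intro X _ _ α _
    rw [cycProd_of_isEmpty, Subsingleton.elim α 1]
    simp
  · intro X Y _ _ α β iha ihb _
    classical
    rw [cycProd_sumCongr α β (fun _ => rfl), ← iha, ← ihb, Fintype.card_sum, pow_add]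
    have := Perm.sign_sumCongr α β
    rw [show Perm.sign (Perm.sumCongr α β) = Perm.sign α * Perm.sign β by convert this,
      Units.val_mul]
    ring
  · intro a _
    rw [cycProd_finRotate a (fun _ => rfl)]
    have : Perm.sign (finRotate (a + 1)) = (-1) ^ a := by
      refine Eq.trans ?_ (sign_finRotate (a + 1))
      congr
      exact Subsingleton.elim _ _
    rw [this, Fintype.card_fin]
    push_cast
    rw [← pow_add]
    exact Odd.neg_one_pow ⟨a, by ring⟩

/-- Only odd elements contribute. On the positions of odd degree `e` induces a permutation `ε`, the
Koszul sign is the ordinary sign of `ε`, and `sign_mul_neg_one_pow` leaves one factor `-1` per odd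
cycle. This is why the tree sum has a supertrace for each cycle and no further signs. -/
theorem koszulSign_mul_prod {r : ℕ} (e : Perm (Fin r)) (d : Fin r → ℤ)
    (hd : ∀ j, d (e j) = d j) :
    koszulSign e d * ∏ j, ((d j).negOnePow : ℤ) = cycProd e fun j => ((d j).negOnePow : ℤ) := by
  classical
  let O : Finset (Fin r) := Finset.univ.filter fun j => Odd (d j)
  have hO : ∀ j, j ∈ O ↔ Odd (d j) := fun j => by simp [O]
  let o : Fin O.card ≃o O := O.orderIsoOfFin rfl
  let ι : Fin O.card → Fin r := fun a => o a
  have hι : Function.Injective ι := Subtype.val_injective.comp o.injective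
  have hlt : ∀ a b, ι a < ι b ↔ a < b := fun a b => o.lt_iff_lt
  have hrange : ∀ j, j ∈ Set.range ι ↔ Odd (d j) := by
    intro j
    rw [← hO]
    constructor
    · rintro ⟨a, rfl⟩; exact (o a).2
    · intro hj; exact ⟨o.symm ⟨j, hj⟩, by simp [ι]⟩
  have hodd : ∀ a, Odd (d (ι a)) := fun a => (hrange _).1 ⟨a, rfl⟩
  let ε : Perm (Fin O.card) := o.symm.toEquiv.permCongr
    (e.subtypePerm fun j => by rw [hO, hO, hd])
  have hε : ∀ a, ι (ε a) = e (ι a) := by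
    intro a
    simp [ι, ε]
  have hval : ∀ j, ((d j).negOnePow : ℤ) = if j ∈ Set.range ι then -1 else 1 := by
    intro j
    split_ifs with h
    · rw [Int.negOnePow_odd _ ((hrange j).1 h)]; rfl
    · rw [hrange, Int.not_odd_iff_even] at h
      rw [Int.negOnePow_even _ h]; rfl
  have h1 : ∏ j, ((d j).negOnePow : ℤ) = (-1) ^ Fintype.card (Fin O.card) := by
    rw [← Finset.card_univ, ← Finset.prod_const]
    refine (Fintype.prod_of_injective ι hι _ _ (fun j hj => ?_) fun a => ?_).symm
    · rw [hval, if_neg hj]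
    · rw [hval, if_pos ⟨a, rfl⟩]
  have h2 : cycProd e (fun j => ((d j).negOnePow : ℤ)) = cycProd ε fun _ => (-1 : ℤ) := by
    rw [cycProd_of_injective hι hε]
    · exact cycProd_congr fun a => by rw [hval, if_pos ⟨a, rfl⟩]
    · intro j; rw [hd]
    · intro j hj; rw [hval, if_neg hj]
  have h3 : koszulSign e d = Perm.sign ε := by
    rw [koszulSign, Perm.sign_eq_prod_prod_Iio]
    push_cast
    have hz : ∀ i j, (i ∉ Set.range ι ∨ j ∉ Set.range ι) →
        (if i < j ∧ e j < e i then ((d (e i) * d (e j)).negOnePow : ℤ) else 1) = 1 := by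
      intro i j hij
      split_ifs
      · rw [Int.negOnePow_even, Units.val_one]
        rw [hd, hd]
        rcases hij with h | h <;> rw [hrange, Int.not_odd_iff_even] at h
        · exact h.mul_right _
        · exact h.mul_left _
      · rfl
    rw [← Fintype.prod_of_injective ι hι (fun a => ∏ j, if ι a < j ∧ e j < e (ι a) then
      ((d (e (ι a)) * d (e j)).negOnePow : ℤ) else 1) _
      (fun i hi => Finset.prod_eq_one fun j _ => hz i j (Or.inl hi)) fun _ => rfl]
    have hin : ∀ a, (∏ j, if ι a < j ∧ e j < e (ι a) then
        ((d (e (ι a)) * d (e j)).negOnePow : ℤ) else 1) =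
        ∏ b, if a < b ∧ ε b < ε a then -1 else 1 := by
      intro a
      refine (Fintype.prod_of_injective ι hι _ _ (fun j hj => hz _ _ (Or.inr hj)) fun b => ?_).symm
      refine if_congr (by rw [hlt, ← hε, ← hε, hlt]) ?_ rfl
      rw [Int.negOnePow_odd]
      · rfl
      · rw [hd, hd]
        exact (hodd _).mul (hodd _)
    rw [Finset.prod_congr rfl fun a _ => hin a, Finset.prod_comm]
    refine Finset.prod_congr rfl fun b _ => ?_
    rw [← Finset.prod_subset (Finset.subset_univ (Finset.Iio b))
      (fun i _ hi => if_neg fun h => hi (Finset.mem_Iio.2 h.1))]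
    refine Finset.prod_congr rfl fun a ha => ?_
    have hab := Finset.mem_Iio.1 ha
    have hne : ε a ≠ ε b := fun h => hab.ne (ε.injective h)
    rcases lt_or_gt_of_ne hne with h | h <;> simp [hab, h, h.not_gt]
  rw [h1, h2, h3]
  exact sign_mul_neg_one_pow _ ε

end Koszul

/-! ### Traces of permuted tensor products -/

section CyclicTrace

variable {k : Type u} [Field k] {B : Type*} [Fintype B] [DecidableEq B] (s : B → k)

/-- The product of the matrices attached to the first `n` points of an orbit. -/
def orbitProd {X : Type} (e : Perm X) (Y : X → Matrix B B k) (n : ℕ) (j : X) : Matrix B B k :=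
  ((List.range n).map fun i => Y (e^[i] j)).prod

theorem orbitProd_zero {X : Type} (e : Perm X) (Y : X → Matrix B B k) (j : X) :
    orbitProd e Y 0 j = 1 := rfl

theorem orbitProd_succ {X : Type} (e : Perm X) (Y : X → Matrix B B k) (n : ℕ) (j : X) :
    orbitProd e Y (n + 1) j = orbitProd e Y n j * Y (e^[n] j) := by
  simp [orbitProd, List.range_succ]

theorem orbitProd_succ' {X : Type} (e : Perm X) (Y : X → Matrix B B k) (n : ℕ) (j : X) :
    orbitProd e Y (n + 1) j = Y j * orbitProd e Y n (e j) := by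
  simp [orbitProd, List.range_succ_eq_map, Function.comp_def]

theorem orbitProd_map {X Z : Type} {e : Perm X} {ε : Perm Z} {φ : X → Z}
    (h : ∀ x, φ (e x) = ε (φ x)) (Y : Z → Matrix B B k) (n : ℕ) (j : X) :
    orbitProd ε Y n (φ j) = orbitProd e (fun x => Y (φ x)) n j := by
  simp [orbitProd, iterate_comm_of_comm h]

/-- The trace of the return map of an orbit, weighted by `s`. -/
noncomputable def orbitTrace {X : Type} (e : Perm X) (Y : X → Matrix B B k) (j : X) : k :=
  ∑ β, s β * orbitProd e Y (per e j) j β β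

theorem orbitTrace_map {X Z : Type} {e : Perm X} {ε : Perm Z} {φ : X → Z}
    (hφ : Function.Injective φ) (h : ∀ x, φ (e x) = ε (φ x)) (Y : Z → Matrix B B k) (j : X) :
    orbitTrace s ε Y (φ j) = orbitTrace s e (fun x => Y (φ x)) j := by
  simp only [orbitTrace, per_of_injective hφ h, orbitProd_map h]

variable {s}

/-- Cyclicity of the trace moves the first matrix to the end. The weights `s` follow because, by
`hY`, their diagonal matrix commutes with every `Y j`. -/
theorem orbitTrace_apply {X : Type} [Fintype X] {e : Perm X} {Y : X → Matrix B B k}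
    (hY : ∀ j β γ, s β ≠ s γ → Y j β γ = 0) (j : X) :
    orbitTrace s e Y (e j) = orbitTrace s e Y j := by
  have hs : ∀ j, Matrix.diagonal s * Y j = Y j * Matrix.diagonal s := by
    intro j
    ext β γ
    rw [Matrix.diagonal_mul, Matrix.mul_diagonal]
    by_cases h : s β = s γ
    · rw [h, mul_comm]
    · rw [hY j β γ h, mul_zero, zero_mul]
  have ht : ∀ j, orbitTrace s e Y j =
      (Matrix.diagonal s * orbitProd e Y (per e j) j).trace := by
    intro j
    simp [orbitTrace, Matrix.trace]
  obtain ⟨n, hn⟩ : ∃ n, per e j = n + 1 := ⟨per e j - 1, by have := per_pos e j; omega⟩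
  have hj : e^[n] (e j) = j := by
    rw [← iterate_succ_apply, Nat.succ_eq_add_one, ← hn]
    exact iterate_minimalPeriod
  rw [ht, ht, per_apply, hn, orbitProd_succ, orbitProd_succ', hj, ← mul_assoc, ← mul_assoc, hs,
    Matrix.trace_mul_comm (Matrix.diagonal s * _), mul_assoc]

/-- An entry of a matrix product is a sum over paths; `Fin.cons` and `Fin.snoc` list the row and
column indices along the path `β, b, γ`. -/
theorem orbitProd_finRotate_apply (a : ℕ) (Y : Fin (a + 1) → Matrix B B k) (n : ℕ) (hn : n < a + 1)
    (β γ : B) : orbitProd (finRotate (a + 1)) Y (n + 1) 0 β γ =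
      ∑ b : Fin n → B, ∏ j : Fin (n + 1), Y (Fin.castLE hn j) (Fin.cons (α := fun _ => B) β b j)
        (Fin.snoc (α := fun _ => B) b γ j) := by
  induction n generalizing γ with
  | zero =>
    simp only [orbitProd_succ, orbitProd_zero, one_mul, Fintype.sum_unique, Fin.prod_univ_succ,
      Fin.prod_univ_zero, mul_one]
    rfl
  | succ n ih =>
    rw [orbitProd_succ, Matrix.mul_apply, finRotate_iterate_zero a _ hn,
      ← (Fin.snocEquiv fun _ : Fin (n + 1) => B).sum_comp, Fintype.sum_prod_type]
    refine Finset.sum_congr rfl fun δ _ => ?_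
    rw [ih (by omega), Finset.sum_mul]
    refine Finset.sum_congr rfl fun b _ => ?_
    have hs : (Fin.snocEquiv fun _ : Fin (n + 1) => B) (δ, b) = Fin.snoc (α := fun _ => B) b δ := rfl
    have hc : (Fin.cons β (Fin.snoc (α := fun _ => B) b δ : Fin (n + 1) → B) : Fin (n + 2) → B) =
        Fin.snoc (α := fun _ => B) (Fin.cons β b : Fin (n + 1) → B) δ :=
      Fin.cons_snoc_eq_snoc_cons β b δ
    rw [hs, Fin.prod_univ_castSucc (n := n + 1), hc]
    simp only [Fin.snoc_castSucc, Fin.snoc_last]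
    rfl

/-- The trace of a tensor product of matrices composed with a permutation of the factors. -/
theorem sum_cycProd_mul_prod (X : Type) [Fintype X] (e : Perm X) : ∀ (Y : X → Matrix B B k)
    (_ : ∀ j β γ, s β ≠ s γ → Y j β γ = 0), ∑ᶠ b : X → B, cycProd e (fun j => s (b j)) *
      ∏ j, Y j (b j) (b (e j)) = cycProd e (orbitTrace s e Y) := by
  classical
  -- The sum is a `finsum` so that the property proved by induction involves no `Fintype` instance
  -- on `X → B`.
  refine perm_cycle_induction (P := fun X _ e => ∀ (Y : X → Matrix B B k)
    (_ : ∀ j β γ, s β ≠ s γ → Y j β γ = 0), ∑ᶠ b : X → B, cycProd e (fun j => s (b j)) *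
      ∏ j, Y j (b j) (b (e j)) = cycProd e (orbitTrace s e Y)) ?_ ?_ ?_ ?_ X e
  · intro X Z _ _ θ e ih Y hY
    rw [cycProd_permCongr θ e (orbitTrace_apply hY),
      cycProd_congr fun x => orbitTrace_map s θ.injective (e := e) (fun x => by simp) Y x,
      ← ih _ fun j => hY _]
    refine finsum_eq_of_bijective (fun b => b ∘ θ) (θ.arrowCongr (Equiv.refl B)).symm.bijective
      fun b => ?_
    have hp : ∏ j, Y j (b j) (b (θ.permCongr e j)) =
        ∏ j, Y (θ j) (b (θ j)) (b (θ (e j))) :=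
      (Fintype.prod_equiv θ _ _ fun j => by simp).symm
    rw [hp]
    -- A product over cycles can only be transported if `s ∘ b` is constant on cycles. Otherwise
    -- some entry of a matrix vanishes by `hY`, and both sides are zero.
    by_cases hb : ∀ j, s (b (θ.permCongr e j)) = s (b j)
    · rw [cycProd_permCongr θ e hb]
      rfl
    · push Not at hb
      obtain ⟨j, hj⟩ := hb
      have : ∏ j, Y (θ j) (b (θ j)) (b (θ (e j))) = 0 :=
        Finset.prod_eq_zero (Finset.mem_univ (θ.symm j)) (hY _ _ _ fun h => hj (by simpa using h.symm))
      simp only [comp_apply]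
      rw [this, mul_zero, mul_zero]
  · intro X _ _ e Y _
    rw [finsum_eq_single _ isEmptyElim fun b hb => absurd (Subsingleton.elim _ _) hb]
    simp [cycProd_of_isEmpty]
  · intro X Z _ _ e ε ih ih' Y hY
    have h1 := cycProd_sumCongr e ε (orbitTrace_apply (e := Perm.sumCongr e ε) hY)
    rw [h1,
      cycProd_congr fun x => orbitTrace_map s Sum.inl_injective (e := e) (fun x => by simp) Y x,
      cycProd_congr fun x => orbitTrace_map s Sum.inr_injective (e := ε) (fun x => by simp) Y x,
      ← ih _ fun j => hY _, ← ih' _ fun j => hY _, finsum_eq_sum_of_fintype,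
      finsum_eq_sum_of_fintype, finsum_eq_sum_of_fintype, Finset.sum_mul_sum,
      ← (Equiv.sumArrowEquivProdArrow X Z B).symm.sum_comp, Fintype.sum_prod_type]
    refine Finset.sum_congr rfl fun b _ => Finset.sum_congr rfl fun c _ => ?_
    rw [Fintype.prod_sum_type]
    simp only [Equiv.sumArrowEquivProdArrow, Equiv.coe_fn_symm_mk, Sum.elim_inl, Sum.elim_inr,
      Perm.sumCongr_apply, Sum.map_inl, Sum.map_inr]
    by_cases hb : ∀ j, s (Sum.elim b c (Perm.sumCongr e ε j)) = s (Sum.elim b c j)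
    · rw [cycProd_sumCongr e ε hb]
      simp only [Sum.elim_inl, Sum.elim_inr]
      ring
    · push Not at hb
      obtain ⟨j, hj⟩ := hb
      rcases j with j | j
      · rw [Finset.prod_eq_zero (Finset.mem_univ j)
          (hY _ _ _ fun h => hj (by simpa using h.symm))]
        ring
      · rw [Finset.prod_eq_zero (s := (Finset.univ : Finset Z)) (Finset.mem_univ j)
          (hY _ _ _ fun h => hj (by simpa using h.symm))]
        ring
  · intro a Y hY
    rw [cycProd_finRotate a (orbitTrace_apply hY), orbitTrace, per_finRotate,
      finsum_eq_sum_of_fintype, ← (Fin.consEquiv fun _ : Fin (a + 1) => B).sum_comp,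
      Fintype.sum_prod_type]
    refine Finset.sum_congr rfl fun β _ => ?_
    rw [orbitProd_finRotate_apply a Y a (Nat.lt_succ_self a), Finset.mul_sum]
    refine Finset.sum_congr rfl fun b _ => ?_
    simp only [Fin.consEquiv, Equiv.coe_fn_mk]
    have hr : ∀ j, (Fin.cons β b : Fin (a + 1) → B) (finRotate (a + 1) j) =
        (Fin.snoc b β : Fin (a + 1) → B) j := by
      intro j
      refine Fin.lastCases ?_ (fun j => ?_) j
      · rw [finRotate_last, Fin.cons_zero, Fin.snoc_last]
      · rw [Fin.snoc_castSucc, finRotate_of_lt (by simp)]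
        exact Fin.cons_succ _ _ j
    have hp : ∏ j, Y j ((Fin.cons β b : Fin (a + 1) → B) j)
        ((Fin.cons β b : Fin (a + 1) → B) (finRotate (a + 1) j)) =
        ∏ j, Y (Fin.castLE (Nat.lt_succ_self a) j) ((Fin.cons β b : Fin (a + 1) → B) j)
          ((Fin.snoc b β : Fin (a + 1) → B) j) :=
      Finset.prod_congr rfl fun j _ => by rw [hr]; rfl
    refine Eq.trans ?_ (congrArg (s β * ·) hp)
    by_cases hb : ∀ j, s ((Fin.cons β b : Fin (a + 1) → B) (finRotate (a + 1) j)) =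
        s ((Fin.cons β b : Fin (a + 1) → B) j)
    · rw [cycProd_finRotate a hb, Fin.cons_zero]
    · push Not at hb
      obtain ⟨j, hj⟩ := hb
      have h0 := Finset.prod_eq_zero (s := (Finset.univ : Finset (Fin (a + 1))))
        (f := fun j => Y j ((Fin.cons β b : Fin (a + 1) → B) j)
          ((Fin.cons β b : Fin (a + 1) → B) (finRotate (a + 1) j))) (Finset.mem_univ j)
          (hY _ _ _ fun h => hj h.symm)
      refine (congrArg _ h0).trans ?_
      refine (mul_zero _).trans (Eq.symm ?_)
      exact (congrArg (s β * ·) h0).trans (mul_zero _)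

end CyclicTrace

/-! ### Block matrices -/

section BlockMatrix

variable {k : Type u} [Field k] {I : Type*} [DecidableEq I] {κ : I → Type*}

/-- The matrix with a single nonzero block. -/
def blockMatrix (i i' : I) (M : Matrix (κ i) (κ i') k) : Matrix (Σ i, κ i) (Σ i, κ i) k :=
  fun β γ => if h : β.1 = i ∧ γ.1 = i' then M (h.1 ▸ β.2) (h.2 ▸ γ.2) else 0

theorem blockMatrix_apply {i i' : I} (M : Matrix (κ i) (κ i') k) (b : κ i) (b' : κ i') :
    blockMatrix i i' M ⟨i, b⟩ ⟨i', b'⟩ = M b b' :=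
  dif_pos ⟨rfl, rfl⟩

theorem blockMatrix_of_ne_left {i i' : I} (M : Matrix (κ i) (κ i') k) {β γ : Σ i, κ i}
    (h : β.1 ≠ i) : blockMatrix i i' M β γ = 0 :=
  dif_neg fun h' => h h'.1

theorem blockMatrix_of_ne_right {i i' : I} (M : Matrix (κ i) (κ i') k) {β γ : Σ i, κ i}
    (h : γ.1 ≠ i') : blockMatrix i i' M β γ = 0 :=
  dif_neg fun h' => h h'.2

omit [DecidableEq I] in
theorem sum_blockMatrix {A : Type*} [AddCommMonoid A] [Fintype (Σ i, κ i)] (i : I) [Fintype (κ i)]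
    {f : (Σ i, κ i) → A} (hf : ∀ β, β.1 ≠ i → f β = 0) : ∑ β, f β = ∑ b : κ i, f ⟨i, b⟩ := by
  refine (Fintype.sum_of_injective (fun b : κ i => (⟨i, b⟩ : Σ i, κ i)) sigma_mk_injective _ _
    (fun β hβ => hf β fun h => hβ ?_) fun _ => rfl).symm
  obtain ⟨j, b⟩ := β
  obtain rfl : j = i := h
  exact ⟨b, rfl⟩

theorem blockMatrix_mul [Fintype (Σ i, κ i)] {i i' i'' : I} [Fintype (κ i')]
    (M : Matrix (κ i) (κ i') k) (N : Matrix (κ i') (κ i'') k) :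
    blockMatrix i i' M * blockMatrix i' i'' N = blockMatrix i i'' (M * N) := by
  ext β γ
  rw [Matrix.mul_apply, sum_blockMatrix i' fun δ hδ => by rw [blockMatrix_of_ne_right _ hδ, zero_mul]]
  by_cases hβ : β.1 = i
  · by_cases hγ : γ.1 = i''
    · obtain ⟨_, b⟩ := β
      obtain ⟨_, c⟩ := γ
      subst hβ hγ
      rw [blockMatrix_apply, Matrix.mul_apply]
      simp only [blockMatrix_apply]
    · rw [blockMatrix_of_ne_right _ hγ]
      exact Finset.sum_eq_zero fun b _ => by rw [blockMatrix_of_ne_right N hγ, mul_zero]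
  · rw [blockMatrix_of_ne_left _ hβ]
    exact Finset.sum_eq_zero fun b _ => by rw [blockMatrix_of_ne_left M hβ, zero_mul]

theorem exists_eq_mk {I : Type*} {κ : I → Type*} {i : I} {β : Σ i, κ i} (h : β.1 = i) :
    ∃ b : κ i, (⟨i, b⟩ : Σ i, κ i) = β := by
  subst h
  exact ⟨β.2, rfl⟩

end BlockMatrix

/-- Used to replace a sum over degrees of traces by one sum over a finite homogeneous basis in all
degrees. -/
theorem finsum_fiber_eq_sum {A B : Type*} [AddCommMonoid A] [Fintype B] (d : B → ℤ) (f : B → A)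
    (t : ℤ → A) (ht : ∀ i, t i = ∑ b : {b // d b = i}, f b) : ∑ᶠ i, t i = ∑ b, f b := by
  classical
  rw [finsum_eq_sum_of_support_subset (s := Finset.univ.image d),
    ← Finset.sum_fiberwise_of_maps_to (s := Finset.univ) (t := Finset.univ.image d) (g := d)
      (fun b _ => Finset.mem_image_of_mem d (Finset.mem_univ b))]
  · refine Finset.sum_congr rfl fun i _ => ?_
    rw [ht, ← Finset.sum_subtype_eq_sum_filter]
    exact Finset.sum_congr (by ext; simp) fun _ _ => rfl
  · intro i hi
    by_contra h
    refine hi ?_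
    rw [ht]
    refine Finset.sum_eq_zero fun b _ => absurd ?_ h
    exact Finset.mem_coe.2 (Finset.mem_image.2 ⟨b, Finset.mem_univ _, b.2⟩)

/-- The sign `(-1)^i`. -/
def sgn (k : Type u) [Field k] (i : ℤ) : k := ((i.negOnePow : ℤ) : k)

/-! ### Supertraces and homogeneous bases -/

namespace GradedCyclicModule

variable {k : Type u} [Field k] {V : GradedCyclicModule.{u, w} k}

variable (V) in
/-- The index set of a homogeneous basis of `𝒱((m))`. -/
abbrev BasisIndex (m : ℕ) : Type := Σ i : ℤ, Fin (Module.finrank k (V m i))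

variable (V) in
/-- The alternating sum of the traces of a permutation. -/
noncomputable def superTrace (m : ℕ) (ρ : Perm (Fin m)) : k :=
  ∑ᶠ i : ℤ, sgn k i * LinearMap.trace k (V m i) ((V m i).ρ ρ)

variable (V) in
/-- The character of the dual graded representation. -/
noncomputable def superChar (m : ℕ) (ρ : Perm (Fin m)) : k := V.superTrace m ρ⁻¹

theorem superChar_isClassFun : IsClassFun V.superChar := by
  intro m g ρ
  refine finsum_congr fun i => ?_
  congr 1
  have : (g.permCongr ρ)⁻¹ = g * ρ⁻¹ * g⁻¹ := by
    ext x
    simp [Perm.mul_def, Perm.inv_def]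
  rw [this, map_mul, LinearMap.trace_mul_comm, ← map_mul, ← mul_assoc, inv_mul_cancel, one_mul]

variable (hV : V.IsFiniteDimensional)
include hV

theorem IsFiniteDimensional.finite (m : ℕ) (i : ℤ) : Module.Finite k (V m i) := by
  classical
  have := hV m
  exact Module.Finite.of_surjective (DirectSum.component k ℤ (fun i => (V m i : Type w)) i)
    fun x => ⟨DirectSum.lof k ℤ (fun i => (V m i : Type w)) i x, DirectSum.component.lof_self k _ _⟩

/-- A basis of the component of degree `i` of `𝒱((m))`. -/
noncomputable def homBasis (m : ℕ) (i : ℤ) :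
    Module.Basis (Fin (Module.finrank k (V m i))) k (V m i) :=
  have := hV.finite m i
  Module.finBasis k (V m i)

/-- A homogeneous basis of `𝒱((m))`. -/
noncomputable def totalBasis (m : ℕ) :
    Module.Basis (BasisIndex V m) k (⨁ i : ℤ, (V m i : Type w)) :=
  DFinsupp.basis fun i => homBasis hV m i

theorem IsFiniteDimensional.finite_basisIndex (m : ℕ) : Finite (BasisIndex V m) :=
  have := hV m
  Module.Finite.finite_basis (totalBasis hV m)

open Classical in
theorem totalBasis_apply (m : ℕ) (b : BasisIndex V m) :
    totalBasis hV m b = DirectSum.lof k ℤ (fun i => (V m i : Type w)) b.1 (homBasis hV m b.1 b.2) := by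
  refine (totalBasis hV m).ext_elem fun c => ?_
  rw [Module.Basis.repr_self]
  change _ = (homBasis hV m c.1).repr
    ((DirectSum.lof k ℤ (fun i => (V m i : Type w)) b.1 (homBasis hV m b.1 b.2)) c.1) c.2
  obtain ⟨i, b⟩ := b
  obtain ⟨j, c⟩ := c
  by_cases h : i = j
  · subst h
    rw [DirectSum.lof_apply, Module.Basis.repr_self, Finsupp.single_apply, Finsupp.single_apply]
    exact if_congr ⟨fun h => by simpa using h, fun h => congrArg (Sigma.mk i) h⟩ rfl rfl
  · rw [Finsupp.single_eq_of_ne (fun h' => h (congrArg Sigma.fst h').symm), DirectSum.lof_eq_of,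
      DirectSum.of_eq_of_ne _ _ _ (Ne.symm h), map_zero, Finsupp.zero_apply]

/-- The matrix of a permutation in a homogeneous basis. -/
noncomputable def repMatrix (m : ℕ) (ρ : Perm (Fin m)) :
    Matrix (BasisIndex V m) (BasisIndex V m) k :=
  fun b b' => (totalBasis hV m).repr
    (DirectSum.lmap (fun i => (V m i).ρ ρ) (totalBasis hV m b')) b

theorem repMatrix_mul [∀ m, Fintype (BasisIndex V m)] (m : ℕ) (ρ ρ' : Perm (Fin m)) :
    repMatrix hV m (ρ * ρ') = repMatrix hV m ρ * repMatrix hV m ρ' := by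
  classical
  have h : ∀ ρ, repMatrix hV m ρ = LinearMap.toMatrix (totalBasis hV m) (totalBasis hV m)
      (DirectSum.lmap fun i => (V m i).ρ ρ) := by
    intro ρ
    ext b b'
    rw [LinearMap.toMatrix_apply]
    rfl
  rw [h, h, h, ← LinearMap.toMatrix_mul]
  congr 1
  refine DirectSum.linearMap_ext k fun i => LinearMap.ext fun x => ?_
  simp

theorem repMatrix_apply (m : ℕ) (ρ : Perm (Fin m)) (i : ℤ)
    (l l' : Fin (Module.finrank k (V m i))) : repMatrix hV m ρ ⟨i, l⟩ ⟨i, l'⟩ =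
      (homBasis hV m i).repr ((V m i).ρ ρ (homBasis hV m i l')) l := by
  classical
  rw [repMatrix, totalBasis_apply, DirectSum.lmap_lof]
  change (homBasis hV m i).repr ((DirectSum.lof k ℤ (fun i => (V m i : Type w)) i
    ((V m i).ρ ρ (homBasis hV m i l'))) i) l = _
  rw [DirectSum.lof_apply]

theorem repMatrix_of_ne (m : ℕ) (ρ : Perm (Fin m)) {b b' : BasisIndex V m} (h : b.1 ≠ b'.1) :
    repMatrix hV m ρ b b' = 0 := by
  classical
  rw [repMatrix, totalBasis_apply, DirectSum.lmap_lof]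
  change (homBasis hV m b.1).repr ((DirectSum.lof k ℤ (fun i => (V m i : Type w)) b'.1
    ((V m b'.1).ρ ρ (homBasis hV m b'.1 b'.2))) b.1) b.2 = _
  rw [DirectSum.lof_eq_of, DirectSum.of_eq_of_ne _ _ _ h, map_zero, Finsupp.zero_apply]

theorem superTrace_eq [∀ m, Fintype (BasisIndex V m)] (m : ℕ) (ρ : Perm (Fin m)) :
    V.superTrace m ρ = ∑ b : BasisIndex V m, sgn k b.1 * repMatrix hV m ρ b b := by
  classical
  refine finsum_fiber_eq_sum (fun b : BasisIndex V m => b.1) _ _ fun i => ?_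
  rw [LinearMap.trace_eq_matrix_trace k (homBasis hV m i), Matrix.trace, Finset.mul_sum]
  refine Fintype.sum_equiv ⟨fun l => ⟨⟨i, l⟩, rfl⟩, fun b => Fin.cast (by rw [b.2]) b.1.2, ?_, ?_⟩
    _ _ fun l => ?_
  · intro l; rfl
  · rintro ⟨⟨_, l⟩, rfl⟩; rfl
  · simp only [Equiv.coe_fn_mk]
    rw [repMatrix_apply, Matrix.diag_apply, LinearMap.toMatrix_apply]

/-- The matrix of the map induced by a bijection. -/
noncomputable def equivMatrix {m m' : ℕ} (φ : Fin m ≃ Fin m') :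
    Matrix (BasisIndex V m) (BasisIndex V m') k :=
  fun b b' => if h : m' = m then repMatrix hV m (φ.trans (finCongr h))⁻¹ b (h ▸ b') else 0

theorem equivMatrix_perm {m : ℕ} (φ : Perm (Fin m)) :
    equivMatrix hV φ = repMatrix hV m φ⁻¹ := by
  ext b b'
  rw [equivMatrix, dif_pos rfl]
  rfl

/-- The inverse in the definition of `equivMatrix` is responsible for the order of the factors:
`trans` reverses the product of permutations, and inversion reverses it again. -/
theorem equivMatrix_trans [∀ m, Fintype (BasisIndex V m)] {m m' m'' : ℕ} (φ : Fin m ≃ Fin m')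
    (ψ : Fin m' ≃ Fin m'') :
    equivMatrix hV (φ.trans ψ) = equivMatrix hV φ * equivMatrix hV ψ := by
  obtain rfl : m = m' := Fin.equiv_iff_eq.1 ⟨φ⟩
  obtain rfl : m = m'' := Fin.equiv_iff_eq.1 ⟨ψ⟩
  have h : (φ.trans ψ)⁻¹ = φ⁻¹ * ψ⁻¹ := mul_inv_rev ψ φ
  rw [equivMatrix_perm, equivMatrix_perm, equivMatrix_perm, h, repMatrix_mul]

theorem equivMatrix_of_ne {m m' : ℕ} (φ : Fin m ≃ Fin m') {b : BasisIndex V m}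
    {b' : BasisIndex V m'} (h : b.1 ≠ b'.1) : equivMatrix hV φ b b' = 0 := by
  obtain rfl : m = m' := Fin.equiv_iff_eq.1 ⟨φ⟩
  rw [equivMatrix_perm]
  exact repMatrix_of_ne hV m _ h

end GradedCyclicModule

/-! ### Bijections between the flags at two vertices -/

section Fibers

variable {W : Type} {e : Perm W} {val : W → ℕ}

theorem FlagPerm.fiber_injective (α : FlagPerm e val) (j : W) :
    Function.Injective fun x : Fin (val j) =>
      (Fin.cast (congrArg val (α.cover ⟨j, x⟩)) (α.perm ⟨j, x⟩).2 : Fin (val (e j))) := by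
  intro x y hxy
  have h2 : α.perm ⟨j, x⟩ = α.perm ⟨j, y⟩ := by
    refine Sigma.ext ((α.cover ⟨j, x⟩).trans (α.cover ⟨j, y⟩).symm) ?_
    refine (Fin.heq_ext_iff (congrArg val ((α.cover ⟨j, x⟩).trans (α.cover ⟨j, y⟩).symm))).2 ?_
    simpa [Fin.ext_iff] using hxy
  simpa using α.perm.injective h2

/-- The bijection that a permutation of the flags induces between the flags at two vertices. -/
noncomputable def FlagPerm.fiber (α : FlagPerm e val) (j : W) : Fin (val j) ≃ Fin (val (e j)) :=
  Equiv.ofBijective _ ((Fintype.bijective_iff_injective_and_card _).2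
    ⟨α.fiber_injective j, by simp [α.val_apply]⟩)

theorem FlagPerm.perm_mk (α : FlagPerm e val) (j : W) (x : Fin (val j)) :
    α.perm ⟨j, x⟩ = ⟨e j, α.fiber j x⟩ := by
  refine Sigma.ext (α.cover ⟨j, x⟩) ?_
  refine (Fin.heq_ext_iff (congrArg val (α.cover ⟨j, x⟩))).2 ?_
  rfl

end Fibers

/-! ### Supertraces of permuted tensor products -/

namespace GradedCyclicModule

variable {k : Type u} [Field k] {V : GradedCyclicModule.{u, w} k} (hV : V.IsFiniteDimensional)

theorem sum_cycProd_mul_prod_equivMatrix [∀ m, Fintype (BasisIndex V m)] {D : ℕ} {W : Type}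
    [Fintype W] {e : Perm W} (val : W → Finset.Icc 3 D)
    (α : FlagPerm e fun j => (val j : ℕ)) [Fintype (∀ j, BasisIndex V (val j))] :
    ∑ q : ∀ j, BasisIndex V (val j), cycProd e (fun j => sgn k (q j).1) *
      ∏ j, equivMatrix hV (α.fiber j) (q j) (q (e j)) =
    vertexWeight V.superChar Sigma.fst e α.perm := by
  classical
  -- The cyclic trace formula needs one finite index type for all vertices, so the bases for all
  -- valences between `3` and `D` are collected and each matrix becomes a block.
  let B : Type := Σ m : Finset.Icc 3 D, BasisIndex V m
  let s : B → k := fun β => sgn k β.2.1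
  let Y : W → Matrix B B k := fun j =>
    blockMatrix (κ := fun m : Finset.Icc 3 D => BasisIndex V m) (val j) (val (e j))
      (equivMatrix hV (α.fiber j))
  have hY : ∀ j β γ, s β ≠ s γ → Y j β γ = 0 := by
    intro j β γ h
    obtain ⟨m, b⟩ := β
    obtain ⟨m', b'⟩ := γ
    by_cases h1 : m = val j
    · by_cases h2 : m' = val (e j)
      · subst h1 h2
        refine (blockMatrix_apply _ _ _).trans (equivMatrix_of_ne hV _ fun h' => h ?_)
        exact congrArg (sgn k) h'
      · exact blockMatrix_of_ne_right _ h2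
    · exact blockMatrix_of_ne_left _ h1
  have h1 := sum_cycProd_mul_prod W e Y hY
  rw [finsum_eq_sum_of_fintype] at h1
  have h2 : ∑ q : ∀ j, BasisIndex V (val j), cycProd e (fun j => sgn k (q j).1) *
      ∏ j, equivMatrix hV (α.fiber j) (q j) (q (e j)) =
      ∑ b : W → B, cycProd e (fun j => s (b j)) * ∏ j, Y j (b j) (b (e j)) := by
    refine Fintype.sum_of_injective (fun q j => (⟨val j, q j⟩ : B)) ?_ _ _ ?_ ?_
    · intro q q' h
      funext j
      simpa using congrFun h j
    · intro b hb
      by_cases h : ∀ j, (b j).1 = val j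
      · choose q hq using fun j => exists_eq_mk (h j)
        exact absurd ⟨q, funext hq⟩ hb
      · push Not at h
        obtain ⟨j, hj⟩ := h
        rw [Finset.prod_eq_zero (Finset.mem_univ j) (blockMatrix_of_ne_left _ hj), mul_zero]
    · intro q
      congr 1
      exact Finset.prod_congr rfl fun j _ => (blockMatrix_apply
        (κ := fun m : Finset.Icc 3 D => BasisIndex V m) (i := val j) (i' := val (e j))
        (equivMatrix hV (α.fiber j)) (q j) (q (e j))).symm
  rw [h2, h1]
  refine cycProd_congr fun j => ?_
  -- The product along an orbit is the block of the composed bijection of flags. The induction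
  -- starts with one step, since the empty product is the identity on all blocks and not a single
  -- block.
  have h3 : ∀ (n : ℕ) (j : W), ∃ φ : Fin (val j : ℕ) ≃ Fin (val (e^[n + 1] j) : ℕ),
      (∀ x, (⟨e^[n + 1] j, φ x⟩ : Flags fun j => (val j : ℕ)) = (α.perm ^ (n + 1)) ⟨j, x⟩) ∧
      orbitProd e Y (n + 1) j =
        blockMatrix (κ := fun m : Finset.Icc 3 D => BasisIndex V m) (val j) (val (e^[n + 1] j))
          (equivMatrix hV φ) := by
    intro n
    induction n with
    | zero =>
      intro j
      refine ⟨α.fiber j, fun x => ?_, ?_⟩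
      · change _ = (α.perm ^ 1) _
        rw [pow_one]
        exact (α.perm_mk j x).symm
      · rw [orbitProd_succ, orbitProd_zero, one_mul]
        rfl
    | succ n ih =>
      intro j
      obtain ⟨φ, hφ, hp⟩ := ih (e j)
      refine ⟨(α.fiber j).trans φ, fun x => ?_, ?_⟩
      · rw [pow_succ (n := n + 1), Perm.mul_apply, α.perm_mk, ← hφ]
        rfl
      · rw [orbitProd_succ', hp]
        exact (blockMatrix_mul _ _).trans (congrArg _ (equivMatrix_trans hV _ _).symm)
  obtain ⟨n, hn⟩ : ∃ n, per e j = n + 1 := ⟨per e j - 1, by have := per_pos e j; omega⟩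
  obtain ⟨φ, hφ, hp⟩ := h3 n j
  have hj : e^[n + 1] j = j := by rw [← hn]; exact iterate_minimalPeriod
  rw [orbitTrace, hn, hp]
  -- The type of `φ` mentions the endpoint of the orbit, which has to be generalized before it can
  -- be identified with `j`.
  generalize e^[n + 1] j = j' at hj φ hφ
  subst hj
  rw [chiOn_eq superChar_isClassFun (Sigma.mk (β := fun j => Fin (val j : ℕ)) j')
    sigma_mk_injective (Set.range_sigmaMk j') φ hφ]
  rw [superChar, superTrace_eq hV, ← equivMatrix_perm]
  refine (sum_blockMatrix (κ := fun m : Finset.Icc 3 D => BasisIndex V m) (val j') ?_).trans ?_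
  · intro β hβ
    rw [blockMatrix_of_ne_left _ hβ, mul_zero]
  · exact Finset.sum_congr rfl fun b _ => by rw [blockMatrix_apply]

/-- If `e` preserves the degrees of `q`, the Koszul sign times the sign of the total degree is a
product of degree signs over cycles (`koszulSign_mul_prod`). If not, some matrix entry vanishes. -/
theorem sum_koszulSign_mul_prod_equivMatrix [∀ m, Fintype (BasisIndex V m)] {D r : ℕ}
    {e : Perm (Fin r)} (val : Fin r → Finset.Icc 3 D)
    (α : FlagPerm e fun j => (val j : ℕ)) [Fintype (∀ j, BasisIndex V (val j))] :
    ∑ q : ∀ j, BasisIndex V (val j), sgn k (∑ j, (q j).1) *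
      ((koszulSign e (fun j => (q j).1) : k) *
      ∏ j, equivMatrix hV (α.fiber j) (q j) (q (e j))) =
    vertexWeight V.superChar Sigma.fst e α.perm := by
  rw [← sum_cycProd_mul_prod_equivMatrix hV]
  refine Finset.sum_congr rfl fun q _ => ?_
  rw [← mul_assoc]
  by_cases h : ∀ j, (q (e j)).1 = (q j).1
  · congr 1
    have h1 := koszulSign_mul_prod e (fun j => (q j).1) h
    have h2 : ∀ s : Finset (Fin r), sgn k (∑ j ∈ s, (q j).1) =
        ((∏ j ∈ s, ((q j).1.negOnePow : ℤ) : ℤ) : k) := by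
      intro s
      classical
      induction s using Finset.induction_on with
      | empty => simp [sgn]
      | insert a s ha ih =>
        rw [Finset.sum_insert ha, Finset.prod_insert ha, Int.cast_mul, ← ih]
        simp [sgn, Int.negOnePow_add]
    rw [h2, mul_comm, ← Int.cast_mul, h1]
    exact map_cycProd (Int.castRingHom k) e _
  · push Not at h
    obtain ⟨j, hj⟩ := h
    rw [Finset.prod_eq_zero (Finset.mem_univ j) (equivMatrix_of_ne hV _ (Ne.symm hj)), mul_zero,
      mul_zero]

end GradedCyclicModule

/-! ### Reordered and relabelled trees -/

theorem StableTree.isTree {n : ℕ} (T : StableTree n) :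
    IsTree (Sigma.fst : (Σ j, Fin (T.val j)) → Fin T.r) T.inv :=
  ⟨T.inv_inv, T.connected, by rw [T.genus_zero, Nat.card_fin]⟩

/-- Turns an equality of structures with dependent fields into pointwise equations with explicit
casts of the flags. -/
theorem StableTree.mk_eq_mk_iff {n r : ℕ} {val val' : Fin r → ℕ}
    {inv : Perm (Σ j, Fin (val j))} {inv' : Perm (Σ j, Fin (val' j))}
    {leg : Fin n → Σ j, Fin (val j)} {leg' : Fin n → Σ j, Fin (val' j)}
    {h1 h2 h3 h4 h5 h6 h1' h2' h3' h4' h5' h6'} :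
    StableTree.mk r val' inv' leg' h1' h2' h3' h4' h5' h6' =
      StableTree.mk r val inv leg h1 h2 h3 h4 h5 h6 ↔ ∃ h : ∀ j, val' j = val j,
      (∀ z, Equiv.sigmaCongrRight (fun j => finCongr (h j)) (inv' z) =
        inv (Equiv.sigmaCongrRight (fun j => finCongr (h j)) z)) ∧
      ∀ a, Equiv.sigmaCongrRight (fun j => finCongr (h j)) (leg' a) = leg a := by
  constructor
  · intro h
    simp only [StableTree.mk.injEq, true_and] at h
    obtain ⟨rfl, h⟩ := h
    rw [heq_eq_eq, heq_eq_eq] at h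
    obtain ⟨rfl, rfl⟩ := h
    exact ⟨fun _ => rfl, fun _ => rfl, fun _ => rfl⟩
  · rintro ⟨h, hi, hl⟩
    obtain rfl : val' = val := funext h
    obtain rfl : inv' = inv := Equiv.ext hi
    obtain rfl : leg' = leg := funext hl
    rfl

theorem StableTree.reorder_reorder {n : ℕ} (T : StableTree n) (e : Perm (Fin T.r))
    (τ : ∀ j, Perm (Fin (T.val (e j)))) (e' : Perm (Fin T.r))
    (τ' : ∀ j, Perm (Fin (T.val (e (e' j))))) :
    (T.reorder e τ).reorder e' τ' = T.reorder (e * e') fun j => τ (e' j) * τ' j := by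
  have h : Equiv.sigmaCongr (β₂ := fun j => Fin (T.val j)) (e * e') (fun j => τ (e' j) * τ' j) =
      (Equiv.sigmaCongr (β₂ := fun j => Fin (T.val (e j))) e' τ').trans
        (Equiv.sigmaCongr (β₂ := fun j => Fin (T.val j)) e τ) := by
    ext ⟨j, x⟩ <;> rfl
  refine StableTree.mk_eq_mk_iff.2 ⟨fun _ => rfl, fun z => ?_, fun a => ?_⟩
  · refine Eq.trans ?_ (congrArg (fun S : (Σ j, Fin (T.val (e (e' j)))) ≃ Σ j, Fin (T.val j) =>
      S.symm (T.inv (S z))) h.symm)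
    rfl
  · refine Eq.trans ?_ (congrArg (fun S : (Σ j, Fin (T.val (e (e' j)))) ≃ Σ j, Fin (T.val j) =>
      S.symm (T.leg a)) h.symm)
    rfl

section FiberPerm

variable {W : Type} {e : Perm W} {val : W → ℕ}

/-- A permutation of the flags covering `e`, as a family of permutations. -/
noncomputable def FlagPerm.fiberPerm (α : FlagPerm e val) (j : W) : Perm (Fin (val (e j))) :=
  (finCongr (α.val_apply j)).trans (α.fiber j)

theorem FlagPerm.fiberPerm_apply (α : FlagPerm e val) (h : ∀ j, val (e j) = val j)
    (z : Σ j, Fin (val (e j))) : Equiv.sigmaCongr e α.fiberPerm z =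
      α.perm (Equiv.sigmaCongrRight (fun j => finCongr (h j)) z) := by
  obtain ⟨j, x⟩ := z
  exact (α.perm_mk j _).symm

theorem FlagPerm.fiberPerm_injective :
    Function.Injective (FlagPerm.fiberPerm : FlagPerm e val → _) := by
  intro α β h
  refine FlagPerm.ext_perm (Equiv.ext fun y => ?_)
  obtain ⟨z, rfl⟩ := (Equiv.sigmaCongrRight fun j => finCongr (α.val_apply j)).surjective y
  rw [← α.fiberPerm_apply α.val_apply, ← β.fiberPerm_apply α.val_apply, h]

theorem FlagPerm.exists_fiberPerm_eq (h : ∀ j, val (e j) = val j)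
    (τ : ∀ j, Perm (Fin (val (e j)))) : ∃ α : FlagPerm e val, α.fiberPerm = τ := by
  let K := Equiv.sigmaCongrRight fun j => finCongr (h j)
  refine ⟨⟨K.symm.trans (Equiv.sigmaCongr e τ), fun x => rfl⟩, ?_⟩
  funext j
  ext x
  have := FlagPerm.fiberPerm_apply ⟨K.symm.trans (Equiv.sigmaCongr e τ), fun x => rfl⟩ h ⟨j, x⟩
  have h2 : (⟨e j, FlagPerm.fiberPerm ⟨K.symm.trans (Equiv.sigmaCongr e τ), fun x => rfl⟩ j x⟩ :
    Σ j, Fin (val j)) = ⟨e j, τ j x⟩ := this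
  exact congrArg Fin.val (eq_of_heq (Sigma.mk.inj h2).2)

end FiberPerm

/-- The orderings that contribute to a diagonal matrix entry are those returning the same ordered
tree, and these are precisely the automorphisms inducing the permutation of the legs. -/
theorem StableTree.reorder_relabel_eq_iff {n : ℕ} (T : StableTree n) (e : Perm (Fin T.r))
    (τ : ∀ j, Perm (Fin (T.val (e j)))) (σ : Perm (Fin n)) :
    (T.reorder e τ).relabel σ = T ↔ ∃ α : FlagPerm e T.val, α.fiberPerm = τ ∧
      (∀ x, T.inv (α.perm x) = α.perm (T.inv x)) ∧
      ∀ a, α.perm (T.leg a) = T.leg (σ⁻¹ a) := by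
  refine StableTree.mk_eq_mk_iff.trans ?_
  have key : ∀ (α : FlagPerm e T.val) (h : ∀ j, T.val (e j) = T.val j) (y : Σ j, Fin (T.val j)),
      Equiv.sigmaCongrRight (fun j => finCongr (h j)) ((Equiv.sigmaCongr e α.fiberPerm).symm y) =
      α.perm.symm y := by
    intro α h y
    obtain ⟨z, rfl⟩ := (Equiv.sigmaCongr e α.fiberPerm).surjective y
    rw [symm_apply_apply, α.fiberPerm_apply h, symm_apply_apply]
  constructor
  · rintro ⟨h, hi, hl⟩
    obtain ⟨α, rfl⟩ := FlagPerm.exists_fiberPerm_eq (val := T.val)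
      (show ∀ j, T.val (e j) = T.val j from h) τ
    refine ⟨α, rfl, fun x => ?_, fun a => ?_⟩
    · obtain ⟨z, rfl⟩ := (Equiv.sigmaCongrRight fun j => finCongr (h j)).surjective x
      rw [← hi]
      simp only [Equiv.trans_apply]
      rw [key, α.fiberPerm_apply h, apply_symm_apply]
    · rw [← hl, key, apply_symm_apply]
  · rintro ⟨α, rfl, hi, hl⟩
    refine ⟨α.val_apply, fun z => ?_, fun a => ?_⟩
    · simp only [Equiv.trans_apply]
      rw [key, α.fiberPerm_apply α.val_apply, hi, symm_apply_apply]
    · rw [key, ← hl, symm_apply_apply]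

/-! ### Symmetrization over the orderings of a tree -/

namespace GradedCyclicModule

variable {k : Type u} [Field k] {V : GradedCyclicModule.{u, w} k}

theorem treeIncl_tprod_congr {n : ℕ} {i : ℤ} {x y : TreeIndex n i} (h : x = y)
    {a : ∀ j : Fin x.tree.r, (V (x.tree.val j) (x.deg j) : Type w)}
    {b : ∀ j : Fin y.tree.r, (V (y.tree.val j) (y.deg j) : Type w)} (hab : HEq a b) :
    treeIncl V x (PiTensorProduct.tprod k a) = treeIncl V y (PiTensorProduct.tprod k b) := by
  subst h
  rw [eq_of_heq hab]

variable (V) in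
/-- The isomorphism between the tensor products of a tree and of the same tree reordered. -/
noncomputable def reorderMap {n : ℕ} {i : ℤ} (x : TreeIndex n i) (e : Perm (Fin x.tree.r))
    (τ : ∀ j, Perm (Fin (x.tree.val (e j)))) : TreeTensor V x →ₗ[k] TreeTensor V (x.reorder e τ) :=
  PiTensorProduct.map (fun j => (V (x.tree.val (e j)) (x.deg (e j))).ρ (τ j)⁻¹) ∘ₗ
    (PiTensorProduct.reindex k (fun j : Fin x.tree.r => (V (x.tree.val j) (x.deg j) : Type w))
      e.symm).toLinearMap

theorem reorderMap_tprod {n : ℕ} {i : ℤ} (x : TreeIndex n i) (e : Perm (Fin x.tree.r))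
    (τ : ∀ j, Perm (Fin (x.tree.val (e j))))
    (a : ∀ j : Fin x.tree.r, (V (x.tree.val j) (x.deg j) : Type w)) :
    reorderMap V x e τ (PiTensorProduct.tprod k a) =
      PiTensorProduct.tprod k fun j : Fin x.tree.r =>
        ((V (x.tree.val (e j)) (x.deg (e j))).ρ (τ j)⁻¹ (a (e j)) :
          (V (x.tree.val (e j)) (x.deg (e j)) : Type w)) := by
  have h := PiTensorProduct.reindex_tprod (R := k)
    (s := fun j : Fin x.tree.r => (V (x.tree.val j) (x.deg j) : Type w)) e.symm a
  exact (congrArg (PiTensorProduct.map fun j : Fin x.tree.r =>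
    (V (x.tree.val (e j)) (x.deg (e j))).ρ (τ j)⁻¹) h).trans (PiTensorProduct.map_tprod _ _)

variable (k) in
/-- The inverse of the number of orderings of a tree. -/
noncomputable def treeWeight {r : ℕ} (val : Fin r → ℕ) : k :=
  (r.factorial : k)⁻¹ * (∏ j, ((val j).factorial : k))⁻¹

theorem treeWeight_comp {r : ℕ} (val : Fin r → ℕ) (e : Perm (Fin r)) :
    treeWeight k (fun j => val (e j)) = treeWeight k val := by
  rw [treeWeight, treeWeight, Equiv.prod_comp e fun j => ((val j).factorial : k)]

theorem treeWeight_mul [CharZero k] {r : ℕ} (val : Fin r → ℕ) :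
    treeWeight k val * ∑ e : Perm (Fin r), ∑ _τ : ∀ j, Perm (Fin (val (e j))), (1 : k) = 1 := by
  have h : ∀ e : Perm (Fin r), ∑ _τ : ∀ j, Perm (Fin (val (e j))), (1 : k) =
      ∏ j, ((val j).factorial : k) := by
    intro e
    rw [← Equiv.prod_comp e fun j => ((val j).factorial : k)]
    simp [Fintype.card_pi, Fintype.card_perm]
  have h1 : ∏ j, ((val j).factorial : k) ≠ 0 :=
    Finset.prod_ne_zero_iff.2 fun j _ => Nat.cast_ne_zero.2 (Nat.factorial_ne_zero _)
  have h2 : (r.factorial : k) ≠ 0 := Nat.cast_ne_zero.2 (Nat.factorial_ne_zero _)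
  simp only [h, treeWeight, Finset.sum_const, Finset.card_univ, Fintype.card_perm, Fintype.card_fin,
    nsmul_eq_mul]
  field_simp

variable (V) in
open Classical in
/-- The symmetrization over all orderings of a tree. -/
noncomputable def symmetrize (n : ℕ) (i : ℤ) :
    (⨁ x : TreeIndex n i, TreeTensor V x) →ₗ[k] ⨁ x : TreeIndex n i, TreeTensor V x :=
  DirectSum.toModule k (TreeIndex n i) _ fun x => treeWeight k x.tree.val •
    ∑ e : Perm (Fin x.tree.r), ∑ τ : ∀ j, Perm (Fin (x.tree.val (e j))),
      (koszulSign e x.deg : k) • (treeIncl V (x.reorder e τ) ∘ₗ reorderMap V x e τ)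

theorem symmetrize_treeIncl {n : ℕ} {i : ℤ} (x : TreeIndex n i)
    (a : ∀ j : Fin x.tree.r, (V (x.tree.val j) (x.deg j) : Type w)) :
    symmetrize V n i (treeIncl V x (PiTensorProduct.tprod k a)) = treeWeight k x.tree.val •
    ∑ e : Perm (Fin x.tree.r), ∑ τ : ∀ j, Perm (Fin (x.tree.val (e j))),
      (koszulSign e x.deg : k) • treeIncl V (x.reorder e τ)
        (PiTensorProduct.tprod k fun j : Fin x.tree.r =>
        ((V (x.tree.val (e j)) (x.deg (e j))).ρ (τ j)⁻¹ (a (e j)) :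
          (V (x.tree.val (e j)) (x.deg (e j)) : Type w))) := by
  classical
  unfold symmetrize treeIncl
  rw [DirectSum.toModule_lof]
  simp only [LinearMap.smul_apply, LinearMap.sum_apply, LinearMap.comp_apply, reorderMap_tprod]

theorem _root_.TreeIndex.reorder_reorder {n : ℕ} {i : ℤ} (x : TreeIndex n i) (e : Perm (Fin x.tree.r))
    (τ : ∀ j, Perm (Fin (x.tree.val (e j)))) (e' : Perm (Fin x.tree.r))
    (τ' : ∀ j, Perm (Fin (x.tree.val (e (e' j))))) :
    (x.reorder e τ).reorder e' τ' = x.reorder (e * e') fun j => τ (e' j) * τ' j := by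
  rw [TreeIndex.mk.injEq]
  exact ⟨x.tree.reorder_reorder e τ e' τ', HEq.rfl⟩

/-- The reorderings of a reordered tree are the translates of the reorderings of the tree itself.
Reindexing by this translation, with the signs controlled by `koszulSign_mul`, shows that both terms
of a relation have the same symmetrization. -/
theorem treeRelations_le_ker_symmetrize {n : ℕ} {i : ℤ} :
    treeRelations V n i ≤ LinearMap.ker (symmetrize V n i) := by
  refine Submodule.span_le.2 ?_
  rintro _ ⟨x, e, τ, a, rfl⟩
  rw [SetLike.mem_coe, LinearMap.mem_ker, map_sub, map_zsmul, sub_eq_zero, symmetrize_treeIncl]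
  have h := symmetrize_treeIncl (V := V) (x.reorder e τ) (fun j : Fin x.tree.r =>
        ((V (x.tree.val (e j)) (x.deg (e j))).ρ (τ j)⁻¹ (a (e j)) :
          (V (x.tree.val (e j)) (x.deg (e j)) : Type w)))
  refine Eq.trans ?_ (congrArg _ h).symm
  rw [show treeWeight k (x.reorder e τ).tree.val = treeWeight k x.tree.val from treeWeight_comp _ e,
    smul_comm]
  congr 1
  rw [Finset.smul_sum]
  symm
  refine Fintype.sum_equiv (Equiv.mulLeft e) _ _ fun e' => ?_
  rw [Finset.smul_sum]
  refine Fintype.sum_equiv (Equiv.piCongrRight fun j => Equiv.mulLeft (τ (e' j))) _ _ fun τ' => ?_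
  rw [← Int.cast_smul_eq_zsmul k, smul_smul, ← Int.cast_mul]
  have h1 : koszulSign (Equiv.mulLeft e e') x.deg =
    koszulSign e x.deg * koszulSign e' (fun j => x.deg (e j)) := koszulSign_mul e e' x.deg
  rw [h1]
  congr 1
  refine treeIncl_tprod_congr (x.reorder_reorder e τ e' τ') (heq_of_eq ?_)
  funext j
  have h2 := map_mul (V (x.tree.val (e (e' j))) (x.deg (e (e' j)))).ρ (τ' j)⁻¹ (τ (e' j))⁻¹
  rw [← mul_inv_rev] at h2
  exact (LinearMap.congr_fun h2 _).symm

-- All terms of the symmetrization have the same class in the quotient, and `treeWeight` is the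
-- inverse of their number.
variable (V) in
theorem mkQ_comp_symmetrize [CharZero k] (n : ℕ) (i : ℤ) :
    (treeRelations V n i).mkQ ∘ₗ symmetrize V n i = (treeRelations V n i).mkQ := by
  classical
  refine DirectSum.linearMap_ext k fun x => PiTensorProduct.ext (MultilinearMap.ext fun a => ?_)
  change (treeRelations V n i).mkQ (symmetrize V n i (treeIncl V x (PiTensorProduct.tprod k a))) =
    (treeRelations V n i).mkQ (treeIncl V x (PiTensorProduct.tprod k a))
  rw [symmetrize_treeIncl, map_smul, map_sum]
  have h : ∀ (e : Perm (Fin x.tree.r)) (τ : ∀ j, Perm (Fin (x.tree.val (e j)))),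
      (treeRelations V n i).mkQ ((koszulSign e x.deg : k) • treeIncl V (x.reorder e τ)
        (PiTensorProduct.tprod k fun j : Fin x.tree.r =>
        ((V (x.tree.val (e j)) (x.deg (e j))).ρ (τ j)⁻¹ (a (e j)) :
          (V (x.tree.val (e j)) (x.deg (e j)) : Type w)))) =
      (treeRelations V n i).mkQ (treeIncl V x (PiTensorProduct.tprod k a)) := by
    intro e τ
    have key : ∀ t : ⨁ y : TreeIndex n i, TreeTensor V y,
      (koszulSign e x.deg : k) • t = koszulSign e x.deg • t := by
        intro t
        rw [← Int.cast_smul_eq_zsmul k]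
    refine (congrArg _ (key _)).trans ?_
    symm
    refine (Submodule.Quotient.eq (treeRelations V n i)).2 (Submodule.subset_span ?_)
    exact ⟨x, e, τ, a, rfl⟩
  simp only [map_sum, h]
  have h1 := treeWeight_mul (k := k) x.tree.val
  simp only [Finset.sum_const, smul_smul, ← Nat.cast_smul_eq_nsmul k, ← Finset.sum_smul] at h1 ⊢
  simp only [smul_eq_mul, mul_one] at h1
  rw [h1, one_smul]

/-- The trace of the map induced on a quotient by an idempotent. -/
theorem trace_quotient {M Q : Type*} [AddCommGroup M] [Module k M] [AddCommGroup Q] [Module k Q]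
    [Module.Finite k M] {π : M →ₗ[k] Q} (hπ : Function.Surjective π) {E : M →ₗ[k] M}
    (hE : LinearMap.ker π ≤ LinearMap.ker E) (hπE : π ∘ₗ E = π) {f : M →ₗ[k] M} {g : Q →ₗ[k] Q}
    (hfg : π ∘ₗ f = g ∘ₗ π) : LinearMap.trace k Q g = LinearMap.trace k M (f ∘ₗ E) := by
  have : Module.Finite k Q := Module.Finite.of_surjective π hπ
  -- `E` factors as `s ∘ π`, and `s` is a section of `π`; cyclicity of the trace then moves `π` from
  -- the left of `f ∘ s` to the right.
  let s : Q →ₗ[k] M := (LinearMap.ker π).liftQ E hE ∘ₗ (π.quotKerEquivOfSurjective hπ).symm.toLinearMap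
  have hs : s ∘ₗ π = E := by
    ext x
    have : (π.quotKerEquivOfSurjective hπ).symm (π x) = Submodule.Quotient.mk x := by
      rw [LinearEquiv.symm_apply_eq]; rfl
    simp only [s, LinearMap.comp_apply, LinearEquiv.coe_coe]
    rw [this]
    rfl
  have hsπ : π ∘ₗ s = LinearMap.id := by
    rw [← LinearMap.cancel_right hπ, LinearMap.comp_assoc, hs, hπE, LinearMap.id_comp]
  calc LinearMap.trace k Q g = LinearMap.trace k Q ((g ∘ₗ π) ∘ₗ s) := by
        rw [LinearMap.comp_assoc, hsπ, LinearMap.comp_id]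
    _ = LinearMap.trace k Q (π ∘ₗ (f ∘ₗ s)) := by rw [← hfg, LinearMap.comp_assoc]
    _ = LinearMap.trace k M ((f ∘ₗ s) ∘ₗ π) := LinearMap.trace_comp_comm' _ _
    _ = _ := by rw [LinearMap.comp_assoc, hs]

end GradedCyclicModule

/-! ### Finiteness of the set of trees -/

namespace StableTree

variable {n : ℕ}

theorem card_legs (T : StableTree n) : Nat.card {x // T.inv x = x} = n := by
  have h : Function.Bijective
      (fun a => ⟨T.leg a, (T.isLeg_iff _).2 ⟨a, rfl⟩⟩ : Fin n → {x // T.inv x = x}) := by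
    refine ⟨fun a b h => T.leg_injective (congrArg Subtype.val h), ?_⟩
    rintro ⟨x, hx⟩
    obtain ⟨a, rfl⟩ := (T.isLeg_iff x).1 hx
    exact ⟨a, rfl⟩
  rw [← Nat.card_congr (Equiv.ofBijective _ h), Nat.card_fin]

theorem three_mul_r_le (T : StableTree n) :
    3 * Fintype.card (Fin T.r) ≤ Fintype.card (Σ j, Fin (T.val j)) := by
  rw [Fintype.card_sigma]
  simp only [Fintype.card_fin]
  have := Finset.card_nsmul_le_sum Finset.univ T.val 3 fun j _ => T.stable j
  simp at this
  linarith

theorem r_add_two_le (T : StableTree n) : T.r + 2 ≤ n := by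
  have := T.isTree.card_legs T.three_mul_r_le
  rwa [T.card_legs, Fintype.card_fin] at this

/-- The valences add up to `n + 2 * r - 2`, and the other `r - 1` vertices use at least `3 * (r -
1)` of this, which leaves at most `n - r + 1` for `j`. -/
theorem val_le (T : StableTree n) (j : Fin T.r) : T.val j ≤ n := by
  classical
  have h1 := T.genus_zero
  have h2 : Nat.card {x // T.inv x = x} + Nat.card {x // T.inv x ≠ x} = ∑ j, T.val j := by
    rw [← Nat.card_sum, Nat.card_congr (Equiv.sumCompl _), Nat.card_eq_fintype_card]
    simp
  rw [T.card_legs, ← Finset.add_sum_erase _ _ (Finset.mem_univ j)] at h2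
  have h3 := Finset.card_nsmul_le_sum (Finset.univ.erase j) (fun j => T.val j) 3 fun j _ => T.stable j
  rw [Finset.card_erase_of_mem (Finset.mem_univ j), Finset.card_univ, Fintype.card_fin,
    smul_eq_mul] at h3
  have := j.2
  omega

end StableTree

/-- The involutions and labellings that make a set of flags into a tree. -/
abbrev TreeStructure (n : ℕ) {r : ℕ} (val : Fin r → ℕ) : Type :=
  {p : Perm (Flags val) × (Fin n → Flags val) // IsTree (Sigma.fst : Flags val → Fin r) p.1 ∧
    Function.Injective p.2 ∧ ∀ x, p.1 x = x ↔ ∃ a, p.2 a = x}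

/-- A tree from the valences, the involution and the labelling. -/
def TreeStructure.toTree {n r : ℕ} {val : Fin r → ℕ} (hval : ∀ j, 3 ≤ val j)
    (p : TreeStructure n val) : StableTree n where
  r := r
  val := val
  inv := p.1.1
  leg := p.1.2
  inv_inv := p.2.1.inv_inv
  leg_injective := p.2.2.1
  isLeg_iff := p.2.2.2
  connected := p.2.1.connected
  genus_zero := by rw [p.2.1.genus_zero, Nat.card_fin]
  stable := hval

/-- Since vertices and valences are bounded by `n`, any bounds `R, D ≥ n` capture all trees. It
gives finiteness and rewrites sums over trees as sums over vertex numbers, valences and tree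
structures. -/
theorem StableTree.toTree_bijective {n R D : ℕ} (hR : n ≤ R) (hD : n ≤ D) :
    Function.Bijective (fun d : Σ (r : Fin (R + 1)) (val : Fin r → Finset.Icc 3 D),
      TreeStructure n fun j => (val j : ℕ) =>
        d.2.2.toTree fun j => (Finset.mem_Icc.1 (d.2.1 j).2).1) := by
  constructor
  · rintro ⟨⟨r, hr⟩, val, ⟨⟨inv, leg⟩, h⟩⟩ ⟨⟨r', hr'⟩, val', ⟨⟨inv', leg'⟩, h'⟩⟩ hd
    dsimp only [TreeStructure.toTree] at hd
    rw [StableTree.mk.injEq] at hd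
    obtain ⟨rfl, hd⟩ := hd
    have hv : val = val' := funext fun j => Subtype.ext (congrFun (eq_of_heq hd.1) j)
    subst hv
    obtain ⟨-, hi, hl⟩ := hd
    obtain rfl := eq_of_heq hi
    obtain rfl := eq_of_heq hl
    rfl
  · intro T
    have hr : T.r < R + 1 := by have := T.r_add_two_le; omega
    refine ⟨⟨⟨T.r, hr⟩, fun j => ⟨T.val j, Finset.mem_Icc.2 ⟨T.stable j, (T.val_le j).trans hD⟩⟩,
      ⟨(T.inv, T.leg), T.isTree, T.leg_injective, T.isLeg_iff⟩⟩, rfl⟩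

instance StableTree.finite (n : ℕ) : Finite (StableTree n) := by
  classical
  have : ∀ (r : Fin (n + 1)) (val : Fin r → Finset.Icc 3 n),
    Finite (TreeStructure n fun j => (val j : ℕ)) := fun _ _ => inferInstance
  exact Finite.of_surjective _ (StableTree.toTree_bijective le_rfl le_rfl).2

/-! ### A basis of the sum over ordered trees -/

namespace GradedCyclicModule

variable {k : Type u} [Field k] {V : GradedCyclicModule.{u, w} k}

variable (V) in
/-- The index set of a basis of the sum over ordered trees. -/
abbrev TreeBasisIndex (n : ℕ) (i : ℤ) : Type :=
  Σ x : TreeIndex n i, ∀ j : Fin x.tree.r, Fin (Module.finrank k (V (x.tree.val j) (x.deg j)))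

variable (V) in
/-- The elements of the bases of the sums over ordered trees, in all degrees. -/
abbrev DecoratedTree (n : ℕ) : Type := Σ T : StableTree n, ∀ j, BasisIndex V (T.val j)

/-- The degree of a decorated tree. -/
def DecoratedTree.degree {n : ℕ} (p : DecoratedTree V n) : ℤ := ∑ j, (p.2 j).1

variable (V) in
/-- Basis elements correspond to decorated trees. -/
def treeBasisIndexEquiv (n : ℕ) (i : ℤ) :
    TreeBasisIndex V n i ≃ {p : DecoratedTree V n // DecoratedTree.degree p = i} where
  toFun b := ⟨⟨b.1.tree, fun j => ⟨b.1.deg j, b.2 j⟩⟩, b.1.sum_deg⟩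
  invFun p := ⟨⟨p.1.1, fun j => (p.1.2 j).1, p.2⟩, fun j => (p.1.2 j).2⟩
  left_inv _ := rfl
  right_inv _ := rfl

variable (hV : V.IsFiniteDimensional)
include hV

theorem IsFiniteDimensional.finite_decoratedTree (n : ℕ) : Finite (DecoratedTree V n) :=
  have := hV.finite_basisIndex
  inferInstance

theorem IsFiniteDimensional.finite_treeBasisIndex (n : ℕ) (i : ℤ) : Finite (TreeBasisIndex V n i) :=
  have := hV.finite_decoratedTree n
  Finite.of_equiv _ (treeBasisIndexEquiv V n i).symm

/-- A basis of the sum over ordered trees. -/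
noncomputable def treeBasis (n : ℕ) (i : ℤ) :
    Module.Basis (TreeBasisIndex V n i) k (⨁ x : TreeIndex n i, TreeTensor V x) :=
  DFinsupp.basis fun x => Basis.piTensorProduct fun j => homBasis hV (x.tree.val j) (x.deg j)

theorem treeBasis_repr_of_ne {n : ℕ} {i : ℤ} {x y : TreeIndex n i} (h : y ≠ x) (t : TreeTensor V y)
    (q : ∀ j : Fin x.tree.r, Fin (Module.finrank k (V (x.tree.val j) (x.deg j)))) :
    (treeBasis hV n i).repr (treeIncl V y t) ⟨x, q⟩ = 0 := by
  classical
  change (Basis.piTensorProduct fun j => homBasis hV (x.tree.val j) (x.deg j)).repr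
    ((DirectSum.lof k (TreeIndex n i) (fun y => TreeTensor V y) y t) x) q = 0
  rw [DirectSum.lof_eq_of, DirectSum.of_eq_of_ne _ _ _ h.symm, map_zero, Finsupp.zero_apply]

theorem treeBasis_repr_self {n : ℕ} {i : ℤ} (x : TreeIndex n i) (t : TreeTensor V x)
    (q : ∀ j : Fin x.tree.r, Fin (Module.finrank k (V (x.tree.val j) (x.deg j)))) :
    (treeBasis hV n i).repr (treeIncl V x t) ⟨x, q⟩ =
      (Basis.piTensorProduct fun j => homBasis hV (x.tree.val j) (x.deg j)).repr t q := by
  classical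
  change (Basis.piTensorProduct fun j => homBasis hV (x.tree.val j) (x.deg j)).repr
    ((DirectSum.lof k (TreeIndex n i) (fun y => TreeTensor V y) x t) x) q = _
  rw [DirectSum.lof_apply]

theorem treeBasis_apply {n : ℕ} {i : ℤ} (b : TreeBasisIndex V n i) : treeBasis hV n i b =
    treeIncl V b.1 (PiTensorProduct.tprod k fun j => homBasis hV _ _ (b.2 j)) := by
  refine (treeBasis hV n i).ext_elem fun c => ?_
  rw [Module.Basis.repr_self]
  obtain ⟨x, q⟩ := b
  obtain ⟨y, q'⟩ := c
  by_cases h : x = y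
  · subst h
    rw [treeBasis_repr_self, ← Basis.piTensorProduct_apply, Module.Basis.repr_self]
    classical
    rw [Finsupp.single_apply, Finsupp.single_apply]
    exact if_congr ⟨fun h => sigma_mk_injective h, fun h => congrArg (Sigma.mk x) h⟩ rfl rfl
  · rw [treeBasis_repr_of_ne hV h, Finsupp.single_eq_of_ne fun h' => h (congrArg Sigma.fst h').symm]

/-- The coordinates of a homogeneous element, with an identification of its arity. -/
noncomputable def coeffAt {m : ℕ} {i : ℤ} (v : (V m i : Type w)) {m' : ℕ} (b : BasisIndex V m') : k :=
  open Classical in if h : m' = m then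
    (totalBasis hV m).repr (DirectSum.lof k ℤ (fun i => (V m i : Type w)) i v) (h ▸ b) else 0

theorem coeffAt_self {m : ℕ} {i : ℤ} (v : (V m i : Type w)) (l : Fin (Module.finrank k (V m i))) :
    coeffAt hV v (⟨i, l⟩ : BasisIndex V m) = (homBasis hV m i).repr v l := by
  classical
  rw [coeffAt, dif_pos rfl]
  change (homBasis hV m i).repr ((DirectSum.lof k ℤ (fun i => (V m i : Type w)) i v) i) l = _
  rw [DirectSum.lof_apply]

theorem coeffAt_homBasis {m m' : ℕ} (h : m' = m) (φ : Fin m ≃ Fin m') (b : BasisIndex V m)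
    (b' : BasisIndex V m') :
    coeffAt hV ((V m' b'.1).ρ ((finCongr h).trans φ : Perm (Fin m'))⁻¹ (homBasis hV m' b'.1 b'.2)) b =
      equivMatrix hV φ b b' := by
  classical
  subst h
  rw [coeffAt, dif_pos rfl, equivMatrix_perm, repMatrix, totalBasis_apply, DirectSum.lmap_lof]
  rfl

theorem treeBasis_repr_tprod {n : ℕ} {i : ℤ} {x y : TreeIndex n i} (h : y = x)
    (hr : x.tree.r = y.tree.r) (a : ∀ j : Fin y.tree.r, (V (y.tree.val j) (y.deg j) : Type w))
    (q : ∀ j : Fin x.tree.r, Fin (Module.finrank k (V (x.tree.val j) (x.deg j)))) :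
    (treeBasis hV n i).repr (treeIncl V y (PiTensorProduct.tprod k a)) ⟨x, q⟩ =
      ∏ j : Fin x.tree.r, coeffAt hV (a (Fin.cast hr j))
        (⟨x.deg j, q j⟩ : BasisIndex V (x.tree.val j)) := by
  subst h
  rw [treeBasis_repr_self, Basis.piTensorProduct_repr_tprod_apply]
  exact Finset.prod_congr rfl fun j _ => (coeffAt_self hV _ _).symm

omit hV in
theorem _root_.TreeIndex.reorder_relabel_eq_iff {n : ℕ} {i : ℤ} (x : TreeIndex n i)
    (e : Perm (Fin x.tree.r)) (τ : ∀ j, Perm (Fin (x.tree.val (e j)))) (σ : Perm (Fin n)) :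
    (x.reorder e τ).relabel σ = x ↔
      (x.tree.reorder e τ).relabel σ = x.tree ∧ ∀ j, x.deg (e j) = x.deg j := by
  obtain ⟨T, d, hd⟩ := x
  rw [TreeIndex.mk.injEq]
  refine and_congr_right fun _ => ⟨fun h j => ?_, fun h => heq_of_eq (funext h)⟩
  exact congrFun (eq_of_heq h) j

/-- The permutation `α` of the flags is an automorphism of a tree that permutes the legs by `σ`. -/
def _root_.StableTree.IsAut {n : ℕ} (T : StableTree n) (σ : Perm (Fin n))
    (α : Perm (Σ j, Fin (T.val j))) : Prop :=
  (∀ y, T.inv (α y) = α (T.inv y)) ∧ ∀ a, α (T.leg a) = T.leg (σ⁻¹ a)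

-- A basis vector over `x` is moved to the summand of the reordered and relabelled tree, so its
-- diagonal coefficient vanishes unless that tree is `x`, that is, unless `τ` comes from an
-- automorphism. If the degrees are not preserved, the matrix entries on the right vanish as well.
open Classical in
theorem sum_treeBasis_repr {n : ℕ} {i : ℤ} (x : TreeIndex n i)
    (q : ∀ j : Fin x.tree.r, Fin (Module.finrank k (V (x.tree.val j) (x.deg j))))
    (e : Perm (Fin x.tree.r)) (σ : Perm (Fin n)) :
    ∑ τ : ∀ j, Perm (Fin (x.tree.val (e j))), (treeBasis hV n i).repr
      (treeIncl V ((x.reorder e τ).relabel σ) (PiTensorProduct.tprod k fun j : Fin x.tree.r =>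
        ((V (x.tree.val (e j)) (x.deg (e j))).ρ (τ j)⁻¹ (homBasis hV _ _ (q (e j))) :
          (V (x.tree.val (e j)) (x.deg (e j)) : Type w)))) ⟨x, q⟩ =
    ∑ α : FlagPerm e x.tree.val, if x.tree.IsAut σ α.perm then
      ∏ j, equivMatrix hV (α.fiber j) (⟨x.deg j, q j⟩ : BasisIndex V _)
        (⟨x.deg (e j), q (e j)⟩ : BasisIndex V _) else 0 := by
  symm
  refine Fintype.sum_of_injective FlagPerm.fiberPerm FlagPerm.fiberPerm_injective _ _
    (fun τ hτ => ?_) fun α => ?_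
  · refine treeBasis_repr_of_ne hV (fun h => hτ ?_) _ _
    rw [TreeIndex.reorder_relabel_eq_iff, StableTree.reorder_relabel_eq_iff] at h
    obtain ⟨⟨α, hα, -⟩, -⟩ := h
    exact ⟨α, hα⟩
  · split_ifs with hα
    · by_cases hd : ∀ j, x.deg (e j) = x.deg j
      · have hx : (x.reorder e α.fiberPerm).relabel σ = x :=
          (x.reorder_relabel_eq_iff e α.fiberPerm σ).2
            ⟨(x.tree.reorder_relabel_eq_iff e α.fiberPerm σ).2 ⟨α, rfl, hα⟩, hd⟩
        refine Eq.trans ?_ (treeBasis_repr_tprod hV hx rfl _ q).symm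
        exact Finset.prod_congr rfl fun j _ => (coeffAt_homBasis hV (α.val_apply j) (α.fiber j)
          ⟨x.deg j, q j⟩ ⟨x.deg (e j), q (e j)⟩).symm
      · have hx : (x.reorder e α.fiberPerm).relabel σ ≠ x := fun h =>
          hd ((x.reorder_relabel_eq_iff e α.fiberPerm σ).1 h).2
        rw [treeBasis_repr_of_ne hV hx]
        push Not at hd
        obtain ⟨j, hj⟩ := hd
        exact Finset.prod_eq_zero (Finset.mem_univ j) (equivMatrix_of_ne hV _ (Ne.symm hj))
    · refine (treeBasis_repr_of_ne hV (fun h => hα ?_) _ _).symm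
      rw [TreeIndex.reorder_relabel_eq_iff, StableTree.reorder_relabel_eq_iff] at h
      obtain ⟨⟨β, hβ, h⟩, -⟩ := h
      obtain rfl := FlagPerm.fiberPerm_injective hβ
      exact h

end GradedCyclicModule

/-! ### The character of the sum over trees -/

namespace GradedCyclicModule

variable {k : Type u} [Field k] {V : GradedCyclicModule.{u, w} k}
variable (hV : V.IsFiniteDimensional)
include hV

-- By `trace_quotient` the trace on the quotient is that of relabelling after symmetrization on the
-- sum over ordered trees, where it is read off from the diagonal in `treeBasis`.
open Classical in
theorem trace_treeRep [CharZero k] (n : ℕ) (i : ℤ) [Fintype (TreeBasisIndex V n i)]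
    (σ : Perm (Fin n)) :
    LinearMap.trace k (TreeSpace V n i) (treeRep V n i σ) =
    ∑ b : TreeBasisIndex V n i, treeWeight k b.1.tree.val * ∑ e : Perm (Fin b.1.tree.r),
      (koszulSign e b.1.deg : k) * ∑ α : FlagPerm e b.1.tree.val,
        if b.1.tree.IsAut σ α.perm then
          ∏ j, equivMatrix hV (α.fiber j) (⟨b.1.deg j, b.2 j⟩ : BasisIndex V _)
            (⟨b.1.deg (e j), b.2 (e j)⟩ : BasisIndex V _) else 0 := by
  have hfin : Module.Finite k (⨁ x : TreeIndex n i, TreeTensor V x) :=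
    Module.Finite.of_basis (treeBasis hV n i)
  refine (trace_quotient (π := (treeRelations V n i).mkQ) (Submodule.mkQ_surjective _)
    (E := symmetrize V n i) (f := treeAct V n i σ) (g := treeRep V n i σ) (by
      rw [Submodule.ker_mkQ]; exact treeRelations_le_ker_symmetrize)
    (mkQ_comp_symmetrize V n i) rfl).trans ?_
  rw [LinearMap.trace_eq_matrix_trace k (treeBasis hV n i), Matrix.trace]
  refine Finset.sum_congr rfl fun b _ => ?_
  obtain ⟨x, q⟩ := b
  rw [Matrix.diag_apply, LinearMap.toMatrix_apply, LinearMap.comp_apply, treeBasis_apply,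
    symmetrize_treeIncl, map_smul, map_smul, Finsupp.smul_apply, smul_eq_mul, map_sum, map_sum,
    Finsupp.finsetSum_apply]
  congr 1
  refine Finset.sum_congr rfl fun e _ => ?_
  have h := sum_treeBasis_repr hV x q e σ
  refine Eq.trans ?_ (congrArg ((koszulSign e x.deg : k) * ·) h)
  dsimp only
  rw [map_sum, map_sum, Finsupp.finsetSum_apply, Finset.mul_sum]
  refine Finset.sum_congr rfl fun τ _ => ?_
  rw [map_smul, map_smul, Finsupp.smul_apply, smul_eq_mul, treeAct_incl]

-- Summing the traces over all degrees amounts to summing over decorated trees. For a fixed tree and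
-- automorphism, the sum over decorations is `sum_koszulSign_mul_prod_equivMatrix`.
open Classical in
theorem superTrace_freeOperad [CharZero k] (n : ℕ) [Fintype (StableTree n)] (σ : Perm (Fin n)) :
    V.freeOperad.superTrace n σ = ∑ T : StableTree n, treeWeight k T.val *
      ∑ e : Perm (Fin T.r), ∑ α : FlagPerm e T.val with T.IsAut σ α.perm,
        vertexWeight V.superChar (Sigma.fst : (Σ j, Fin (T.val j)) → Fin T.r) e α.perm := by
  have := hV.finite_basisIndex
  have := hV.finite_decoratedTree n
  have := hV.finite_treeBasisIndex n
  let : ∀ m, Fintype (BasisIndex V m) := fun m => Fintype.ofFinite _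
  let : ∀ i, Fintype (TreeBasisIndex V n i) := fun m => Fintype.ofFinite _
  let : ∀ T : StableTree n, Fintype (∀ j, BasisIndex V (T.val j)) := fun m => Fintype.ofFinite _
  rw [superTrace, finsum_fiber_eq_sum (fun p : DecoratedTree V n => DecoratedTree.degree p)
    (fun p => sgn k (DecoratedTree.degree p) * (treeWeight k p.1.val * ∑ e : Perm (Fin p.1.r),
      (koszulSign e (fun j => (p.2 j).1) : k) * ∑ α : FlagPerm e p.1.val,
        if p.1.IsAut σ α.perm then
          ∏ j, equivMatrix hV (α.fiber j) (p.2 j) (p.2 (e j)) else 0))]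
  · rw [Fintype.sum_sigma]
    refine Finset.sum_congr rfl fun T _ => ?_
    have h : ∀ (e : Perm (Fin T.r)) (α : FlagPerm e T.val),
        ∑ Q : ∀ j, BasisIndex V (T.val j), sgn k (∑ j, (Q j).1) *
          ((koszulSign e (fun j => (Q j).1) : k) *
          ∏ j, equivMatrix hV (α.fiber j) (Q j) (Q (e j))) =
        vertexWeight V.superChar (Sigma.fst : (Σ j, Fin (T.val j)) → Fin T.r) e α.perm :=
      fun e α => sum_koszulSign_mul_prod_equivMatrix hV (D := n)
        (fun j => ⟨T.val j, Finset.mem_Icc.2 ⟨T.stable j, T.val_le j⟩⟩) α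
    change ∑ Q : ∀ j, BasisIndex V (T.val j), sgn k (∑ j, (Q j).1) * (treeWeight k T.val *
      ∑ e : Perm (Fin T.r), (koszulSign e (fun j => (Q j).1) : k) * ∑ α : FlagPerm e T.val,
        if T.IsAut σ α.perm then ∏ j, equivMatrix hV (α.fiber j) (Q j) (Q (e j)) else 0) = _
    simp only [← h, Finset.sum_filter, Finset.mul_sum]
    refine (Finset.sum_comm (β := k)).trans ?_
    refine Finset.sum_congr rfl fun e _ => ?_
    refine (Finset.sum_comm (β := k)).trans ?_
    refine Finset.sum_congr rfl fun α _ => ?_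
    split_ifs
    · rw [Finset.mul_sum]
      refine Finset.sum_congr rfl fun Q _ => ?_
      ring
    · simp
  · intro i
    have h1 := trace_treeRep hV n i σ
    change sgn k i * LinearMap.trace k (TreeSpace V n i) (treeRep V n i σ) = _
    rw [h1, Finset.mul_sum]
    refine Fintype.sum_equiv (treeBasisIndexEquiv V n i) _ _ fun b => ?_
    rw [(treeBasisIndexEquiv V n i b).2]
    rfl

theorem freeOperad_isFiniteDimensional : V.freeOperad.IsFiniteDimensional := by
  intro n
  classical
  have := hV.finite_decoratedTree n
  have := hV.finite_treeBasisIndex n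
  have hM : Module.Finite k (⨁ i : ℤ, ⨁ x : TreeIndex n i, TreeTensor V x) := by
    have : Finite (Σ i, TreeBasisIndex V n i) := by
      refine Finite.of_injective (β := DecoratedTree V n)
        (fun b => (treeBasisIndexEquiv V n b.1 b.2).1) ?_
      rintro ⟨i, b⟩ ⟨i', b'⟩ h
      obtain rfl : i = i' := by
        rw [← (treeBasisIndexEquiv V n i b).2, ← (treeBasisIndexEquiv V n i' b').2]
        exact congrArg _ h
      exact congrArg (Sigma.mk i) ((treeBasisIndexEquiv V n i).injective (Subtype.ext h))
    exact Module.Finite.of_basis (DFinsupp.basis fun i => treeBasis hV n i :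
      Module.Basis _ k (⨁ i : ℤ, ⨁ x : TreeIndex n i, TreeTensor V x))
  exact Module.Finite.of_surjective (DirectSum.lmap fun i => (treeRelations V n i).mkQ)
    ((DirectSum.lmap_surjective _).2 fun i => Submodule.mkQ_surjective _)

end GradedCyclicModule

/-! ### The cycle index as a product over cycles -/

section CycleIndex

theorem cycleType_permCongr {X Y : Type} [Fintype X] [Fintype Y] [DecidableEq X] [DecidableEq Y]
    (θ : X ≃ Y) (α : Perm X) : (θ.permCongr α).cycleType = α.cycleType := by
  rw [← Perm.cycleType_extendDomain (θ.trans (Equiv.subtypeUnivEquiv (p := fun _ : Y => True)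
    fun _ => trivial).symm)]
  congr 1

theorem cycleType_sumCongr {X Y : Type} [Fintype X] [Fintype Y] [DecidableEq X] [DecidableEq Y]
    (α : Perm X) (β : Perm Y) :
    (Perm.sumCongr α β).cycleType = α.cycleType + β.cycleType := by
  classical
  let f : X ≃ {z : X ⊕ Y // z ∈ Set.range Sum.inl} := Equiv.ofInjective _ Sum.inl_injective
  let g : Y ≃ {z : X ⊕ Y // z ∈ Set.range Sum.inr} := Equiv.ofInjective _ Sum.inr_injective
  have hf : α.extendDomain f = Perm.sumCongr α 1 := by
    ext z
    rcases z with x | y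
    · exact Perm.extendDomain_apply_image α f x
    · rw [Perm.extendDomain_apply_not_subtype _ _ (by simp)]
      rfl
  have hg : β.extendDomain g = Perm.sumCongr 1 β := by
    ext z
    rcases z with x | y
    · rw [Perm.extendDomain_apply_not_subtype _ _ (by simp)]
      rfl
    · exact Perm.extendDomain_apply_image β g y
  have h : Perm.sumCongr α β = α.extendDomain f * β.extendDomain g := by
    rw [hf, hg, Perm.sumCongr_mul, mul_one, one_mul]
  have hd : (α.extendDomain f).Disjoint (β.extendDomain g) := by
    rw [hf, hg]
    rintro (x | y)
    · exact Or.inr rfl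
    · exact Or.inl rfl
  rw [h, hd.cycleType_mul, Perm.cycleType_extendDomain, Perm.cycleType_extendDomain]

/-- `cycleType` omits fixed points, and the partition restores them as parts equal to one. Both
sides are multiplicative, so rotations suffice; the rotation of one point is separate because its
cycle type is empty. -/
theorem prod_parts_eq_cycProd {M : Type*} [CommMonoid M] (g : ℕ → M) (X : Type) [Fintype X]
    [DecidableEq X] (α : Perm X) :
    (α.partition.parts.map g).prod = cycProd α fun x => g (per α x) := by
  rw [Perm.parts_partition, ← Perm.sum_cycleType]
  refine perm_cycle_induction (P := fun X _ α => ∀ [DecidableEq X],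
    ((α.cycleType + Multiset.replicate (Fintype.card X - α.cycleType.sum) 1).map g).prod =
      cycProd α fun x => g (per α x)) ?_ ?_ ?_ ?_ X α
  · intro X Y _ _ θ α ih _
    classical
    rw [cycProd_permCongr θ α fun y => by rw [per_apply], cycleType_permCongr,
      ← Fintype.card_congr θ, ih]
    exact cycProd_congr fun x => by
      rw [per_of_injective (α := α) θ.injective fun x => by simp]
  · intro X _ _ α _
    rw [cycProd_of_isEmpty, Subsingleton.elim α 1]
    simp
  · intro X Y _ _ α β iha ihb _
    classical
    have h := cycleType_sumCongr α β
    have ha := Perm.sum_cycleType_le α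
    have hb := Perm.sum_cycleType_le β
    rw [cycProd_sumCongr α β fun y => by rw [per_apply],
      cycProd_congr fun x => by rw [per_of_injective (α := α) (β := Perm.sumCongr α β)
        Sum.inl_injective fun x => by simp],
      cycProd_congr (α := β) fun x => by rw [per_of_injective (α := β) (β := Perm.sumCongr α β)
        Sum.inr_injective fun x => by simp], ← iha, ← ihb,
      show (Perm.sumCongr α β).cycleType = α.cycleType + β.cycleType by convert h,
      Multiset.sum_add, Fintype.card_sum,
      show Fintype.card X + Fintype.card Y - (α.cycleType.sum + β.cycleType.sum) =
        (Fintype.card X - α.cycleType.sum) + (Fintype.card Y - β.cycleType.sum) by omega,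
      Multiset.replicate_add]
    simp only [Multiset.map_add, Multiset.prod_add]
    exact mul_mul_mul_comm _ _ _ _
  · intro a hD
    obtain rfl : hD = instDecidableEqFin (a + 1) := Subsingleton.elim _ _
    rw [cycProd_finRotate a fun y => by rw [per_apply], per_finRotate]
    cases a with
    | zero =>
      rw [show finRotate (0 + 1) = 1 from Subsingleton.elim (α := Perm (Fin 1)) _ _]
      simp
    | succ a => simp [cycleType_finRotate]

variable {k : Type u} [Field k]

theorem cycleIndex_eq {n : ℕ} (σ : Perm (Fin n)) :
    (SymFun.cycleIndex σ : SymFun k) = cycProd σ fun x => pw k (per σ x) := by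
  rw [SymFun.cycleIndex]
  refine Eq.trans ?_ (prod_parts_eq_cycProd (pw k) (Fin n) σ)
  congr!

theorem per_inv {X : Type} [Fintype X] (α : Perm X) (x : X) : per α⁻¹ x = per α x := by
  have h : ∀ (α : Perm X), per α x ∣ per α⁻¹ x := by
    intro α
    refine IsPeriodicPt.minimalPeriod_dvd ?_
    have h1 : (⇑α⁻¹)^[per α⁻¹ x] x = x := iterate_minimalPeriod
    change α^[per α⁻¹ x] x = x
    rw [Perm.iterate_eq_pow] at h1 ⊢
    rw [inv_pow, Perm.inv_eq_iff_eq] at h1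
    exact h1.symm
  refine Nat.dvd_antisymm ?_ (h α)
  have := h α⁻¹
  rwa [inv_inv] at this

/-- Makes the passage to the dual character `superChar` harmless: inverting all permutations does
not change the characteristic. -/
theorem cycleIndex_inv {n : ℕ} (σ : Perm (Fin n)) :
    (SymFun.cycleIndex σ⁻¹ : SymFun k) = SymFun.cycleIndex σ := by
  rw [cycleIndex_eq, cycleIndex_eq, cycProd_congr fun x => by rw [per_inv],
    cycProd_inv σ fun y => by rw [per_apply]]

theorem cycleIndex_mem_ordIdeal {n : ℕ} (σ : Perm (Fin n)) :
    (SymFun.cycleIndex σ : SymFun k) ∈ SymFun.ordIdeal k n := by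
  have h := cycProd_pw_mem_ordIdeal (k := k) σ (P := fun _ => True) fun _ => Iff.rfl
  rw [cycleIndex_eq]
  simpa using h

end CycleIndex

/-! ### Automorphisms and labellings of the legs -/

section Automorphisms

variable {k : Type u} [Field k]

-- An automorphism of the tree permutes the legs in exactly one way, and the cycles of this
-- permutation are the cycles of legs counted by `legProd`.
open Classical in
theorem sum_cycleIndex_isAut {n : ℕ} (T : StableTree n) (α : Perm (Σ j, Fin (T.val j))) :
    ∑ σ : Perm (Fin n) with T.IsAut σ α, (SymFun.cycleIndex σ : SymFun k) =
      if ∀ y, T.inv (α y) = α (T.inv y) then legProd k T.inv α else 0 := by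
  split_ifs with h
  · have h1 : ∀ a, ∃ b, T.leg b = α (T.leg a) := fun a =>
      (T.isLeg_iff _).1 ((leg_apply_iff h _).2 ((T.isLeg_iff _).2 ⟨a, rfl⟩))
    choose s hs using h1
    have hsi : Function.Injective s := fun a b hab => by
      refine T.leg_injective (α.injective ?_)
      rw [← hs, ← hs, hab]
    let τ : Perm (Fin n) := Equiv.ofBijective s (Finite.injective_iff_bijective.1 hsi)
    have hτ : ∀ a, T.leg (τ a) = α (T.leg a) := hs
    rw [Finset.sum_eq_single_of_mem τ⁻¹]
    · rw [cycleIndex_inv, cycleIndex_eq, legProd,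
        cycProd_of_injective (α := τ) T.leg_injective hτ]
      · refine cycProd_congr fun a => ?_
        rw [if_pos ((T.isLeg_iff _).2 ⟨a, rfl⟩), per_of_injective T.leg_injective hτ]
      · intro y
        rw [per_apply, leg_apply_iff h]
      · intro y hy
        exact if_neg fun h' => hy ((T.isLeg_iff y).1 h')
    · rw [Finset.mem_filter]
      exact ⟨Finset.mem_univ _, h, fun a => by rw [inv_inv, hτ]⟩
    · intro σ hσ hne
      rw [Finset.mem_filter] at hσ
      refine absurd ?_ hne
      rw [eq_inv_iff_mul_eq_one, mul_eq_one_iff_inv_eq]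
      ext a
      exact congrArg Fin.val (T.leg_injective ((hσ.2.2 a).symm.trans (hτ a).symm))
  · exact Finset.sum_eq_zero fun σ hσ => absurd (Finset.mem_filter.1 hσ).2.1 h

-- An involution with `n` fixed flags admits `n !` labellings of its legs.
open Classical in
theorem sum_treeStructure {A : Type*} [AddCommMonoid A] {n r : ℕ} (val : Fin r → ℕ)
    [Fintype (TreeStructure n val)] (G : Perm (Flags val) → A) :
    ∑ p : TreeStructure n val, G p.1.1 = n.factorial • ∑ inv : Perm (Flags val) with
      IsTree (Sigma.fst : Flags val → Fin r) inv ∧ Nat.card {x // inv x = x} = n, G inv := by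
  have hcard : ∀ inv : Perm (Flags val),
      (Finset.univ.filter fun p : TreeStructure n val => p.1.1 = inv).card =
        if IsTree (Sigma.fst : Flags val → Fin r) inv ∧ Nat.card {x // inv x = x} = n
        then n.factorial else 0 := by
    intro inv
    split_ifs with h
    · obtain ⟨h, hn⟩ := h
      have e : {p : TreeStructure n val // p.1.1 = inv} ≃ (Fin n ≃ {x // inv x = x}) :=
        { toFun p := Equiv.ofBijective
            (fun a => ⟨p.1.1.2 a, by have := (p.1.2.2.2 (p.1.1.2 a)).2 ⟨a, rfl⟩; rwa [p.2] at this⟩)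
            ⟨fun a b hab => p.1.2.2.1 (congrArg Subtype.val hab), fun x => by
              obtain ⟨a, ha⟩ := (p.1.2.2.2 x.1).1 (by rw [p.2]; exact x.2)
              exact ⟨a, Subtype.ext ha⟩⟩
          invFun φ := ⟨⟨(inv, fun a => φ a), h, Subtype.val_injective.comp φ.injective, fun x =>
            ⟨fun hx => ⟨φ.symm ⟨x, hx⟩, by simp⟩, fun ⟨a, ha⟩ => ha ▸ (φ a).2⟩⟩, rfl⟩
          left_inv := by
            rintro ⟨⟨⟨inv', leg⟩, hp⟩, rfl⟩
            rfl
          right_inv φ := Equiv.ext fun a => rfl }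
      rw [← Fintype.card_subtype, Fintype.card_congr e,
        Fintype.card_equiv (Fintype.equivOfCardEq (by rw [Fintype.card_fin, ← hn, Nat.card_eq_fintype_card])),
        Fintype.card_fin]
    · rw [Finset.card_eq_zero, Finset.filter_eq_empty_iff]
      rintro p - rfl
      refine h ⟨p.2.1, ?_⟩
      have hb : Function.Bijective (fun a => ⟨p.1.2 a, (p.2.2.2 _).2 ⟨a, rfl⟩⟩ :
          Fin n → {x // p.1.1 x = x}) := by
        refine ⟨fun a b h => p.2.2.1 (congrArg Subtype.val h), ?_⟩
        rintro ⟨x, hx⟩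
        obtain ⟨a, rfl⟩ := (p.2.2.2 x).1 hx
        exact ⟨a, rfl⟩
      rw [← Nat.card_congr (Equiv.ofBijective _ hb), Nat.card_fin]
  rw [← Finset.sum_fiberwise Finset.univ (fun p : TreeStructure n val => p.1.1), Finset.smul_sum,
    Finset.sum_filter]
  refine Finset.sum_congr rfl fun inv _ => ?_
  rw [Finset.sum_congr rfl fun p hp => by rw [(Finset.mem_filter.1 hp).2], Finset.sum_const, hcard]
  split_ifs
  · rfl
  · rw [zero_smul]

end Automorphisms

/-! ### Characteristics as sums over trees -/

namespace GradedCyclicModule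

variable {k : Type u} [Field k]

theorem chGr_eq {V : GradedCyclicModule.{u, w} k} (hV : V.IsFiniteDimensional) (n : ℕ) :
    chGr (V n) = (n.factorial : k)⁻¹ •
      ∑ σ : Perm (Fin n), V.superTrace n σ • (SymFun.cycleIndex σ : SymFun k) := by
  classical
  have := hV.finite_basisIndex n
  let _ : Fintype (BasisIndex V n) := Fintype.ofFinite _
  let S : Finset ℤ := Finset.univ.image fun b : BasisIndex V n => b.1
  have h0 : ∀ i, i ∉ S → ∀ f : V n i →ₗ[k] V n i, LinearMap.trace k (V n i) f = 0 := by
    intro i hi f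
    have := hV.finite n i
    have h1 : Module.finrank k (V n i) = 0 := by
      by_contra h
      exact hi (Finset.mem_image.2 ⟨⟨i, ⟨0, Nat.pos_of_ne_zero h⟩⟩, Finset.mem_univ _, rfl⟩)
    have := Module.finrank_zero_iff.1 h1
    rw [Subsingleton.elim f 0, map_zero]
  have h1 : chGr (V n) = ∑ i ∈ S, (i.negOnePow : ℤ) • chRep (V n i) := by
    refine finsum_eq_sum_of_support_subset _ fun i hi => ?_
    by_contra h
    refine hi ?_
    simp only [chRep, h0 i h, zero_smul, Finset.sum_const_zero, smul_zero]
  have h2 : ∀ σ, V.superTrace n σ = ∑ i ∈ S, sgn k i * LinearMap.trace k (V n i) ((V n i).ρ σ) := by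
    intro σ
    refine finsum_eq_sum_of_support_subset _ fun i hi => ?_
    by_contra h
    refine hi ?_
    simp only [h0 i h, mul_zero]
  rw [h1]
  simp only [h2, Finset.sum_smul]
  rw [Finset.sum_comm, Finset.smul_sum]
  refine Finset.sum_congr rfl fun i _ => ?_
  simp only [chRep, mul_smul, ← Finset.smul_sum]
  rw [smul_comm, sgn, Int.cast_smul_eq_zsmul, smul_comm]

theorem chGr_mem_ordIdeal {V : GradedCyclicModule.{u, w} k} (hV : V.IsFiniteDimensional) (n : ℕ) :
    chGr (V n) ∈ SymFun.ordIdeal k n := by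
  rw [chGr_eq hV]
  exact smul_mem_ordIdeal _ (Ideal.sum_mem _ fun σ _ =>
    smul_mem_ordIdeal _ (cycleIndex_mem_ordIdeal σ))

theorem Ch_sub_mem_ordIdeal {V : GradedCyclicModule.{u, w} k} (hV : V.IsFiniteDimensional) (N : ℕ) :
    V.Ch - ∑ n ∈ Finset.Icc 1 N, chGr (V n) ∈ SymFun.ordIdeal k (N + 1) := by
  rw [SymFun.mem_ordIdeal]
  intro d hd
  rw [map_sub, map_sum, sub_eq_zero]
  change ∑ᶠ n ∈ Set.Ici 1, MvPowerSeries.coeff d (chGr (V n)) = _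
  refine finsum_mem_eq_sum_of_inter_support_eq _ ?_
  ext n
  simp only [Set.mem_inter_iff, Set.mem_Ici, Function.mem_support, Finset.coe_Icc, Set.mem_Icc]
  refine ⟨fun ⟨h1, h2⟩ => ⟨⟨h1, ?_⟩, h2⟩, fun ⟨h1, h2⟩ => ⟨h1.1, h2⟩⟩
  by_contra h
  exact h2 (SymFun.mem_ordIdeal.1 (chGr_mem_ordIdeal hV n) d (by omega))

/-- The arities at most two drop out by `h2`, and reindexing by inversion exchanges the supertrace
with the dual character. -/
theorem Ch_sub_truncCh_mem {V : GradedCyclicModule.{u, w} k} (hV : V.IsFiniteDimensional)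
    (h2 : ∀ n ≤ 2, ∀ i, Subsingleton (V n i)) (N : ℕ) :
    V.Ch - truncCh V.superChar N ∈ SymFun.ordIdeal k (N + 1) := by
  have h := Ch_sub_mem_ordIdeal hV N
  suffices h' : ∑ n ∈ Finset.Icc 1 N, chGr (V n) = truncCh V.superChar N by rwa [h'] at h
  rw [truncCh]
  symm
  refine Finset.sum_subset_zero_on_sdiff (Finset.Icc_subset_Icc_left (by norm_num)) ?_ ?_
  · intro n hn
    simp only [Finset.mem_sdiff, Finset.mem_Icc, not_and, not_le] at hn
    have hn2 : n ≤ 2 := by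
      by_contra h
      have := hn.2 (by omega)
      omega
    rw [chGr_eq hV]
    have : ∀ σ, V.superTrace n σ = 0 := by
      intro σ
      refine (finsum_congr fun i => ?_).trans finsum_zero
      have := h2 n hn2 i
      rw [Subsingleton.elim ((V n i).ρ σ) 0, map_zero, mul_zero]
    simp [this]
  · intro n _
    rw [chGr_eq hV]
    congr 1
    refine Fintype.sum_equiv (Equiv.inv _) _ _ fun ρ => ?_
    rw [Equiv.inv_apply, cycleIndex_inv, cycleIndex_eq, superChar]

section

variable (χ : ∀ m : ℕ, Perm (Fin m) → k)

open Classical in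
/-- The part of `graftSum` coming from the trees with `n` legs. -/
noncomputable def graftPart (n : ℕ) {W : Type} [Fintype W] (e : Perm W) (F : Type) [Fintype F]
    (vt : F → W) (α : Perm F) : SymFun k :=
  ∑ inv : Perm F with (IsTree vt inv ∧ (∀ x, inv (α x) = α (inv x)) ∧ Good vt inv ∅) ∧
    Nat.card {x // inv x = x} = n, vertexWeight χ vt e α • legProd k inv α

theorem graftSum_sub_sum_graftPart_mem (N : ℕ) {W : Type} [Fintype W] (e : Perm W) (F : Type)
    [Fintype F] (vt : F → W) (α : Perm F) (hF : 3 * Fintype.card W ≤ Fintype.card F) :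
    ∑ n ∈ Finset.Icc 1 N, graftPart χ n e F vt α - graftSum χ ∅ e F vt α ∈
      SymFun.ordIdeal k (N + 1) := by
  classical
  have h : ∑ n ∈ Finset.Icc 1 N, graftPart χ n e F vt α = ∑ inv : Perm F with
      (IsTree vt inv ∧ (∀ x, inv (α x) = α (inv x)) ∧ Good vt inv ∅) ∧
        Nat.card {x // inv x = x} ∈ Finset.Icc 1 N, vertexWeight χ vt e α • legProd k inv α := by
    unfold graftPart
    simp only [Finset.sum_filter]
    rw [Finset.sum_comm]
    refine Finset.sum_congr rfl fun inv _ => ?_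
    by_cases h1 : IsTree vt inv ∧ (∀ x, inv (α x) = α (inv x)) ∧ Good vt inv ∅
    · simp only [h1, implies_true, true_and, and_true, Finset.sum_ite_eq]
    · simp [h1]
  rw [h, graftSum, ← Finset.filter_filter]
  rw [← Finset.sum_filter_add_sum_filter_not (Finset.univ.filter fun inv : Perm F =>
    IsTree vt inv ∧ (∀ x, inv (α x) = α (inv x)) ∧ Good vt inv ∅)
    (fun inv => Nat.card {x // inv x = x} ∈ Finset.Icc 1 N), sub_add_cancel_left]
  refine (SymFun.ordIdeal k (N + 1)).neg_mem (Ideal.sum_mem _ fun inv hinv =>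
    smul_mem_ordIdeal _ ?_)
  simp only [Finset.mem_filter, Finset.mem_univ, true_and, Finset.mem_Icc] at hinv
  have h1 := hinv.1.1.card_legs hF
  exact SymFun.ordIdeal_mono (by omega) (legProd_mem_ordIdeal hinv.1.2.1)

end

open Classical in
/-- The contribution of a tree with an automorphism of the flags. -/
noncomputable def autTerm (χ : ∀ m : ℕ, Perm (Fin m) → k) {W F : Type} [Fintype W] [Fintype F]
    (vt : F → W) (e : Perm W) (inv α : Perm F) : SymFun k :=
  if ∀ y, inv (α y) = α (inv y) then vertexWeight χ vt e α • legProd k inv α else 0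

-- The `n !` labellings cancel the prefactor of the characteristic, and `treeWeight` splits into the
-- `1 / r !` of the sum over permutations of the vertices and the factorials of the valences in
-- `sumOver`.
open Classical in
theorem sum_treeStructure_autTerm [CharZero k] (χ : ∀ m : ℕ, Perm (Fin m) → k) (n D r : ℕ)
    [∀ val : Fin r → Finset.Icc 3 D, Fintype (TreeStructure n fun j => (val j : ℕ))] :
    (n.factorial : k)⁻¹ • ∑ val : Fin r → Finset.Icc 3 D,
      ∑ p : TreeStructure n fun j => (val j : ℕ), treeWeight k (fun j => (val j : ℕ)) •
        ∑ e : Perm (Fin r), ∑ α : FlagPerm e fun j => (val j : ℕ),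
          autTerm χ Sigma.fst e p.1.1 α.perm =
    (r.factorial : k)⁻¹ • ∑ e : Perm (Fin r), sumOver k D e fun F _ vt α =>
      graftPart χ n e F vt α := by
  have hn : (n.factorial : k) ≠ 0 := Nat.cast_ne_zero.2 (Nat.factorial_ne_zero _)
  unfold sumOver
  rw [Finset.sum_comm, Finset.smul_sum, Finset.smul_sum]
  refine Finset.sum_congr (by ext; simp) fun val _ => ?_
  refine (congrArg ((n.factorial : k)⁻¹ • ·) (sum_treeStructure (n := n) (fun j => (val j : ℕ))
    (fun inv => treeWeight k (fun j => (val j : ℕ)) • ∑ e : Perm (Fin r),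
      ∑ α : FlagPerm e (fun j => (val j : ℕ)), autTerm χ Sigma.fst e inv α.perm))).trans ?_
  dsimp only
  rw [← Nat.cast_smul_eq_nsmul k, smul_smul, inv_mul_cancel₀ hn, one_smul, ← Finset.smul_sum,
    treeWeight, mul_smul]
  congr 1
  rw [← Finset.smul_sum]
  congr 1
  rw [Finset.sum_comm]
  refine Finset.sum_congr rfl fun e _ => ?_
  rw [Finset.sum_comm]
  refine Finset.sum_congr rfl fun α _ => ?_
  rw [graftPart, Finset.sum_filter, Finset.sum_filter]
  refine Finset.sum_congr (by ext; simp) fun inv _ => ?_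
  have hg : Good (Sigma.fst : Flags (fun j => (val j : ℕ)) → Fin r) inv ∅ := fun s hs => hs.elim
  unfold autTerm
  by_cases a1 : IsTree (Sigma.fst : Flags (fun j => (val j : ℕ)) → Fin r) inv <;>
  by_cases a2 : ∀ y, inv (α.perm y) = α.perm (inv y) <;>
  by_cases a3 : Nat.card {x // inv x = x} = n <;> simp [a1, a2, hg]

-- After exchanging the sums, the sum over `σ` for a fixed automorphism collapses by
-- `sum_cycleIndex_isAut`.
open Classical in
theorem sum_superTrace_smul_cycleIndex [CharZero k] {V : GradedCyclicModule.{u, w} k}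
    (hV : V.IsFiniteDimensional) (n : ℕ) [Fintype (StableTree n)] :
    ∑ σ : Perm (Fin n), V.freeOperad.superTrace n σ • (SymFun.cycleIndex σ : SymFun k) =
      ∑ T : StableTree n, treeWeight k T.val • ∑ e : Perm (Fin T.r), ∑ α : FlagPerm e T.val,
        autTerm V.superChar (Sigma.fst : (Σ j, Fin (T.val j)) → Fin T.r) e T.inv α.perm := by
  simp only [superTrace_freeOperad hV, Finset.sum_smul]
  rw [Finset.sum_comm]
  refine Finset.sum_congr rfl fun T _ => ?_
  simp only [mul_smul, ← Finset.smul_sum]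
  congr 1
  simp only [Finset.sum_smul, Finset.sum_filter]
  rw [Finset.sum_comm]
  refine Finset.sum_congr rfl fun e _ => ?_
  rw [Finset.sum_comm]
  refine Finset.sum_congr rfl fun α _ => ?_
  have h := sum_cycleIndex_isAut (k := k) T α.perm
  rw [Finset.sum_filter] at h
  have h2 := congrArg (vertexWeight V.superChar
    (Sigma.fst : (Σ j, Fin (T.val j)) → Fin T.r) e α.perm • ·) h
  simp only [Finset.smul_sum, smul_ite, smul_zero] at h2
  rw [autTerm]
  refine Eq.trans (Finset.sum_congr rfl fun σ _ => ?_) (h2.trans ?_)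
  · split_ifs <;> simp
  · split_ifs <;> rfl

theorem chGr_freeOperad [CharZero k] {V : GradedCyclicModule.{u, w} k} (hV : V.IsFiniteDimensional)
    {n R D : ℕ} (hR : n ≤ R) (hD : n ≤ D) :
    chGr (V.freeOperad n) = ∑ r ∈ Finset.range (R + 1), (r.factorial : k)⁻¹ •
      ∑ e : Perm (Fin r), sumOver k D e fun F _ vt α => graftPart V.superChar n e F vt α := by
  classical
  let _ : Fintype (StableTree n) := Fintype.ofFinite _
  let _ : ∀ (r : ℕ) (val : Fin r → Finset.Icc 3 D),
    Fintype (TreeStructure n fun j => (val j : ℕ)) := fun _ _ => Fintype.ofFinite _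
  rw [chGr_eq (freeOperad_isFiniteDimensional hV), sum_superTrace_smul_cycleIndex hV,
    ← (Equiv.ofBijective _ (StableTree.toTree_bijective hR hD)).sum_comp, Fintype.sum_sigma,
    Finset.smul_sum, Finset.sum_range]
  refine Finset.sum_congr rfl fun r _ => ?_
  rw [Fintype.sum_sigma]
  refine Eq.trans ?_ (sum_treeStructure_autTerm V.superChar n D r)
  rfl

/-- With both bounds equal to `N`, all trees with at most `N` legs are captured; the other trees in
`treeCh` have more than `N` legs and hence order at least `N + 1`. -/
theorem Ch_freeOperad_sub_treeCh_mem [CharZero k] {V : GradedCyclicModule.{u, w} k}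
    (hV : V.IsFiniteDimensional) (N : ℕ) :
    V.freeOperad.Ch - treeCh V.superChar N N ∈ SymFun.ordIdeal k (N + 1) := by
  classical
  have h := Ch_sub_mem_ordIdeal (freeOperad_isFiniteDimensional hV) N
  have h1 : ∑ n ∈ Finset.Icc 1 N, chGr (V.freeOperad n) = ∑ r ∈ Finset.range (N + 1),
      (r.factorial : k)⁻¹ • ∑ e : Perm (Fin r), sumOver k N e fun F _ vt α =>
        ∑ n ∈ Finset.Icc 1 N, graftPart V.superChar n e F vt α := by
    rw [Finset.sum_congr rfl fun n hn => chGr_freeOperad hV (Finset.mem_Icc.1 hn).2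
      (Finset.mem_Icc.1 hn).2, Finset.sum_comm]
    refine Finset.sum_congr rfl fun r _ => ?_
    rw [← Finset.smul_sum, Finset.sum_comm]
    congr 1
    exact Finset.sum_congr rfl fun e _ => (sumOver_sum _ _).symm
  have h2 : ∑ n ∈ Finset.Icc 1 N, chGr (V.freeOperad n) - treeCh V.superChar N N ∈
      SymFun.ordIdeal k (N + 1) := by
    rw [h1, treeCh, ← Finset.sum_sub_distrib]
    refine Ideal.sum_mem _ fun r _ => ?_
    rw [← smul_sub, ← Finset.sum_sub_distrib]
    refine smul_mem_ordIdeal _ (Ideal.sum_mem _ fun e _ => ?_)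
    unfold sumOver
    rw [← Finset.sum_sub_distrib]
    refine Ideal.sum_mem _ fun val _ => ?_
    rw [← smul_sub, ← Finset.sum_sub_distrib]
    exact smul_mem_ordIdeal _ (Ideal.sum_mem _ fun α _ =>
      graftSum_sub_sum_graftPart_mem _ N e _ _ _ (card_flags_bounds N val).1)
  have h3 := Ideal.add_mem _ h h2
  rwa [sub_add_sub_cancel] at h3

end GradedCyclicModule

/-! ### The Legendre equation -/

namespace SymFun

variable {k : Type u} [Field k]

theorem dp₁_e₂ [CharZero k] : dp₁ (e₂ : SymFun k) = p 1 := by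
  have h2 : (2 : k) ≠ 0 := two_ne_zero
  have h := (MvPowerSeries.pderiv k (1 : ℕ+)).leibniz (p 1 : SymFun k) (p 1)
  have h1 : MvPowerSeries.pderiv k (1 : ℕ+) (p 1 : SymFun k) = 1 := by
    have := dp₁_pw (k := k) (n := 1) one_pos
    rwa [if_pos rfl] at this
  have h3 : MvPowerSeries.pderiv k (1 : ℕ+) (p 2 : SymFun k) = 0 := by
    have := dp₁_pw (k := k) (n := 2) two_pos
    rwa [if_neg (by norm_num)] at this
  rw [dp₁, e₂, Derivation.map_smul, map_sub, pow_two, h, h1, h3, sub_zero, smul_eq_mul, mul_one,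
    ← two_smul k, smul_smul, inv_mul_cancel₀ h2, one_smul]

theorem dp₁_sub (f g : SymFun k) : dp₁ (f - g) = dp₁ f - dp₁ g :=
  map_sub (MvPowerSeries.pderiv k (1 : ℕ+)) f g

theorem adams_sub (n : ℕ+) (f g : SymFun k) : adams n (f - g) = adams n f - adams n g := by
  simp only [← adamsHom_apply, map_sub]

/-- The values `c = -1` and `c = 1` cover `e₂` and `h₂`. Under `rk` the term in `p 2` disappears and
`f` does not reach degree two, so the quadratic coefficient is `1 / 2`. -/
theorem coeff_p_one_sq_add_mem_LambdaStar [CharZero k] (c : k) {f : SymFun k}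
    (hf : f ∈ ordIdeal k 3) : (2 : k)⁻¹ • (p 1 ^ 2 + c • p 2) + f ∈ LambdaStar k := by
  classical
  have h : ∀ n < 3, PowerSeries.coeff n (rk ((2 : k)⁻¹ • (p 1 ^ 2 + c • p 2) + f)) =
      (2 : k)⁻¹ * if n = 2 then 1 else 0 := by
    intro n hn
    rw [rk, PowerSeries.coeff_mk, map_add, mem_ordIdeal.1 hf _ (by
        rw [wt, Finsupp.weight_single]; simpa using hn), add_zero,
      MvPowerSeries.coeff_smul, map_add, MvPowerSeries.coeff_smul, p, p, MvPowerSeries.coeff_X_pow,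
      MvPowerSeries.coeff_X]
    have h1 : Finsupp.single (1 : ℕ+) n ≠ Finsupp.single (2 : ℕ+) 1 := by
      intro h
      have := DFunLike.congr_fun h 2
      simp at this
    rw [if_neg h1, mul_zero, add_zero]
    congr 1
    exact if_congr (Finsupp.single_injective _).eq_iff rfl rfl
  refine ⟨?_, ?_, ?_⟩
  · rw [h 0 (by norm_num)]; simp
  · rw [h 1 (by norm_num)]; simp
  · rw [h 2 (by norm_num)]; simp

end SymFun

namespace GradedCyclicModule

variable {k : Type u} [Field k] [CharZero k] {V : GradedCyclicModule.{u, w} k}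
  (hV : V.IsFiniteDimensional) (h2 : ∀ n ≤ 2, ∀ i, Subsingleton (V n i))
include hV

omit [CharZero k] in
include h2 in
theorem Ch_mem_ordIdeal : V.Ch ∈ SymFun.ordIdeal k 3 := by
  have h := Ch_sub_truncCh_mem hV h2 2
  rwa [truncCh, Finset.Icc_eq_empty (by norm_num), Finset.sum_empty, sub_zero] at h

theorem Ch_freeOperad_mem_ordIdeal : V.freeOperad.Ch ∈ SymFun.ordIdeal k 3 := by
  have h := Ch_freeOperad_sub_treeCh_mem hV 2
  have h1 : treeCh V.superChar 2 2 ∈ SymFun.ordIdeal k 3 := by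
    refine Ideal.sum_mem _ fun r _ => smul_mem_ordIdeal _ (Ideal.sum_mem _ fun e _ =>
      sumOver_mem_ordIdeal _ fun F _ vt α hF => ?_)
    rcases r with _ | r
    · rw [graftSum_of_isEmpty]
      exact zero_mem _
    · refine SymFun.ordIdeal_mono ?_ (graftSum_mem_ordIdeal V.superChar ∅ e vt α hF)
      rw [Fintype.card_fin]
      omega
  have h3 := Ideal.add_mem _ h h1
  rwa [sub_add_cancel] at h3

include h2

omit [CharZero k] in
theorem p_sub_dp₁_Ch_mem : (SymFun.p 1 - SymFun.dp₁ V.Ch) - SymFun.p 1 ∈ SymFun.ordIdeal k 2 := by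
  rw [sub_sub_cancel_left]
  exact (Ideal.neg_mem_iff _).2 (SymFun.dp₁_mem_ordIdeal (Ch_mem_ordIdeal hV h2))

/-- The limit of `plethysm_treeCh`: modulo each order, every occurrence of the two characteristics
may be replaced by its truncation, since plethysm, Adams operations and squares respect the
filtration and the derivative loses only one. -/
theorem plethysm_Ch_freeOperad :
    SymFun.plethysm V.freeOperad.Ch (SymFun.p 1 - SymFun.dp₁ V.Ch) =
      V.Ch + (2 : k)⁻¹ • (SymFun.adams 2 (SymFun.dp₁ V.Ch) - SymFun.dp₁ V.Ch ^ 2) := by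
  have hu := constantCoeff_eq_zero_of_sub_p_mem (p_sub_dp₁_Ch_mem hV h2)
  refine SymFun.eq_of_forall_sub_mem_ordIdeal fun M => ?_
  -- The shift by two meets the hypothesis `2 ≤ R` of `plethysm_treeCh`.
  let N := M + 2
  refine SymFun.ordIdeal_mono (show M ≤ N by omega) ?_
  let v := truncCh V.superChar N
  have hv := constantCoeff_eq_zero_of_sub_p_mem (one_sub_dp₁_truncCh (χ := V.superChar) N)
  have hw : V.Ch - v ∈ SymFun.ordIdeal k (N + 1) := Ch_sub_truncCh_mem hV h2 N
  have hdw : SymFun.dp₁ V.Ch - SymFun.dp₁ v ∈ SymFun.ordIdeal k N := by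
    rw [← SymFun.dp₁_sub]
    exact SymFun.dp₁_mem_ordIdeal hw
  have hA : SymFun.plethysm V.freeOperad.Ch (SymFun.p 1 - SymFun.dp₁ V.Ch) -
      SymFun.plethysm (treeCh V.superChar N N) (SymFun.p 1 - SymFun.dp₁ V.Ch) ∈
      SymFun.ordIdeal k N := by
    rw [← SymFun.plethysmHom_apply hu, ← SymFun.plethysmHom_apply hu, ← map_sub,
      SymFun.plethysmHom_apply]
    exact SymFun.plethysm_mem_ordIdeal hu
      (SymFun.ordIdeal_mono (Nat.le_succ N) (Ch_freeOperad_sub_treeCh_mem hV N))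
  have hB : SymFun.plethysm (treeCh V.superChar N N) (SymFun.p 1 - SymFun.dp₁ V.Ch) -
      SymFun.plethysm (treeCh V.superChar N N) (SymFun.p 1 - SymFun.dp₁ v) ∈
      SymFun.ordIdeal k N := by
    refine SymFun.plethysm_sub_plethysm_mem_ordIdeal _ hu hv ?_
    rw [sub_sub_sub_cancel_left]
    have := (Ideal.neg_mem_iff _).2 hdw
    rwa [neg_sub] at this
  have hC := SymFun.ordIdeal_mono (show N ≤ N + 3 by omega)
    (plethysm_treeCh N (superChar_isClassFun (V := V)) (show 2 ≤ N by omega))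
  have hD : v - V.Ch ∈ SymFun.ordIdeal k N := by
    rw [← neg_sub]
    exact (Ideal.neg_mem_iff _).2 (SymFun.ordIdeal_mono (Nat.le_succ N) hw)
  have hE : SymFun.adams 2 (SymFun.dp₁ V.Ch) - SymFun.adams 2 (SymFun.dp₁ v) ∈
      SymFun.ordIdeal k N := by
    rw [← SymFun.adams_sub]
    exact SymFun.ordIdeal_mono (by simp; omega) (SymFun.adams_mem_ordIdeal 2 hdw)
  have hF : SymFun.dp₁ V.Ch ^ 2 - SymFun.dp₁ v ^ 2 ∈ SymFun.ordIdeal k N := by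
    rw [sq_sub_sq]
    exact Ideal.mul_mem_left _ _ hdw
  have hG := smul_mem_ordIdeal (2 : k)⁻¹ (Ideal.sub_mem _ hF hE)
  have h := Ideal.add_mem _ (Ideal.add_mem _ hA hB) (Ideal.add_mem _ hC (Ideal.add_mem _ hD hG))
  convert h using 1
  simp only [smul_sub, v]
  ring

/-- Plethysm of `h₂` with `p 1 - d` is half of `(p 1 - d) ^ 2 + p 2 - adams 2 d`. The terms `d ^ 2`
and `adams 2 d` cancel against `plethysm_Ch_freeOperad`, and `p 2` cancels against `e₂`. -/
theorem legendreEquation : SymFun.LegendreEquation (SymFun.e₂ - V.Ch)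
    (SymFun.h₂ + V.freeOperad.Ch) := by
  have hk : (2 : k) ≠ 0 := two_ne_zero
  have hu := constantCoeff_eq_zero_of_sub_p_mem (p_sub_dp₁_Ch_mem hV h2)
  rw [SymFun.LegendreEquation, SymFun.dp₁_sub, SymFun.dp₁_e₂, ← SymFun.plethysmHom_apply hu, map_add,
    SymFun.h₂, map_smul, map_add, map_pow, SymFun.plethysmHom_apply, SymFun.plethysmHom_apply,
    SymFun.plethysmHom_apply, plethysm_Ch_freeOperad hV h2, SymFun.plethysm_p hu,
    SymFun.plethysm_p hu, SymFun.adams_one, SymFun.adams_sub, SymFun.adams_p, SymFun.e₂]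
  set d := SymFun.dp₁ V.Ch
  have h : (SymFun.p 1 : SymFun k) * (SymFun.p 1 - d) =
      (2 : k)⁻¹ • ((2 : k) • (SymFun.p 1 * (SymFun.p 1 - d))) := by
    rw [smul_smul, inv_mul_cancel₀ hk, one_smul]
  rw [h]
  have h' : (2 : k)⁻¹ • ((SymFun.p 1 - d) ^ 2 + (SymFun.p (2 * 1) - SymFun.adams 2 d)) +
      (V.Ch + (2 : k)⁻¹ • (SymFun.adams 2 d - d ^ 2)) +
      ((2 : k)⁻¹ • (SymFun.p 1 ^ 2 - SymFun.p 2) - V.Ch) =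
      (2 : k)⁻¹ • (((SymFun.p 1 - d) ^ 2 + (SymFun.p (2 * 1) - SymFun.adams 2 d)) +
        (SymFun.adams 2 d - d ^ 2) + (SymFun.p 1 ^ 2 - SymFun.p 2)) := by
    simp only [smul_add, smul_sub]
    ring
  rw [h']
  congr 1
  rw [two_smul, mul_one]
  ring

/-- Two solutions have the same plethysm with the derivative of `e₂ - V.Ch`, which is `p 1` plus
terms of higher order, so `plethysm_injective` gives uniqueness. -/
theorem isLegendreTransform : SymFun.IsLegendreTransform (SymFun.e₂ - V.Ch)
    (SymFun.h₂ + V.freeOperad.Ch) := by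
  refine ⟨?_, ?_, legendreEquation hV h2, fun g' _ hg' => ?_⟩
  · have := SymFun.coeff_p_one_sq_add_mem_LambdaStar (-1 : k)
      ((Ideal.neg_mem_iff _).2 (Ch_mem_ordIdeal hV h2))
    rwa [neg_one_smul, ← sub_eq_add_neg, ← sub_eq_add_neg] at this
  · have := SymFun.coeff_p_one_sq_add_mem_LambdaStar (1 : k) (Ch_freeOperad_mem_ordIdeal hV)
    rwa [one_smul] at this
  · have h := legendreEquation hV h2
    have hu := p_sub_dp₁_Ch_mem hV h2
    rw [SymFun.LegendreEquation, SymFun.dp₁_sub, SymFun.dp₁_e₂] at h hg'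
    exact SymFun.plethysm_injective hu (add_right_cancel (hg'.trans h.symm))

end GradedCyclicModule

/-! ### Expansion in the variables and integrality -/

namespace SymFun

section Expansion

variable {k : Type u} [Field k]

theorem coeff_powerSumX_eq_zero (n : ℕ+) {m : ℕ →₀ ℕ} (h : m.degree ≠ n) :
    MvPowerSeries.coeff m (powerSumX n : MvPowerSeries ℕ k) = 0 := by
  refine if_neg ?_
  rintro ⟨i, rfl⟩
  exact h (Finsupp.degree_single i (n : ℕ))

theorem hasSubst_powerSumX :
    MvPowerSeries.HasSubst (fun n : ℕ+ => (powerSumX n : MvPowerSeries ℕ k)) where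
  const_coeff n := by
    rw [← MvPowerSeries.coeff_zero_eq_constantCoeff_apply, coeff_powerSumX_eq_zero]
    · exact IsNilpotent.zero
    · simpa using n.ne_zero.symm
  coeff_zero d := by
    refine Set.Finite.subset (Set.finite_Iic (⟨d.degree + 1, Nat.succ_pos _⟩ : ℕ+)) ?_
    intro n hn
    have h : d.degree = n := by
      by_contra h
      exact hn (coeff_powerSumX_eq_zero n h)
    change (n : ℕ) ≤ d.degree + 1
    omega

/-- The expansion in the variables `xᵢ` as a homomorphism of algebras. -/
noncomputable def toXHom (k : Type u) [Field k] : SymFun k →ₐ[k] MvPowerSeries ℕ k :=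
  MvPowerSeries.substAlgHom hasSubst_powerSumX

theorem toXHom_apply (f : SymFun k) : toXHom k f = toX f :=
  MvPowerSeries.substAlgHom_apply _ _

theorem toXHom_p (n : ℕ+) : toXHom k (p n) = powerSumX n := by
  rw [toXHom_apply]
  exact MvPowerSeries.subst_X hasSubst_powerSumX n

theorem coeff_toX_eq_zero {f : SymFun k} {N : ℕ} (hf : f ∈ ordIdeal k N) {m : ℕ →₀ ℕ}
    (hm : m.degree < N) : MvPowerSeries.coeff m (toX f) = 0 := by
  rw [toX, MvPowerSeries.coeff_subst hasSubst_powerSumX]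
  refine finsum_eq_zero_of_forall_eq_zero fun e => ?_
  by_cases he : wt e < N
  · rw [mem_ordIdeal.1 hf e he, zero_smul]
  · refine smul_eq_zero_of_right _ (MvPowerSeries.coeff_of_lt_order
      (lt_of_lt_of_le ?_ (MvPowerSeries.le_order_prod _ _)))
    have h : (m.degree : ℕ∞) < (wt e : ℕ) := by exact_mod_cast hm.trans_le (not_lt.1 he)
    refine lt_of_lt_of_le h ?_
    rw [wt, Finsupp.weight_apply, Finsupp.sum, Nat.cast_sum]
    refine Finset.sum_le_sum fun i _ => le_trans ?_ (MvPowerSeries.le_order_pow _)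
    have hi : ((i : ℕ) : ℕ∞) ≤ (powerSumX i : MvPowerSeries ℕ k).order :=
      MvPowerSeries.le_order fun d hd => coeff_powerSumX_eq_zero i
        (ne_of_lt (by exact_mod_cast hd))
    refine le_trans ?_ (nsmul_le_nsmul_right hi _)
    simp

theorem isIntegral_iff {f : SymFun k} :
    IsIntegral f ↔ ∀ m, MvPowerSeries.coeff m (toXHom k f) ∈ (Int.castRingHom k).range := by
  simp only [IsIntegral, toXHom_apply, RingHom.mem_range, eq_intCast, eq_comm]

/-- The additive group of symmetric functions with integer coefficients. -/
def integral (k : Type u) [Field k] : AddSubgroup (SymFun k) where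
  carrier := {f | IsIntegral f}
  zero_mem' := isIntegral_iff.2 fun m => by simp
  add_mem' := fun {f g} hf hg => isIntegral_iff.2 fun m => by
    rw [map_add, map_add]
    exact add_mem (isIntegral_iff.1 hf m) (isIntegral_iff.1 hg m)
  neg_mem' := fun {f} hf => isIntegral_iff.2 fun m => by
    rw [map_neg, map_neg]
    exact neg_mem (isIntegral_iff.1 hf m)

/-- A monomial of degree `N` only sees the part of `f` of weight at most `N`, so integrality passes
to limits of the filtration. -/
theorem isIntegral_of_forall_sub_mem {f : SymFun k}
    (h : ∀ N, ∃ g ∈ integral k, f - g ∈ ordIdeal k N) : IsIntegral f := by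
  intro m
  obtain ⟨g, hg, hfg⟩ := h (m.degree + 1)
  obtain ⟨z, hz⟩ := hg m
  refine ⟨z, ?_⟩
  rw [← hz, ← sub_eq_zero, ← map_sub, ← toXHom_apply, ← toXHom_apply, ← map_sub, toXHom_apply]
  exact coeff_toX_eq_zero hfg (Nat.lt_succ_self _)

theorem p_mem_integral (n : ℕ+) : p n ∈ integral k := by
  refine isIntegral_iff.2 fun m => ?_
  rw [toXHom_p, MvPowerSeries.coeff_apply, powerSumX]
  split_ifs
  · exact one_mem _
  · exact zero_mem _

end Expansion

end SymFun

/-! ### Colourings invariant under a permutation -/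

section Colourings

variable {k : Type u} [Field k] {X Y : Type} [Fintype X] [Fintype Y]

/-- The monomial of a colouring: the number of times that each colour is used. -/
noncomputable def content (c : X → ℕ) : ℕ →₀ ℕ := ∑ x, Finsupp.single (c x) 1

theorem content_comp_equiv (θ : X ≃ Y) (c : Y → ℕ) : content (fun x => c (θ x)) = content c :=
  Equiv.sum_comp θ fun y => Finsupp.single (c y) 1

theorem apply_mem_support_content (c : X → ℕ) (x : X) : c x ∈ (content c).support := by
  rw [Finsupp.mem_support_iff, content, Finsupp.finsetSum_apply]
  refine (Finset.sum_pos' (fun _ _ => Nat.zero_le _) ⟨x, Finset.mem_univ _, ?_⟩).ne'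
  simp

instance (m : ℕ →₀ ℕ) : Finite {c : X → ℕ // content c = m} :=
  Finite.of_injective (β := X → m.support)
    (fun c x => ⟨c.1 x, by have := apply_mem_support_content c.1 x; rwa [c.2] at this⟩)
    fun c c' h => Subtype.ext (funext fun x => congrArg Subtype.val (congrFun h x))

/-- The colourings with a given monomial that are constant on the cycles of a permutation. -/
abbrev InvColouring (α : Perm X) (m : ℕ →₀ ℕ) : Type :=
  {c : {c : X → ℕ // content c = m} // ∀ x, c.1 (α x) = c.1 x}

theorem card_invColouring_permCongr (θ : X ≃ Y) (α : Perm X) (m : ℕ →₀ ℕ) :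
    Nat.card (InvColouring (θ.permCongr α) m) = Nat.card (InvColouring α m) := by
  refine Nat.card_congr (((θ.symm.arrowCongr (Equiv.refl ℕ)).subtypeEquiv fun c => ?_).subtypeEquiv
    fun c => ?_)
  · rw [← content_comp_equiv θ c]
    rfl
  · constructor
    · intro h x
      simpa using h (θ x)
    · intro h y
      obtain ⟨x, rfl⟩ := θ.surjective y
      simpa using h x

theorem content_sum (c : X ⊕ Y → ℕ) :
    content c = content (fun x => c (Sum.inl x)) + content (fun y => c (Sum.inr y)) :=
  Fintype.sum_sum_type _

theorem card_invColouring_sumCongr (α : Perm X) (β : Perm Y) (m : ℕ →₀ ℕ) :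
    Nat.card (InvColouring (Perm.sumCongr α β) m) =
      ∑ q ∈ Finset.HasAntidiagonal.antidiagonal m, Nat.card (InvColouring α q.1) * Nat.card (InvColouring β q.2) := by
  have e : InvColouring (Perm.sumCongr α β) m ≃
      Σ q : Finset.HasAntidiagonal.antidiagonal m, InvColouring α q.1.1 × InvColouring β q.1.2 :=
    { toFun := fun c => ⟨⟨(content (fun x => c.1.1 (Sum.inl x)), content (fun y => c.1.1 (Sum.inr y))),
        by rw [Finset.HasAntidiagonal.mem_antidiagonal, ← content_sum, c.1.2]⟩,
        ⟨⟨_, rfl⟩, fun x => c.2 (Sum.inl x)⟩, ⟨⟨_, rfl⟩, fun y => c.2 (Sum.inr y)⟩⟩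
      invFun := fun q => ⟨⟨Sum.elim q.2.1.1.1 q.2.2.1.1, by
          rw [content_sum]
          exact (congrArg₂ (· + ·) q.2.1.1.2 q.2.2.1.2).trans (Finset.HasAntidiagonal.mem_antidiagonal.1 q.1.2)⟩, by
          rintro (x | y)
          · exact q.2.1.2 x
          · exact q.2.2.2 y⟩
      left_inv := fun c => by
        refine Subtype.ext (Subtype.ext (funext ?_))
        rintro (x | y) <;> rfl
      right_inv := by
        rintro ⟨⟨⟨a, b⟩, _⟩, ⟨⟨c, hc⟩, _⟩, ⟨⟨c', hc'⟩, _⟩⟩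
        obtain rfl : content c = a := hc
        obtain rfl : content c' = b := hc'
        rfl }
  rw [Nat.card_congr e, Nat.card_sigma, ← Finset.sum_coe_sort (Finset.HasAntidiagonal.antidiagonal m)
    (fun q => Nat.card (InvColouring α q.1) * Nat.card (InvColouring β q.2))]
  exact Finset.sum_congr (by ext; simp) fun q _ => Nat.card_prod _ _

/-- A colouring that is constant on the only cycle uses a single colour `a + 1` times; these
colourings are the monomials of the power sum. -/
theorem card_invColouring_finRotate (a : ℕ) (m : ℕ →₀ ℕ) :
    (Nat.card (InvColouring (finRotate (a + 1)) m) : k) =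
      MvPowerSeries.coeff m (SymFun.powerSumX (a + 1).toPNat' : MvPowerSeries ℕ k) := by
  have hc : ∀ c : Fin (a + 1) → ℕ, (∀ x, c (finRotate (a + 1) x) = c x) → ∀ x, c x = c 0 :=
    fun c hc x => (eq_of_sameCycle hc (sameCycle_finRotate a x)).symm
  have hi : ∀ i : ℕ, content (fun _ : Fin (a + 1) => i) = Finsupp.single i (a + 1) := fun i => by
    rw [content, Finset.sum_const, Finset.card_univ, Fintype.card_fin, Finsupp.smul_single,
      smul_eq_mul, mul_one]
  rw [MvPowerSeries.coeff_apply, SymFun.powerSumX]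
  have hcoe : (((a + 1).toPNat' : ℕ+) : ℕ) = a + 1 := rfl
  rw [hcoe]
  split_ifs with h
  · obtain ⟨i, rfl⟩ := h
    rw [Nat.card_eq_one_iff_unique.2, Nat.cast_one]
    refine ⟨⟨fun c c' => Subtype.ext (Subtype.ext (funext fun x => ?_))⟩,
      ⟨⟨⟨fun _ => i, hi i⟩, fun _ => rfl⟩⟩⟩
    have key : ∀ c : InvColouring (finRotate (a + 1)) (Finsupp.single i (a + 1)), c.1.1 x = i := by
      intro c
      have := apply_mem_support_content c.1.1 x
      rw [c.1.2] at this
      simpa using Finsupp.support_single_subset this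
    rw [key, key]
  · have : IsEmpty (InvColouring (finRotate (a + 1)) m) := by
      refine ⟨fun c => h ⟨c.1.1 0, ?_⟩⟩
      rw [← hi]
      exact c.1.2.symm.trans (congrArg content (funext fun x => hc _ c.2 x))
    simp

/-- The coefficients of the cycle index count the colourings that are constant on the cycles. -/
theorem coeff_toXHom_cycProd (X : Type) [Fintype X] (α : Perm X) (m : ℕ →₀ ℕ) :
    MvPowerSeries.coeff m (SymFun.toXHom k (cycProd α fun x => pw k (per α x))) =
      Nat.card (InvColouring α m) := by
  revert m
  refine perm_cycle_induction (P := fun X _ α => ∀ m, MvPowerSeries.coeff m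
    (SymFun.toXHom k (cycProd α fun x => pw k (per α x))) = Nat.card (InvColouring α m))
    ?_ ?_ ?_ ?_ X α
  · intro X Y _ _ θ α ih m
    rw [card_invColouring_permCongr, ← ih, cycProd_permCongr]
    · congr 2
      refine cycProd_congr fun x => ?_
      rw [per_of_injective (α := α) θ.injective (fun x => by simp)]
    · intro y; rw [per_apply]
  · intro X _ _ α m
    rw [cycProd_of_isEmpty, map_one]
    classical
    rw [MvPowerSeries.coeff_one]
    have h0 : ∀ c : X → ℕ, content c = 0 := fun c => by simp [content]
    split_ifs with h
    · subst h
      rw [Nat.card_eq_one_iff_unique.2, Nat.cast_one]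
      exact ⟨⟨fun c c' => Subtype.ext (Subtype.ext (funext fun x => isEmptyElim x))⟩,
        ⟨⟨⟨isEmptyElim, h0 _⟩, isEmptyElim⟩⟩⟩
    · have : IsEmpty (InvColouring α m) := ⟨fun c => h (by rw [← c.1.2, h0])⟩
      simp
  · intro X Y _ _ α β h1 h2 m
    rw [cycProd_sumCongr, map_mul, MvPowerSeries.coeff_mul, card_invColouring_sumCongr, Nat.cast_sum]
    · refine Finset.sum_congr rfl fun q _ => ?_
      rw [Nat.cast_mul, ← h1, ← h2]
      congr 3
      · refine cycProd_congr fun x => ?_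
        rw [per_of_injective (α := α) Sum.inl_injective (fun x => by simp)]
      · refine cycProd_congr fun x => ?_
        rw [per_of_injective (α := β) Sum.inr_injective (fun x => by simp)]
    · intro y; rw [per_apply]
  · intro a m
    rw [card_invColouring_finRotate, cycProd_finRotate]
    · rw [per_finRotate, pw, SymFun.toXHom_p]
    · intro y; rw [per_apply]

end Colourings

/-! ### Permutation representations -/

section PermutationRepresentation

variable (k : Type u) [Field k] {G C : Type} [Group G] [MulAction G C]

/-- The representation of a group on the functions on a set on which it acts. -/
def funRepresentation (G C : Type) [Group G] [MulAction G C] : Representation k G (C → k) where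
  toFun g := LinearMap.funLeft k k (g⁻¹ • · : C → C)
  map_one' := by
    ext f c
    simp [LinearMap.funLeft_apply]
  map_mul' g h := by
    refine LinearMap.ext fun f => funext fun c => ?_
    simp [LinearMap.funLeft_apply, mul_smul]

theorem character_funRepresentation [Finite C] (g : G) :
    (funRepresentation k G C).character g = Nat.card {c : C // g • c = c} := by
  classical
  let _ : Fintype C := Fintype.ofFinite C
  rw [Representation.character, LinearMap.trace_eq_matrix_trace k (Pi.basisFun k C), Matrix.trace,
    Nat.card_eq_fintype_card, Fintype.card_subtype, Finset.card_eq_sum_ones, Nat.cast_sum,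
    Finset.sum_filter]
  refine Finset.sum_congr rfl fun c _ => ?_
  rw [Matrix.diag_apply, LinearMap.toMatrix_apply, Pi.basisFun_apply, Pi.basisFun_repr]
  change (Pi.single c (1 : k) : C → k) (g⁻¹ • c) = _
  rw [Pi.single_apply, inv_smul_eq_iff, Nat.cast_one]
  simp only [eq_comm]

/-- The number of fixed points is the character of the functions on `C`, so the average is that of
the character of a tensor product, which is the dimension of its invariants. -/
theorem exists_nat_eq_average_trace_mul_card [CharZero k] [Fintype G] [Finite C] {W : Type w}
    [AddCommGroup W] [Module k W] [Module.Finite k W] (ρ : Representation k G W) :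
    ∃ z : ℕ, (Nat.card G : k)⁻¹ * ∑ g : G, LinearMap.trace k W (ρ g) *
      Nat.card {c : C // g • c = c} = z := by
  have h : (Nat.card G : k) ≠ 0 := Nat.cast_ne_zero.2 Nat.card_pos.ne'
  have := invertibleOfNonzero h
  refine ⟨_, Eq.trans ?_ (Representation.card_inv_mul_sum_char_eq_finrank
    (ρ.tprod (funRepresentation k G C)))⟩
  congr 1
  refine Finset.sum_congr rfl fun g _ => ?_
  rw [Representation.char_tensor, Pi.mul_apply, character_funRepresentation]
  rfl

end PermutationRepresentation

/-- The action of the symmetric group on the colourings. -/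
instance {n : ℕ} (m : ℕ →₀ ℕ) : MulAction (Perm (Fin n)) {c : Fin n → ℕ // content c = m} where
  smul σ c := ⟨fun x => c.1 (σ⁻¹ x), (content_comp_equiv σ⁻¹ c.1).trans c.2⟩
  one_smul _ := rfl
  mul_smul σ τ c := Subtype.ext (funext fun x => by
    change c.1 ((σ * τ)⁻¹ x) = c.1 (τ⁻¹ (σ⁻¹ x))
    rw [mul_inv_rev]; rfl)

theorem card_invColouring_eq {n : ℕ} (σ : Perm (Fin n)) (m : ℕ →₀ ℕ) :
    Nat.card (InvColouring σ m) = Nat.card {c : {c : Fin n → ℕ // content c = m} // σ • c = c} := by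
  refine Nat.card_congr (Equiv.subtypeEquivRight fun c => ?_)
  rw [← eq_inv_smul_iff, Subtype.ext_iff, funext_iff]
  refine forall_congr' fun x => ?_
  change _ ↔ c.1 x = c.1 (σ⁻¹⁻¹ x)
  rw [inv_inv]
  exact eq_comm

/-! ### Integrality of the characteristics -/

namespace SymFun

variable {k : Type u} [Field k] [CharZero k]

/-- By `coeff_toXHom_cycProd` a coefficient of the cycle index counts the colourings fixed by `σ`,
so each coefficient of the average is a dimension of invariants. -/
theorem average_trace_smul_cycleIndex_mem_integral {n : ℕ} {W : Type w} [AddCommGroup W]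
    [Module k W] [Module.Finite k W] (ρ : Representation k (Perm (Fin n)) W) :
    (n.factorial : k)⁻¹ • ∑ σ : Perm (Fin n), LinearMap.trace k W (ρ σ) • cycleIndex σ ∈
      integral k := by
  refine isIntegral_iff.2 fun m => ?_
  obtain ⟨z, hz⟩ := exists_nat_eq_average_trace_mul_card k
    (C := {c : Fin n → ℕ // content c = m}) ρ
  refine ⟨z, ?_⟩
  rw [eq_intCast, Int.cast_natCast, ← hz, map_smul, MvPowerSeries.coeff_smul, map_sum, map_sum,
    Nat.card_eq_fintype_card, Fintype.card_perm, Fintype.card_fin]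
  congr 1
  refine Finset.sum_congr (by ext; simp) fun σ _ => ?_
  rw [map_smul, MvPowerSeries.coeff_smul, cycleIndex_eq, coeff_toXHom_cycProd,
    card_invColouring_eq]

/-- `h₂` is the characteristic of the trivial representation of the symmetric group on two letters.
-/
theorem h₂_mem_integral : (h₂ : SymFun k) ∈ integral k := by
  have h := average_trace_smul_cycleIndex_mem_integral
    (Representation.trivial k (Perm (Fin 2)) k)
  have hu : (Finset.univ : Finset (Perm (Fin 2))) = {1, finRotate 2} := by decide
  have h1 : (cycleIndex (1 : Perm (Fin 2)) : SymFun k) = p 1 ^ 2 := by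
    rw [cycleIndex_eq, cycProd_one, Fin.prod_univ_two, sq]
    have : ∀ x : Fin 2, per (1 : Perm (Fin 2)) x = 1 := fun x =>
      minimalPeriod_eq_one_iff_isFixedPt.2 rfl
    rw [this, this]
    rfl
  have h2 : (cycleIndex (finRotate 2) : SymFun k) = p 2 := by
    rw [cycleIndex_eq, cycProd_finRotate 1 (fun y => by rw [per_apply]), per_finRotate]
    rfl
  rw [Finset.sum_congr (by ext; simp : _ = Finset.univ) fun _ _ => rfl, hu,
    Finset.sum_pair (by decide), h1, h2] at h
  simpa [h₂] using h

theorem e₂_mem_integral : (e₂ : SymFun k) ∈ integral k := by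
  have h : (e₂ : SymFun k) = h₂ - p 2 := by
    have : (p 2 : SymFun k) = (2 : k)⁻¹ • (p 2 + p 2) := by
      rw [← two_smul k, smul_smul, inv_mul_cancel₀ two_ne_zero, one_smul]
    rw [e₂, h₂]
    nth_rw 3 [this]
    rw [← smul_sub]
    congr 1
    abel
  rw [h]
  exact sub_mem h₂_mem_integral (p_mem_integral 2)

end SymFun

namespace GradedCyclicModule

variable {k : Type u} [Field k] [CharZero k]

theorem chGr_mem_integral {V : GradedCyclicModule.{u, w} k} (hV : V.IsFiniteDimensional) (n : ℕ) :
    chGr (V n) ∈ SymFun.integral k := by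
  refine finsum_induction (· ∈ SymFun.integral k) (zero_mem _) (fun _ _ => add_mem)
    fun i => zsmul_mem ?_ _
  have := hV.finite n i
  have h := SymFun.average_trace_smul_cycleIndex_mem_integral (V n i).ρ
  rw [chRep]
  convert h

theorem Ch_mem_integral {V : GradedCyclicModule.{u, w} k} (hV : V.IsFiniteDimensional) :
    V.Ch ∈ SymFun.integral k :=
  SymFun.isIntegral_of_forall_sub_mem fun N =>
    ⟨_, sum_mem fun n _ => chGr_mem_integral hV n,
      SymFun.ordIdeal_mono (Nat.le_succ N) (Ch_sub_mem_ordIdeal hV N)⟩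

end GradedCyclicModule

end

theorem mainTheorem8 {k : Type u} [Field k] [CharZero k] (V : CyclicModule.{u, w} k)
    (hV : ∀ n ≤ 2, ∀ i : ℤ, Subsingleton ((V n).X i))
    (hfin : V.graded.IsFiniteDimensional) :
    V.graded.freeOperad.IsFiniteDimensional ∧
    SymFun.IsIntegral (SymFun.e₂ - V.graded.Ch) ∧
    SymFun.IsIntegral (SymFun.h₂ + V.graded.freeOperad.Ch) ∧
    SymFun.IsLegendreTransform (SymFun.e₂ - V.graded.Ch) (SymFun.h₂ + V.graded.freeOperad.Ch) :=
  have hT := GradedCyclicModule.freeOperad_isFiniteDimensional hfin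
  ⟨hT, sub_mem SymFun.e₂_mem_integral (GradedCyclicModule.Ch_mem_integral hfin),
    add_mem SymFun.h₂_mem_integral (GradedCyclicModule.Ch_mem_integral hT),
    GradedCyclicModule.isLegendreTransform hfin hV⟩
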